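/- **Orders and twisted Alexander polynomials.** Let $\mathbb F$ be a field. For a finitely presented module $A$ over a Laurent polynomial ring $\Lambda$ over $\mathbb F$, with presentation $\Lambda^r\xrightarrow{P}\Lambda^s\to A\to 0$, let $E_0(A)$ be the ideal generated by the $s\times s$ minors of $P$; the *order* of $A$ is a generator of the smallest principal ideal containing $E_0(A)$, well defined up to multiplication by a unit of $\Lambda$. Let $M$ be a compact connected orientable 3-manifold, $\psi:\pi_1(M)\to FH_1(M)=H_1(M;\mathbb Z)/\mathrm{torsion}$ the natural surjection, $\Lambda=\mathbb F[FH_1(M)]$, and $\alpha:\pi_1(M)\to \mathrm{GL}(\mathbb F,k)$ a representation. Let $g\in\pi_1(M)$ act on $\mathbb F^k\otimes_{\mathbb F}\Lambda=\Lambda^k$ by $g(v\otimes p)=\alpha(g)v\otimes\psi(g)p$ and let $C_*(\tilde M)$ be the singular chain complex of the universal cover, a right $\mathbb Z[\pi_1(M)]$-module by $\sigma\cdot g=g^{-1}\sigma$. Then $\Delta_M^{\alpha,j}\in\Lambda$ denotes the order of $H_j(C_*(\tilde M)\otimes_{\mathbb Z[\pi_1(M)]}\Lambda^k)$, and $\Delta_M^\alpha:=\Delta_M^{\alpha,1}$.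 For a knot or link $L\subset S^3$ with exterior $X(L)$ (the complement of an open tubular neighbourhood), write $\Delta_L^{\alpha,j}=\Delta_{X(L)}^{\alpha,j}$. The degree of a nonzero one-variable Laurent polynomial is the difference between its largest and its smallest exponent. **Hopf-like links.** A two-component link $L=K_1\cup K_2\subset S^3$ is *Hopf-like* if it is obtained from the Hopf link $H_1\cup H_2$ by tying a (tame) knot into each component: there are disjoint balls $B_1,B_2\subset S^3$ such that $B_i$ is a standard ball around a point of $H_i$, meeting the Hopf link in an unknotted arc of $H_i$, and $K_i$ coincides with $H_i$ outside the interior of $B_i$ and is arbitrary inside $B_i$. Put $P_i=X(L)\cap B_i$; the inclusion $P_i\subset X(K_i)$ is a homotopy equivalence. Let $\mu_i$ be the meridian of $K_i$, a loop in $P_i$ running once around the annulus $X(L)\cap\partial B_i$, and let $x_i$ be its homology class, so that $\mathbb F[H_1(X(L);\mathbb Z)]=\mathbb F[x_1^{\pm1},x_2^{\pm1}]$ and $\mathbb F[H_1(X(K_i);\mathbb Z)]=\mathbb F[x_i^{\pm1}]$. A representation $\alpha:\pi_1(X(L))\to\mathrm{GL}(\mathbb F,k)$ induces, by $\pi_1(X(K_i))\cong\pi_1(P_i)\to\pi_1(X(L))$,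 representations of $\pi_1(X(K_i))$, also denoted by $\alpha$. **Proposition.** Let $L=K_1\cup K_2$ be a Hopf-like link and $\alpha:\pi_1(X(L))\to\mathrm{GL}(\mathbb F,k)$ a representation with $\Delta_{K_i}^\alpha(x_i)\neq 0$ for $i=1,2$. Then $\Delta_{K_i}^{\alpha,0}(x_i)\ne 0$ for $i=1,2$ and, up to multiplication by units, $$\Delta_L^\alpha(x_1,x_2)=\Delta_1(x_1)\,\Delta_2(x_2)\in\mathbb F[x_1^{\pm1},x_2^{\pm1}],$$ where $$\Delta_i(x_i)=\Delta_{K_i}^\alpha(x_i)\,\frac{\det(\alpha(\mu_i)x_i-\mathrm{id})}{\Delta_{K_i}^{\alpha,0}(x_i)}\in\mathbb F[x_i^{\pm1}],\qquad i=1,2.$$ In particular $$\deg\Delta_i(x_i)=\deg\Delta_{K_i}^\alpha(x_i)+k-\deg\Delta_{K_i}^{\alpha,0}(x_i),\qquad i=1,2.$$ -/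

import Mathlib

/-! ### Orders of modules -/

/-- The zeroth elementary ideal of the module presented by the matrix `P` with `r` relations (rows)
and `s` generators (columns): the ideal generated by the `s × s` minors of `P`. It is `⊤` for
`s = 0` and `⊥` for `s > r` (a selection of rows with a repetition contributes the minor `0`). -/
def elementaryIdeal {R : Type*} [CommRing R] {r s : ℕ} (P : Matrix (Fin r) (Fin s) R) : Ideal R :=
  Ideal.span (Set.range fun f : Fin s → Fin r => (P.submatrix f id).det)

/-- `d` is an order of the module `A`: for a finite presentation `R^r → R^s → A → 0` of `A`,
the ideal `(d)` is the smallest principal ideal containing the zeroth elementary ideal. -/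
def IsOrder {R : Type*} [CommRing R] (A : Type*) [AddCommGroup A] [Module R A] (d : R) : Prop :=
  ∃ (r s : ℕ) (P : Matrix (Fin r) (Fin s) R) (q : (Fin s → R) →ₗ[R] A),
    Function.Surjective q ∧ LinearMap.range P.vecMulLinear = LinearMap.ker q ∧
    elementaryIdeal P ≤ Ideal.span {d} ∧
    ∀ e : R, elementaryIdeal P ≤ Ideal.span {e} → Ideal.span {d} ≤ Ideal.span {e}

/-! ### Twisted homology -/

/-- A singular `n`-simplex of the universal cover of `(X, x₀)`. The points of the universal cover
over `x` are the homotopy classes of paths from `x₀` to `x`, so such a simplex is a singular simplex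
of `X` together with a lift to classes of paths, continuity of the lift meaning that it is
compatible with moving along paths in the simplex. -/
@[ext] structure LiftedSimplex (X : Type*) [TopologicalSpace X] (x₀ : X) (n : ℕ) where
  toMap : C(stdSimplex ℝ (Fin (n + 1)), X)
  lift : ∀ s, Path.Homotopic.Quotient x₀ (toMap s)
  lift_path : ∀ (s t : stdSimplex ℝ (Fin (n + 1))) (τ : Path s t),
    lift t = (lift s).trans (Path.Homotopic.Quotient.mk (τ.map toMap.continuous))

/-- The inclusion of the `i`-th face of the standard simplex. -/
noncomputable def faceInclusion (n : ℕ) (i : Fin (n + 2)) :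
    C(stdSimplex ℝ (Fin (n + 1)), stdSimplex ℝ (Fin (n + 2))) :=
  ⟨stdSimplex.map (Fin.succAbove i), stdSimplex.continuous_map _⟩

namespace LiftedSimplex

/-- The `i`-th face of a singular simplex of the universal cover. -/
noncomputable def face {X : Type*} [TopologicalSpace X] {x₀ : X} {n : ℕ} (i : Fin (n + 2))
    (σ : LiftedSimplex X x₀ (n + 1)) : LiftedSimplex X x₀ n where
  toMap := σ.toMap.comp (faceInclusion n i)
  lift s := σ.lift (faceInclusion n i s)
  lift_path s t τ :=
    σ.lift_path (faceInclusion n i s) (faceInclusion n i t)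
      (τ.map (faceInclusion n i).continuous)

/-- The right action `σ · g = g⁻¹ σ` of the fundamental group on the singular simplices of the
universal cover. (In the fundamental group of Mathlib, `g * h` is the loop `h` followed by the
loop `g`; the canonical left action of `g` on path classes is therefore precomposition with the
loop `g⁻¹`.) -/
noncomputable def act {X : Type*} [TopologicalSpace X] {x₀ : X} {n : ℕ}
    (σ : LiftedSimplex X x₀ n) (g : FundamentalGroup X x₀) : LiftedSimplex X x₀ n where
  toMap := σ.toMap
  lift s := (FundamentalGroup.toPath g).trans (σ.lift s)
  lift_path s t τ := by
    rw [σ.lift_path s t τ]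
    exact (CategoryTheory.Category.assoc (FundamentalGroup.toArrow g)
      (show FundamentalGroupoid.mk x₀ ⟶ FundamentalGroupoid.mk (σ.toMap s) from σ.lift s)
      (show FundamentalGroupoid.mk (σ.toMap s) ⟶ FundamentalGroupoid.mk (σ.toMap t) from
        Path.Homotopic.Quotient.mk (τ.map σ.toMap.continuous))).symm

end LiftedSimplex

/-- The action of `g ∈ π₁(X, x₀)` on `F^k ⊗ F[A] = F[A]^k`: it sends `v ⊗ p` to
`α(g) v ⊗ ψ(g) p`. -/
noncomputable def twistedAction {F : Type*} [Field F] {k : ℕ} {A : Type*} [AddCommGroup A]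
    {G : Type*} [Group G] (α : G →* GL (Fin k) F) (ψ : G →* Multiplicative A) (g : G) :
    (Fin k → AddMonoidAlgebra F A) →ₗ[AddMonoidAlgebra F A] (Fin k → AddMonoidAlgebra F A) :=
  AddMonoidAlgebra.single (Multiplicative.toAdd (ψ g)) (1 : F) •
    Matrix.toLin' ((α g).val.map (algebraMap F (AddMonoidAlgebra F A)))

section TwistedHomology

variable {F : Type*} [Field F] {k : ℕ} {A : Type*} [AddCommGroup A]
  {X : Type*} [TopologicalSpace X] {x₀ : X}
  (α : FundamentalGroup X x₀ →* GL (Fin k) F) (ψ : FundamentalGroup X x₀ →* Multiplicative A)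

/-- The relations `σ · g ⊗ v = σ ⊗ g v` that cut the tensor product over `ℤ[π₁(X, x₀)]` out of the
tensor product over `ℤ`, the latter being the module of finitely supported functions from the
simplices to `F[A]^k`. -/
noncomputable def twistedRelations (n : ℕ) :
    Submodule (AddMonoidAlgebra F A) (LiftedSimplex X x₀ n →₀ (Fin k → AddMonoidAlgebra F A)) :=
  Submodule.span _ {c | ∃ (σ : LiftedSimplex X x₀ n) (g : FundamentalGroup X x₀)
    (v : Fin k → AddMonoidAlgebra F A),
    c = Finsupp.single (σ.act g) v - Finsupp.single σ (twistedAction α ψ g v)}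

/-- The twisted singular chains: the tensor product over `ℤ[π₁(X, x₀)]` of the singular chains of
the universal cover with `F[A]^k`. -/
abbrev TwistedChains (n : ℕ) : Type _ :=
  (LiftedSimplex X x₀ n →₀ (Fin k → AddMonoidAlgebra F A)) ⧸ twistedRelations α ψ n

/-- The singular boundary operator of the universal cover, tensored over `ℤ` with `F[A]^k`. -/
noncomputable def freeBoundary (F : Type*) [Field F] (k : ℕ) (A : Type*) [AddCommGroup A]
    {X : Type*} [TopologicalSpace X] (x₀ : X) (n : ℕ) :
    (LiftedSimplex X x₀ (n + 1) →₀ (Fin k → AddMonoidAlgebra F A)) →ₗ[AddMonoidAlgebra F A]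
      (LiftedSimplex X x₀ n →₀ (Fin k → AddMonoidAlgebra F A)) :=
  ∑ i : Fin (n + 2), ((-1 : AddMonoidAlgebra F A) ^ (i : ℕ)) •
    Finsupp.lmapDomain (Fin k → AddMonoidAlgebra F A) (AddMonoidAlgebra F A)
      (LiftedSimplex.face i)

theorem freeBoundary_single (n : ℕ) (σ : LiftedSimplex X x₀ (n + 1))
    (v : Fin k → AddMonoidAlgebra F A) :
    freeBoundary F k A x₀ n (Finsupp.single σ v) =
      ∑ i : Fin (n + 2), ((-1 : AddMonoidAlgebra F A) ^ (i : ℕ)) • Finsupp.single (σ.face i) v := by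
  simp [freeBoundary, LinearMap.sum_apply]

theorem twistedRelations_le_comap (n : ℕ) :
    twistedRelations α ψ (n + 1) ≤ (twistedRelations α ψ n).comap (freeBoundary F k A x₀ n) := by
  rw [twistedRelations, Submodule.span_le]
  rintro _ ⟨σ, g, v, rfl⟩
  rw [SetLike.mem_coe, Submodule.mem_comap, map_sub, freeBoundary_single, freeBoundary_single,
    ← Finset.sum_sub_distrib]
  refine Submodule.sum_mem _ fun i _ => ?_
  rw [← smul_sub]
  exact Submodule.smul_mem _ _ (Submodule.subset_span ⟨σ.face i, g, v, rfl⟩)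

/-- The boundary operator of the twisted singular chain complex. -/
noncomputable def twistedBoundary (n : ℕ) :
    TwistedChains α ψ (n + 1) →ₗ[AddMonoidAlgebra F A] TwistedChains α ψ n :=
  Submodule.mapQ _ _ (freeBoundary F k A x₀ n) (twistedRelations_le_comap α ψ n)

/-- The cycles of the twisted singular chain complex. -/
noncomputable def twistedCycles :
    (n : ℕ) → Submodule (AddMonoidAlgebra F A) (TwistedChains α ψ n)
  | 0 => ⊤
  | n + 1 => LinearMap.ker (twistedBoundary α ψ n)

/-- The `n`-th twisted Alexander module of `(X, ψ, α)`. -/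
abbrev TwistedHomology (n : ℕ) : Type _ :=
  twistedCycles α ψ n ⧸
    (LinearMap.range (twistedBoundary α ψ n)).submoduleOf (twistedCycles α ψ n)

/-- `Δ` is an `n`-th twisted Alexander polynomial of `(X, ψ, α)`. -/
def IsTwistedAlexander (n : ℕ) (Δ : AddMonoidAlgebra F A) : Prop :=
  IsOrder (TwistedHomology α ψ n) Δ

end TwistedHomology

/-- `ψ` is the natural surjection of `G = π₁` onto the maximal free abelian quotient
`FH₁ = H₁ / torsion`, the latter being written as `A`. -/
def IsNaturalSurjection {G A : Type*} [Group G] [AddCommGroup A]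
    (ψ : G →* Multiplicative A) : Prop :=
  Function.Surjective ψ ∧ ∀ g : G, ψ g = 1 ↔ IsOfFinOrder (Abelianization.of g)

/-! ### Knots and Hopf-like links -/

/-- The 3-sphere, as the unit sphere of `ℂ²`. -/
abbrev S3 : Type := Metric.sphere (0 : EuclideanSpace ℂ (Fin 2)) 1

/-- A tame knot in the 3-sphere with an open tubular neighbourhood: the knot is the core
`S¹ × {0}` of an embedded solid torus `S¹ × {|u| ≤ 2}`, and its tubular neighbourhood is the open
solid torus `S¹ × {|u| < 1}`. -/
structure ThickenedKnot where
  toFun : Circle × Metric.closedBall (0 : ℂ) 2 → S3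
  isEmbedding : Topology.IsEmbedding toFun
  isOpen_nbhd : IsOpen (toFun '' {q | ‖(q.2 : ℂ)‖ < 1})

namespace ThickenedKnot

/-- The knot itself. -/
def core (K : ThickenedKnot) : Set S3 := K.toFun '' {q | (q.2 : ℂ) = 0}

/-- The open tubular neighbourhood of the knot. -/
def nbhd (K : ThickenedKnot) : Set S3 := K.toFun '' {q | ‖(q.2 : ℂ)‖ < 1}

/-- The exterior of the knot. -/
def exterior (K : ThickenedKnot) : Set S3 := K.nbhdᶜ

end ThickenedKnot

/-- A Hopf-like link `K 0 ∪ K 1`: the Hopf link with a knot tied locally into each component.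

In the 3-sphere `|z₀|² + |z₁|² = 1` the standard Hopf link has the components `H₀ = {z₁ = 0}` and
`H₁ = {z₀ = 0}`, with tubular neighbourhoods `{|z₁| < 1/2}` and `{|z₀| < 1/2}`. The disjoint balls
`Bᵢ = {Re zᵢ ≥ 4/5}` meet `Hᵢ` in an arc and are disjoint from the neighbourhood of the other
component. Up to a homeomorphism `h` of the 3-sphere, `K i` agrees with `Hᵢ` outside the interior
of `Bᵢ`, tubular neighbourhoods included, and is arbitrary inside `Bᵢ`. -/
structure HopfLikeLink where
  K : Fin 2 → ThickenedKnot
  h : S3 ≃ₜ S3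
  core_iff : ∀ (i : Fin 2) (p : S3), (p.1 i).re ≤ 4 / 5 →
    (h p ∈ (K i).core ↔ p.1 (1 - i) = 0)
  nbhd_iff : ∀ (i : Fin 2) (p : S3), (p.1 i).re ≤ 4 / 5 →
    (h p ∈ (K i).nbhd ↔ ‖p.1 (1 - i)‖ < 1 / 2)

namespace HopfLikeLink

/-- The exterior `X(L)` of the link. -/
def exterior (L : HopfLikeLink) : Set S3 := ⋂ i, (L.K i).exterior

/-- The piece `Pᵢ = X(L) ∩ Bᵢ` of the link exterior, which is cut off by the annulus
`Dᵢ = X(L) ∩ ∂Bᵢ` and is a copy of the exterior of `K i`. -/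
def piece (L : HopfLikeLink) (i : Fin 2) : Set S3 :=
  L.exterior ∩ L.h '' {p | 4 / 5 ≤ (p.1 i).re}

/-- The point `zᵢ = 4/5`, `z₁₋ᵢ = (3/5) e^{2π√-1 t}` of the sphere `∂Bᵢ`. -/
noncomputable def circlePoint (i : Fin 2) (t : ℝ) : S3 :=
  ⟨WithLp.toLp 2 fun j => if j = i then 4 / 5
      else 3 / 5 * Complex.exp ((2 * Real.pi * t : ℝ) * Complex.I), by
    rw [mem_sphere_zero_iff_norm, EuclideanSpace.norm_eq, Real.sqrt_eq_one]
    fin_cases i <;> simp [Complex.norm_exp_ofReal_mul_I, -Complex.ofReal_mul] <;> norm_num⟩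

theorem circlePoint_self (i : Fin 2) (t : ℝ) : (circlePoint i t).1 i = 4 / 5 := by
  simp [circlePoint]

theorem circlePoint_other (i : Fin 2) (t : ℝ) :
    (circlePoint i t).1 (1 - i) =
      3 / 5 * Complex.exp ((2 * Real.pi * t : ℝ) * Complex.I) := by
  fin_cases i <;> simp [circlePoint]

theorem continuous_circlePoint (i : Fin 2) : Continuous (circlePoint i) := by
  refine Continuous.subtype_mk ((PiLp.continuous_toLp 2 _).comp ?_) _
  refine continuous_pi fun j => ?_
  split_ifs <;> fun_prop

theorem circlePoint_mem_piece (L : HopfLikeLink) (i : Fin 2) (t : ℝ) :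
    L.h (circlePoint i t) ∈ L.piece i := by
  have hn : ‖(circlePoint i t).1 (1 - i)‖ = 3 / 5 := by
    rw [circlePoint_other, norm_mul, Complex.norm_exp_ofReal_mul_I]; norm_num
  have hs : ((circlePoint i t).1 i).re = 4 / 5 := by rw [circlePoint_self]; norm_num
  have ho : ((circlePoint i t).1 (1 - i)).re ≤ 4 / 5 :=
    (Complex.re_le_norm _).trans (by rw [hn]; norm_num)
  refine ⟨Set.mem_iInter.2 fun j => ?_, ⟨_, hs.ge, rfl⟩⟩
  by_cases hj : j = i
  · subst hj
    change ¬ _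
    rw [L.nbhd_iff j _ hs.le, hn]; norm_num
  · obtain rfl : j = 1 - i := by clear hn hs ho; revert i j; decide
    change ¬ _
    rw [L.nbhd_iff _ _ ho, sub_sub_cancel, circlePoint_self]; norm_num

/-- The base point of `Pᵢ`; it lies on the annulus `Dᵢ`. -/
noncomputable def pieceBase (L : HopfLikeLink) (i : Fin 2) : L.piece i :=
  ⟨L.h (circlePoint i 0), L.circlePoint_mem_piece i 0⟩

/-- The meridian of `K i`, as a loop in `Pᵢ`. It runs once around the annulus `Dᵢ`. -/
noncomputable def meridianLoop (L : HopfLikeLink) (i : Fin 2) :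
    Path (L.pieceBase i) (L.pieceBase i) where
  toFun t := ⟨L.h (circlePoint i t), L.circlePoint_mem_piece i t⟩
  continuous_toFun := by
    refine Continuous.subtype_mk (L.h.continuous.comp ?_) _
    exact (continuous_circlePoint i).comp continuous_subtype_val
  source' := rfl
  target' := by
    refine Subtype.ext (congrArg L.h (Subtype.ext ?_))
    simp [circlePoint, Complex.exp_two_pi_mul_I]

/-- The inclusion of `Pᵢ` into the link exterior. -/
noncomputable def pieceToLink (L : HopfLikeLink) (i : Fin 2) : C(L.piece i, L.exterior) :=
  ContinuousMap.inclusion Set.inter_subset_left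

/-- The inclusion of `Pᵢ` into the exterior of `K i`. -/
noncomputable def pieceToKnot (L : HopfLikeLink) (i : Fin 2) : C(L.piece i, (L.K i).exterior) :=
  ContinuousMap.inclusion (Set.inter_subset_left.trans (Set.iInter_subset _ i))

/-- The base point of the exterior of `K i`. -/
noncomputable def knotBase (L : HopfLikeLink) (i : Fin 2) : (L.K i).exterior :=
  L.pieceToKnot i (L.pieceBase i)

/-- The homomorphism from the fundamental group of `Pᵢ` to that of the exterior of `K i`. -/
noncomputable def toKnotGroup (L : HopfLikeLink) (i : Fin 2) :
    FundamentalGroup (L.piece i) (L.pieceBase i) →*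
      FundamentalGroup (L.K i).exterior (L.knotBase i) :=
  FundamentalGroup.map (L.pieceToKnot i) (L.pieceBase i)

/-- The homomorphism from the fundamental group of `Pᵢ` to that of the link exterior, the base
points being connected by the path `γ`. -/
noncomputable def toLinkGroup (L : HopfLikeLink) (i : Fin 2) {x₀ : L.exterior}
    (γ : Path (L.pieceToLink i (L.pieceBase i)) x₀) :
    FundamentalGroup (L.piece i) (L.pieceBase i) →* FundamentalGroup L.exterior x₀ :=
  (FundamentalGroup.fundamentalGroupMulEquivOfPath γ).toMonoidHom.comp
    (FundamentalGroup.map (L.pieceToLink i) (L.pieceBase i))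

/-- The meridian of `K i`, in the fundamental group of `Pᵢ`. -/
noncomputable def meridian (L : HopfLikeLink) (i : Fin 2) :
    FundamentalGroup (L.piece i) (L.pieceBase i) :=
  FundamentalGroup.fromPath (Path.Homotopic.Quotient.mk (L.meridianLoop i))

end HopfLikeLink

/-! ### Laurent polynomials -/

/-- The degree of a Laurent polynomial in one variable, insensitive to units: the difference of the
largest and the smallest exponent that occur (and `0` for the zero polynomial). -/
def laurentWidth {F : Type*} [Field F] (p : LaurentPolynomial F) : ℕ :=
  (p.coeff.support ×ˢ p.coeff.support).sup fun e => (e.1 - e.2).toNat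

/-- The substitution `F[x^{±1}] → F[x₀^{±1}, x₁^{±1}]`, `x ↦ xᵢ`. -/
noncomputable def inVariable (F : Type*) [Field F] (i : Fin 2) :
    LaurentPolynomial F →+* AddMonoidAlgebra F (Fin 2 → ℤ) :=
  AddMonoidAlgebra.mapDomainRingHom F (AddMonoidHom.single (fun _ : Fin 2 => ℤ) i)

/-- The Laurent polynomial `det (B x - id)`. -/
noncomputable def detPolynomial {F : Type*} [Field F] {k : ℕ} (B : GL (Fin k) F) :
    LaurentPolynomial F :=
  ((LaurentPolynomial.T 1 : LaurentPolynomial F) • B.val.map LaurentPolynomial.C - 1).det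

/-!
The proof translates the statement into one about fundamental groups, computes the link group as a
pushout, and compares lengths of homology modules at the prime elements of the Laurent polynomial
ring in two variables.

*From chains to groups.* In degrees zero and one, the twisted homology of a space `X` depends only on
`π₁(X)` and its representation `V`. It is the homology of the map `[g] ⊗ v ↦ g v - v` from the
Fox module, the target of the universal crossed homomorphism on `π₁(X)`, to `V`
(`nonempty_twistedHomology_one_equiv`, `nonempty_twistedHomology_zero_equiv`): a singular 1-simplex
of the universal cover is determined modulo boundaries by its end points, and a choice of one lift of
every point of `X` gives a chain homotopy.

*The link group.* The link exterior is covered by the two open balls `Re zᵢ > 3/4` and by the part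
outside of the closed balls `Re zᵢ ≥ 4/5`. The first two retract onto the pieces `Pᵢ`; so does the
exterior of the component `Kᵢ`. The third has the torus `‖z₀‖ = ‖z₁‖` as a deformation retract, and
its group `ℤ²` is generated by the two meridians. Hence the link group is, up to conjugations, the
free product of the two knot groups modulo the relation that the meridians commute
(`HopfLikeLink.exists_isCommutingPushout`). The van Kampen theorem is proved for path cocycles, the
functors from the fundamental groupoid to a group (`CompatibleCocycles.exists_glue`), which makes it
independent of the choice of base points.

*Homology of the pushout.* Crossed homomorphisms on `G` are homomorphisms to a group of block
triangular matrices, so the universal property of the pushout computes the Fox module of the link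
group. This gives a Mayer–Vietoris sequence. If `mᵢ - 1` is injective on `V` for both meridians and
bijective for one of them, the torus has no homology with coefficients in `V`, and lengths are
additive:
`ℓ(H₁(G)) + ℓ(H₀(G₀)) + ℓ(H₀(G₁)) = ∑ᵢ (ℓ(H₁(Gᵢ)) + ℓ(V / (mᵢ - 1) V))`
(`IsCommutingPushout.length_H1`).

*Orders.* Over a unique factorization domain the order of a torsion module is determined by the
lengths of its localizations at the prime elements (`IsOrder.iff_associated`), which over the
discrete valuation rings in question follows from the Smith normal form
(`IsPresentation.length_eq`). The determinants of `mᵢ - 1` are nonzero polynomials in different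
variables, so no prime divides both of them (`isUnit_of_dvd_inVariable`), and after localization at
a prime element one of the maps `mᵢ - 1` is bijective. The modules of the knots come from the
principal ideal domains `F[xᵢ^±1]` by flat base change. This proves the formula for the link
(`IsCommutingPushout.isOrder_H1_iff`). Moreover `H₀` of a knot group is a quotient of
`V / (mᵢ - 1) V`, whence its order is nonzero and divides the determinant
(`IsOrder.H0_ne_zero_and_dvd`), and the degrees follow from their additivity.
-/

/-! ### Path cocycles and their primitives -/

/-- A multiplicative, homotopy invariant function on the paths of `X` with values in a group: a
functor from the fundamental groupoid to `H`, with the composition order of `FundamentalGroup`. -/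
structure PathCocycle (X : Type*) [TopologicalSpace X] (H : Type*) [Group H] where
  toFun : ∀ {x y : X}, Path x y → H
  map_trans : ∀ {x y z : X} (p : Path x y) (q : Path y z), toFun (p.trans q) = toFun q * toFun p
  map_homotopic : ∀ {x y : X} {p q : Path x y}, p.Homotopic q → toFun p = toFun q

namespace PathCocycle

variable {X Y H : Type*} [TopologicalSpace X] [TopologicalSpace Y] [Group H]

theorem map_refl (φ : PathCocycle X H) (x : X) : φ.toFun (Path.refl x) = 1 := by
  have h := φ.map_trans (Path.refl x) (Path.refl x)
  rw [φ.map_homotopic (p := (Path.refl x).trans (Path.refl x)) (q := Path.refl x)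
    ⟨(Path.Homotopy.reflTrans (Path.refl x))⟩] at h
  exact (mul_eq_left.1 h.symm)

theorem map_symm (φ : PathCocycle X H) {x y : X} (p : Path x y) :
    φ.toFun p.symm = (φ.toFun p)⁻¹ := by
  have h := φ.map_trans p p.symm
  rw [← φ.map_homotopic ⟨Path.Homotopy.reflTransSymm p⟩, φ.map_refl] at h
  exact eq_inv_of_mul_eq_one_left h.symm

/-- The pullback of a path cocycle along a continuous map. -/
def comap (φ : PathCocycle X H) (g : C(Y, X)) : PathCocycle Y H where
  toFun p := φ.toFun (p.map g.continuous)
  map_trans p q := by rw [Path.map_trans, φ.map_trans]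
  map_homotopic h := φ.map_homotopic (h.map g)

end PathCocycle

/-- The restriction of a continuous map to subsets of the source and the target. -/
def ContinuousMap.restrictMapsTo {E X : Type*} [TopologicalSpace E] [TopologicalSpace X] (g : C(E, X))
    {K : Set E} {U : Set X} (h : Set.MapsTo g K U) : C(K, U) :=
  ⟨fun k => ⟨g k, h k.2⟩, by fun_prop⟩

theorem Convex.homotopic_path {E : Type*} [AddCommGroup E] [Module ℝ E] [TopologicalSpace E]
    [IsTopologicalAddGroup E] [ContinuousSMul ℝ E] {K : Set E} (hK : Convex ℝ K) {s t : K}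
    (p q : Path s t) : p.Homotopic q := by
  have : ContractibleSpace K := hK.contractibleSpace ⟨s, s.2⟩
  exact SimplyConnectedSpace.paths_homotopic p q

theorem Convex.nonempty_path {E : Type*} [AddCommGroup E] [Module ℝ E] [TopologicalSpace E]
    [IsTopologicalAddGroup E] [ContinuousSMul ℝ E] {K : Set E} (hK : Convex ℝ K) (s t : K) :
    Nonempty (Path s t) := by
  have : ContractibleSpace K := hK.contractibleSpace ⟨s, s.2⟩
  exact PathConnectedSpace.joined s t

section VanKampen

variable {X H ι : Type*} [TopologicalSpace X] [Group H]
  {E : Type*} [NormedAddCommGroup E] [NormedSpace ℝ E]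
  {E' : Type*} [NormedAddCommGroup E'] [NormedSpace ℝ E']
  {U : ι → Set X}

/-- The path cocycles `φ a` on the sets `U a` agree on the overlaps. -/
def CompatibleCocycles (φ : ∀ a, PathCocycle (U a) H) : Prop :=
  ∀ (a b : ι) (x y : ↥(U a ∩ U b)) (p : Path x y),
    ((φ a).comap (ContinuousMap.inclusion Set.inter_subset_left)).toFun p =
      ((φ b).comap (ContinuousMap.inclusion Set.inter_subset_right)).toFun p

/-- A primitive, on the subset `R` of a normed space, of the pullback along `g` of the family of
local path cocycles `φ`: a function `f` with `f t = φ a (p) * f s` for every path `p` from `s` to `t`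
in a convex part of `R` that is mapped to `U a`. -/
def IsPrimitive (φ : ∀ a, PathCocycle (U a) H) (g : C(E, X)) (R : Set E) (f : E → H) : Prop :=
  ∀ (a : ι) (K : Set E) (_ : Convex ℝ K) (_ : K ⊆ R) (h : Set.MapsTo g K (U a)) (s t : K)
    (p : Path s t), ((φ a).comap (g.restrictMapsTo h)).toFun p * f s = f t

variable {φ : ∀ a, PathCocycle (U a) H}

theorem IsPrimitive.mono {g : C(E, X)} {R R' : Set E} {f : E → H} (h : IsPrimitive φ g R f)
    (hR : R' ⊆ R) : IsPrimitive φ g R' f :=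
  fun a K hK hKR => h a K hK (hKR.trans hR)

theorem IsPrimitive.mul_right {g : C(E, X)} {R : Set E} {f : E → H} (h : IsPrimitive φ g R f)
    (c : H) : IsPrimitive φ g R fun s => f s * c := fun a K hK hKR hm s t p => by
  rw [← mul_assoc, h a K hK hKR hm s t p]

/-- Primitives pull back along affine maps, which take convex sets to convex sets. -/
theorem IsPrimitive.comp_affine {g : C(E, X)} {R : Set E} {f : E → H}
    (h : IsPrimitive φ g R f) (A : E' →ᴬ[ℝ] E) {g' : C(E', X)} {R' : Set E'}
    (hA : Set.MapsTo A R' R) (hg : ∀ s ∈ R', g' s = g (A s)) :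
    IsPrimitive φ g' R' (f ∘ A) := fun a K hK hKR hm s t p => by
  have hm' : Set.MapsTo g (A '' K) (U a) := by
    rintro _ ⟨k, hk, rfl⟩
    rw [← hg k (hKR hk)]
    exact hm hk
  have hK' : Convex ℝ (A '' K) := by
    have := hK.affine_image (A : E' →ᵃ[ℝ] E)
    exact this
  let B : C(K, A '' K) := ⟨fun k => ⟨A k, k, k.2, rfl⟩, by fun_prop⟩
  have := h a (A '' K) hK' (by rintro _ ⟨k, hk, rfl⟩; exact hA (hKR hk)) hm' (B s) (B t)
    (p.map B.continuous)
  have e : (g.restrictMapsTo hm').comp B = g'.restrictMapsTo hm := by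
    ext k
    exact (hg k (hKR k.2)).symm
  rw [← e]
  exact this

/-- Two primitives on a convex set differ by a constant. -/
theorem IsPrimitive.unique {g : C(E, X)} {R : Set E} {f f' : E → H} (hU : ∀ a, IsOpen (U a))
    (hcov : ∀ x, ∃ a, x ∈ U a) (hR : Convex ℝ R)
    (h : IsPrimitive φ g R f) (h' : IsPrimitive φ g R f') {s t : E} (hs : s ∈ R) (ht : t ∈ R) :
    (f s)⁻¹ * f' s = (f t)⁻¹ * f' t := by
  have : PreconnectedSpace R := Subtype.preconnectedSpace hR.isPreconnected
  -- a convex neighbourhood of a point is mapped to one set of the cover and is path connected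
  have hloc : IsLocallyConstant fun s : R => (f s)⁻¹ * f' s := by
    rw [IsLocallyConstant.iff_eventually_eq]
    intro s
    obtain ⟨a, ha⟩ := hcov (g s)
    obtain ⟨ε, hε, hb⟩ := Metric.mem_nhds_iff.1
      (((hU a).preimage g.continuous).mem_nhds (show (s : E) ∈ g ⁻¹' U a from ha))
    have hball : ∀ᶠ t : R in nhds s, (t : E) ∈ Metric.ball (s : E) ε :=
      continuous_subtype_val.continuousAt.eventually (Metric.ball_mem_nhds _ hε)
    filter_upwards [hball] with t ht
    have hK : Convex ℝ (Metric.ball (s : E) ε ∩ R) := (convex_ball _ _).inter hR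
    have hm : Set.MapsTo g (Metric.ball (s : E) ε ∩ R) (U a) := fun k hk => hb hk.1
    let s' : ↥(Metric.ball (s : E) ε ∩ R) := ⟨s, Metric.mem_ball_self hε, s.2⟩
    let t' : ↥(Metric.ball (s : E) ε ∩ R) := ⟨t, ht, t.2⟩
    obtain ⟨p⟩ := hK.nonempty_path s' t'
    have e1 := h a _ hK Set.inter_subset_right hm s' t' p
    have e2 := h' a _ hK Set.inter_subset_right hm s' t' p
    change _ * f s = f t at e1
    change _ * f' s = f' t at e2
    rw [← e1, ← e2]
    group
  exact hloc.apply_eq_of_preconnectedSpace ⟨s, hs⟩ ⟨t, ht⟩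

/-- A primitive exists on a convex set that is mapped into one of the sets of the cover. -/
theorem exists_isPrimitive_of_mapsTo {g : C(E, X)} {R : Set E} (hφ : CompatibleCocycles φ)
    (hR : Convex ℝ R) {a : ι} (ha : Set.MapsTo g R (U a)) : ∃ f : E → H, IsPrimitive φ g R f := by
  classical
  rcases R.eq_empty_or_nonempty with rfl | ⟨c, hc⟩
  · exact ⟨fun _ => 1, fun b K _ hKR _ s => (hKR s.2).elim⟩
  refine ⟨fun s => if hs : s ∈ R then ((φ a).comap (g.restrictMapsTo ha)).toFun
    (hR.nonempty_path ⟨c, hc⟩ ⟨s, hs⟩).some else 1, fun b K hK hKR hb s t p => ?_⟩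
  change _ * dite _ _ _ = dite _ _ _
  rw [dif_pos (hKR s.2), dif_pos (hKR t.2)]
  have hab : Set.MapsTo g K (U a ∩ U b) := fun k hk => ⟨ha (hKR hk), hb hk⟩
  have e := hφ a b _ _ (p.map (g.restrictMapsTo hab).continuous)
  change _ = ((φ b).comap (g.restrictMapsTo hb)).toFun p at e
  rw [← e]
  change ((φ a).comap (g.restrictMapsTo ha)).toFun
    (p.map (ContinuousMap.inclusion hKR).continuous) * _ = _
  refine (PathCocycle.map_trans _ _ _).symm.trans ?_
  exact PathCocycle.map_homotopic _ (hR.homotopic_path _ _)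

/-- Primitives on the two parts into which a hyperplane cuts a convex set can be glued. -/
theorem exists_isPrimitive_of_halves {g : C(E, X)} {R : Set E} (hU : ∀ a, IsOpen (U a))
    (hcov : ∀ x, ∃ a, x ∈ U a) (hR : Convex ℝ R) (l : E →L[ℝ] ℝ) (b : ℝ)
    (h1 : ∃ f, IsPrimitive φ g (R ∩ {s | l s ≤ b}) f)
    (h2 : ∃ f, IsPrimitive φ g (R ∩ {s | b ≤ l s}) f) : ∃ f, IsPrimitive φ g R f := by
  classical
  have c1 : Convex ℝ {s | l s ≤ b} := convex_halfSpace_le l.toLinearMap.isLinear b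
  have c2 : Convex ℝ {s | b ≤ l s} := convex_halfSpace_ge l.toLinearMap.isLinear b
  obtain ⟨f1, h1⟩ := h1
  obtain ⟨f2, h2, he⟩ : ∃ f2, IsPrimitive φ g (R ∩ {s | b ≤ l s}) f2 ∧
      ∀ s ∈ R, l s = b → f1 s = f2 s := by
    obtain ⟨f2, h2⟩ := h2
    by_cases hs : ∃ s ∈ R, l s = b
    · obtain ⟨s, hs, hb⟩ := hs
      refine ⟨_, h2.mul_right ((f2 s)⁻¹ * f1 s), fun t ht htb => ?_⟩
      have hc : Convex ℝ (R ∩ {s | l s ≤ b} ∩ {s | b ≤ l s}) := (hR.inter c1).inter c2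
      have := IsPrimitive.unique hU hcov hc (h2.mono (by
        rintro k ⟨⟨hk, -⟩, hk'⟩; exact ⟨hk, hk'⟩)) (h1.mono Set.inter_subset_left)
        (s := s) (t := t) ⟨⟨hs, hb.le⟩, hb.ge⟩ ⟨⟨ht, htb.le⟩, htb.ge⟩
      rw [this]
      group
    · exact ⟨f2, h2, fun s h h' => (hs ⟨s, h, h'⟩).elim⟩
  have key : ∀ (a : ι) (K : Set E) (_ : Convex ℝ K) (_ : K ⊆ R) (h : Set.MapsTo g K (U a))
      (s t : K) (p : Path s t), l s ≤ b → b ≤ l t →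
      ((φ a).comap (g.restrictMapsTo h)).toFun p * f1 s = f2 t := by
    intro a K hK hKR h s t p hs ht
    obtain ⟨m, hm, hmb⟩ : ∃ m ∈ K, l m = b := by
      have := (hK.isPreconnected.image l l.continuous.continuousOn).ordConnected.out
        ⟨s, s.2, rfl⟩ ⟨t, t.2, rfl⟩ ⟨hs, ht⟩
      exact this
    have k1 : Convex ℝ (K ∩ {s | l s ≤ b}) := hK.inter c1
    have k2 : Convex ℝ (K ∩ {s | b ≤ l s}) := hK.inter c2
    obtain ⟨p1⟩ := k1.nonempty_path ⟨s, s.2, hs⟩ ⟨m, hm, hmb.le⟩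
    obtain ⟨p2⟩ := k2.nonempty_path ⟨m, hm, hmb.ge⟩ ⟨t, t.2, ht⟩
    have e1 := h1 a _ k1 (fun k hk => ⟨hKR hk.1, hk.2⟩) (fun k hk => h hk.1) _ _ p1
    have e2 := h2 a _ k2 (fun k hk => ⟨hKR hk.1, hk.2⟩) (fun k hk => h hk.1) _ _ p2
    have e : p.Homotopic ((p1.map (ContinuousMap.inclusion Set.inter_subset_left).continuous).trans
        (p2.map (ContinuousMap.inclusion Set.inter_subset_left).continuous)) :=
      hK.homotopic_path _ _
    refine (congrArg (· * f1 s) ((PathCocycle.map_homotopic _ e).trans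
      (PathCocycle.map_trans _ _ _))).trans ?_
    refine (mul_assoc _ _ _).trans ?_
    change _ * f1 s = f1 m at e1
    change _ * f2 m = f2 t at e2
    rw [← e2, ← he m (hKR hm) hmb, ← e1]
    rfl
  refine ⟨fun s => if l s ≤ b then f1 s else f2 s, fun a K hK hKR h s t p => ?_⟩
  by_cases hs : l s ≤ b <;> by_cases ht : l t ≤ b
  · simp only [hs, ht, if_true]
    have k1 : Convex ℝ (K ∩ {s | l s ≤ b}) := hK.inter c1
    obtain ⟨p1⟩ := k1.nonempty_path ⟨s, s.2, hs⟩ ⟨t, t.2, ht⟩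
    have e1 := h1 a _ k1 (fun k hk => ⟨hKR hk.1, hk.2⟩) (fun k hk => h hk.1) _ _ p1
    exact (congrArg (· * _) (PathCocycle.map_homotopic _ (hK.homotopic_path p
      (p1.map (ContinuousMap.inclusion Set.inter_subset_left).continuous)))).trans e1
  · simp only [hs, ht, if_true, if_false]
    exact key a K hK hKR h s t p hs (not_le.1 ht).le
  · simp only [hs, ht, if_true, if_false]
    have := key a K hK hKR h t s p.symm ht (not_le.1 hs).le
    rw [PathCocycle.map_symm] at this
    rw [← this]
    group
  · simp only [hs, ht, if_false]
    have k2 : Convex ℝ (K ∩ {s | b ≤ l s}) := hK.inter c2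
    obtain ⟨p1⟩ := k2.nonempty_path ⟨s, s.2, (not_le.1 hs).le⟩ ⟨t, t.2, (not_le.1 ht).le⟩
    have e1 := h2 a _ k2 (fun k hk => ⟨hKR hk.1, hk.2⟩) (fun k hk => h hk.1) _ _ p1
    exact (congrArg (· * _) (PathCocycle.map_homotopic _ (hK.homotopic_path p
      (p1.map (ContinuousMap.inclusion Set.inter_subset_left).continuous)))).trans e1

end VanKampen

/-! ### Gluing path cocycles along an open cover -/

section VanKampen

open scoped unitInterval

variable {X H ι : Type*} [TopologicalSpace X] [Group H] {U : ι → Set X}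
  {φ : ∀ a, PathCocycle (U a) H}

/-- A primitive exists on the unit square: the pullback of the local cocycles to a square is
exact. -/
theorem exists_isPrimitive_square (hU : ∀ a, IsOpen (U a)) (hcov : ∀ x, ∃ a, x ∈ U a)
    (hφ : CompatibleCocycles φ) (g : C(ℝ × ℝ, X)) :
    ∃ f, IsPrimitive φ g (Set.Icc 0 1 ×ˢ Set.Icc 0 1) f := by
  obtain ⟨t, h0, hmono, ⟨N, hN⟩, hc⟩ := exists_monotone_Icc_subset_open_cover_unitInterval_prod_self
    (c := fun a => {q : I × I | g ((q.1 : ℝ), (q.2 : ℝ)) ∈ U a})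
    (fun a => (hU a).preimage (by fun_prop)) (fun q _ => by
      obtain ⟨a, ha⟩ := hcov (g ((q.1 : ℝ), (q.2 : ℝ)))
      exact Set.mem_iUnion.2 ⟨a, ha⟩)
  have cell : ∀ m n, ∃ f, IsPrimitive φ g
      (Set.Icc (t m : ℝ) (t (m + 1)) ×ˢ Set.Icc (t n : ℝ) (t (n + 1))) f := by
    intro m n
    obtain ⟨a, ha⟩ := hc m n
    refine exists_isPrimitive_of_mapsTo hφ ((convex_Icc _ _).prod (convex_Icc _ _)) (a := a) ?_
    rintro ⟨x, y⟩ ⟨hx, hy⟩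
    have hx' : x ∈ I := ⟨(t m).2.1.trans hx.1, hx.2.trans (t (m + 1)).2.2⟩
    have hy' : y ∈ I := ⟨(t n).2.1.trans hy.1, hy.2.trans (t (n + 1)).2.2⟩
    exact ha (show ((⟨x, hx'⟩, ⟨y, hy'⟩) : I × I) ∈ _ from ⟨hx, hy⟩)
  -- cells are glued to horizontal strips, and the strips to the square
  have strip : ∀ n m, ∃ f, IsPrimitive φ g
      (Set.Icc (0 : ℝ) (t m) ×ˢ Set.Icc (t n : ℝ) (t (n + 1))) f := by
    intro n m
    induction m with
    | zero =>
      obtain ⟨f, hf⟩ := cell 0 n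
      refine ⟨f, hf.mono (Set.prod_mono (fun x hx => ?_) subset_rfl)⟩
      rw [h0] at hx ⊢
      exact ⟨hx.1, hx.2.trans (t 1).2.1⟩
    | succ m ih =>
      refine exists_isPrimitive_of_halves hU hcov ((convex_Icc _ _).prod (convex_Icc _ _))
        (ContinuousLinearMap.fst ℝ ℝ ℝ) (t m) ?_ ?_
      · obtain ⟨f, hf⟩ := ih
        refine ⟨f, hf.mono ?_⟩
        rintro ⟨x, y⟩ ⟨⟨hx, hy⟩, hxy⟩
        exact ⟨⟨hx.1, hxy⟩, hy⟩
      · obtain ⟨f, hf⟩ := cell m n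
        refine ⟨f, hf.mono ?_⟩
        rintro ⟨x, y⟩ ⟨⟨hx, hy⟩, hxy⟩
        exact ⟨⟨hxy, hx.2⟩, hy⟩
  have full : ∀ n, ∃ f, IsPrimitive φ g (Set.Icc (0 : ℝ) 1 ×ˢ Set.Icc (0 : ℝ) (t n)) f := by
    intro n
    induction n with
    | zero =>
      obtain ⟨f, hf⟩ := strip 0 N
      rw [hN N le_rfl] at hf
      refine ⟨f, hf.mono (Set.prod_mono subset_rfl (fun x hx => ?_))⟩
      rw [h0] at hx ⊢
      exact ⟨hx.1, hx.2.trans (t 1).2.1⟩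
    | succ n ih =>
      refine exists_isPrimitive_of_halves hU hcov ((convex_Icc _ _).prod (convex_Icc _ _))
        (ContinuousLinearMap.snd ℝ ℝ ℝ) (t n) ?_ ?_
      · obtain ⟨f, hf⟩ := ih
        refine ⟨f, hf.mono ?_⟩
        rintro ⟨x, y⟩ ⟨⟨hx, hy⟩, hxy⟩
        exact ⟨hx, hy.1, hxy⟩
      · obtain ⟨f, hf⟩ := strip n N
        rw [hN N le_rfl] at hf
        refine ⟨f, hf.mono ?_⟩
        rintro ⟨x, y⟩ ⟨⟨hx, hy⟩, hxy⟩
        exact ⟨hx, hxy, hy.2⟩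
  have := full N
  rwa [hN N le_rfl] at this

/-- The affine map `t ↦ c + t d` from the line to a normed space. -/
noncomputable def affineLine {E : Type*} [NormedAddCommGroup E] [NormedSpace ℝ E] (c d : E) :
    ℝ →ᴬ[ℝ] E :=
  (ContinuousAffineMap.const ℝ ℝ c) +
    ((ContinuousLinearMap.id ℝ ℝ).smulRight d).toContinuousAffineMap

theorem affineLine_apply {E : Type*} [NormedAddCommGroup E] [NormedSpace ℝ E] (c d : E) (t : ℝ) :
    affineLine c d t = c + t • d := by
  simp [affineLine]

/-- A path, extended by constants to the real line. -/
noncomputable def Path.line {x y : X} (p : Path x y) : C(ℝ, X) := ⟨p.extend, p.continuous_extend⟩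

/-- A primitive exists along every path: restrict a primitive on the square to one of its sides. -/
theorem exists_isPrimitive_line (hU : ∀ a, IsOpen (U a)) (hcov : ∀ x, ∃ a, x ∈ U a)
    (hφ : CompatibleCocycles φ) {x y : X} (p : Path x y) :
    ∃ f, IsPrimitive φ p.line (Set.Icc 0 1) f := by
  obtain ⟨f, hf⟩ := exists_isPrimitive_square hU hcov hφ (p.line.comp ⟨Prod.snd, continuous_snd⟩)
  refine ⟨_, hf.comp_affine (affineLine (0, 0) (0, 1)) (fun t ht => ?_) (fun t _ => ?_)⟩
  · simpa [affineLine_apply] using ht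
  · simp [affineLine_apply]

/-- A path cocycle on `X` that restricts to the given local cocycles is computed, on a path, by a
primitive along this path. -/
theorem PathCocycle.isPrimitive_of_agree (Φ : PathCocycle X H)
    (hΦ : ∀ a (x y : U a) (p : Path x y),
      Φ.toFun (p.map continuous_subtype_val) = (φ a).toFun p) {x y : X} (p : Path x y) :
    ∃ f, IsPrimitive φ p.line (Set.Icc 0 1) f ∧ Φ.toFun p = f 1 * (f 0)⁻¹ := by
  let ψ : ∀ _ : Unit, PathCocycle (Set.univ : Set X) H := fun _ =>
    Φ.comap ⟨Subtype.val, continuous_subtype_val⟩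
  have hψ : CompatibleCocycles ψ := fun _ _ _ _ _ => rfl
  obtain ⟨f, hf⟩ := exists_isPrimitive_of_mapsTo (g := p.line) hψ (convex_Icc (0 : ℝ) 1) (a := ())
    (Set.mapsTo_univ _ _)
  refine ⟨f, fun a K hK hKR h s t q => ?_, ?_⟩
  · rw [← hf () K hK hKR (Set.mapsTo_univ _ _) s t q]
    exact congrArg (· * _) (hΦ a _ _ (q.map (p.line.restrictMapsTo h).continuous)).symm
  · let q : Path (⟨0, by simp⟩ : Set.Icc (0 : ℝ) 1) ⟨1, by simp⟩ := ⟨⟨id, continuous_id⟩, rfl, rfl⟩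
    have := hf () _ (convex_Icc (0 : ℝ) 1) subset_rfl (Set.mapsTo_univ _ _) _ _ q
    refine eq_mul_inv_of_mul_eq (Eq.trans ?_ this)
    refine congrArg (· * _) ?_
    have e : ∀ (x' y' : X) (hx : x' = x) (hy : y' = y) (p' : Path x' y') (_ : ∀ t, p' t = p t),
        Φ.toFun p = Φ.toFun p' := by
      rintro x' y' rfl rfl p' h
      congr 1
      ext t
      exact (h t).symm
    refine e _ _ ?_ ?_ (q.map (p.line.continuous.comp continuous_subtype_val)) ?_
    · exact p.extend_zero
    · exact p.extend_one
    · intro t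
      exact p.extend_apply t.2

/-- Path cocycles that agree on the sets of an open cover are equal. -/
theorem PathCocycle.ext_of_cover (hU : ∀ a, IsOpen (U a)) (hcov : ∀ x, ∃ a, x ∈ U a)
    (Φ Φ' : PathCocycle X H)
    (h : ∀ a (x y : U a) (p : Path x y),
      Φ.toFun (p.map continuous_subtype_val) = Φ'.toFun (p.map continuous_subtype_val))
    {x y : X} (p : Path x y) : Φ.toFun p = Φ'.toFun p := by
  obtain ⟨f, hf, e⟩ := Φ.isPrimitive_of_agree
    (φ := fun a => Φ'.comap ⟨(Subtype.val : U a → X), continuous_subtype_val⟩) h p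
  obtain ⟨f', hf', e'⟩ := Φ'.isPrimitive_of_agree
    (φ := fun a => Φ'.comap ⟨(Subtype.val : U a → X), continuous_subtype_val⟩)
    (fun _ _ _ _ => rfl) p
  have := hf.unique hU hcov (convex_Icc 0 1) hf' (s := 0) (t := 1) (by simp) (by simp)
  rw [e, e', eq_mul_inv_iff_mul_eq, mul_assoc, this]
  group

/-- **Van Kampen theorem for path cocycles**: compatible path cocycles on the sets of an open cover
come from a path cocycle on the whole space. -/
theorem CompatibleCocycles.exists_glue (hU : ∀ a, IsOpen (U a)) (hcov : ∀ x, ∃ a, x ∈ U a)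
    (hφ : CompatibleCocycles φ) :
    ∃ Φ : PathCocycle X H, ∀ a (x y : U a) (p : Path x y),
      Φ.toFun (p.map continuous_subtype_val) = (φ a).toFun p := by
  choose F hF using fun (x y : X) (p : Path x y) => exists_isPrimitive_line hU hcov hφ p
  have key : ∀ {x y : X} (p : Path x y) (f : ℝ → H), IsPrimitive φ p.line (Set.Icc 0 1) f →
      F x y p 1 * (F x y p 0)⁻¹ = f 1 * (f 0)⁻¹ := by
    intro x y p f hf
    have := (hF x y p).unique hU hcov (convex_Icc 0 1) hf (s := 0) (t := 1) (by simp) (by simp)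
    rw [eq_mul_inv_iff_mul_eq, mul_assoc, this]
    group
  refine ⟨⟨fun {x y} p => F x y p 1 * (F x y p 0)⁻¹, ?_, ?_⟩, ?_⟩
  · intro x y z p q
    have hf := hF x z (p.trans q)
    have e1 := key p _ (hf.comp_affine (affineLine (0 : ℝ) (1 / 2)) (R' := Set.Icc 0 1)
      (fun t ht => by
        simp only [affineLine_apply, Set.mem_Icc, smul_eq_mul] at ht ⊢
        constructor <;> linarith)
      (fun t ht => by
        have h2 : (0 + t • (1 / 2) : ℝ) ∈ I := by
          simp only [Set.mem_Icc, smul_eq_mul] at ht ⊢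
          constructor <;> linarith
        change p.extend t = (p.trans q).extend _
        rw [affineLine_apply, Path.extend_apply _ h2, Path.trans_apply, dif_pos (by
          simp only [Set.mem_Icc, smul_eq_mul] at ht ⊢; linarith), Path.extend_apply _ ht]
        congr 1
        ext
        simp only [smul_eq_mul]
        ring))
    have e2 := key q _ (hf.comp_affine (affineLine (1 / 2 : ℝ) (1 / 2)) (R' := Set.Icc 0 1)
      (fun t ht => by
        simp only [affineLine_apply, Set.mem_Icc, smul_eq_mul] at ht ⊢
        constructor <;> linarith)
      (fun t ht => by
        have h2 : (1 / 2 + t • (1 / 2) : ℝ) ∈ I := by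
          simp only [Set.mem_Icc, smul_eq_mul] at ht ⊢
          constructor <;> linarith
        change q.extend t = (p.trans q).extend _
        rw [affineLine_apply, Path.extend_apply _ h2, Path.extend_apply _ ht]
        rcases eq_or_lt_of_le ht.1 with h | h
        · subst h
          rw [Path.trans_apply, dif_pos (by simp)]
          norm_num
        · rw [Path.trans_apply, dif_neg (by
            simp only [smul_eq_mul, not_le]; linarith)]
          congr 1
          ext
          simp only [smul_eq_mul]
          ring))
    rw [e1, e2]
    simp only [Function.comp_apply, affineLine_apply]
    norm_num
  · rintro x y p q ⟨Γ⟩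
    let g : C(ℝ × ℝ, X) := ⟨fun z => Γ (Set.projIcc 0 1 zero_le_one z.1,
      Set.projIcc 0 1 zero_le_one z.2), by
        refine Γ.continuous.comp (.prodMk ?_ ?_)
        · exact continuous_projIcc.comp continuous_fst
        · exact continuous_projIcc.comp continuous_snd⟩
    obtain ⟨f, hf⟩ := exists_isPrimitive_square hU hcov hφ g
    have e1 := key p _ (hf.comp_affine (affineLine (0, 0) (0, 1))
      (fun t ht => by simpa [affineLine_apply] using ht)
      (fun t ht => by
        change p.extend t = Γ _
        simp [affineLine_apply, Path.extend, Set.IccExtend]))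
    have e2 := key q _ (hf.comp_affine (affineLine (1, 0) (0, 1))
      (fun t ht => by simpa [affineLine_apply] using ht)
      (fun t ht => by
        change q.extend t = Γ _
        simp [affineLine_apply, Path.extend, Set.IccExtend]))
    -- a homotopy is constant on two sides of the square, hence so is a primitive along it
    have hconst : ∀ (z : X) (b : ℝ) (_ : b ∈ I) (_ : ∀ s, g (s, b) = z), f (0, b) = f (1, b) := by
      intro z b hb hz
      have h1 := hf.comp_affine (affineLine (0, b) (1, 0)) (R' := Set.Icc 0 1)
        (g' := ContinuousMap.const ℝ z)
        (fun t ht => by simpa [affineLine_apply] using ⟨⟨ht.1, hb.1⟩, ht.2, hb.2⟩)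
        (fun t ht => by simp [affineLine_apply, hz])
      obtain ⟨a, ha⟩ := hcov z
      obtain ⟨r⟩ := (convex_Icc (0 : ℝ) 1).nonempty_path ⟨0, by simp⟩ ⟨1, by simp⟩
      have h2 := h1 a (Set.Icc 0 1) (convex_Icc _ _) subset_rfl (fun _ _ => ha) _ _ r
      have h3 : ((φ a).comap ((ContinuousMap.const ℝ z).restrictMapsTo
          (fun _ _ => ha : Set.MapsTo _ (Set.Icc (0 : ℝ) 1) (U a)))).toFun r = 1 :=
        (φ a).map_refl ⟨z, ha⟩
      rw [h3, one_mul] at h2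
      simpa [affineLine_apply] using h2
    have h0 := hconst x 0 (by simp) (fun s => by simp [g])
    have h1 := hconst y 1 (by simp) (fun s => by simp [g])
    rw [e1, e2]
    simp [affineLine_apply, h0, h1]
  · intro a x y p
    let p' : Path (x : X) (y : X) := p.map continuous_subtype_val
    have hm : Set.MapsTo p'.line (Set.Icc 0 1) (U a) := fun t ht => by
      change p'.extend t ∈ U a
      rw [Path.extend_apply _ ht]
      exact (p ⟨t, ht⟩).2
    let q : Path (⟨0, by simp⟩ : Set.Icc (0 : ℝ) 1) ⟨1, by simp⟩ := ⟨⟨id, continuous_id⟩, rfl, rfl⟩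
    have := hF _ _ p' a _ (convex_Icc (0 : ℝ) 1) subset_rfl hm _ _ q
    refine (eq_mul_inv_of_mul_eq (Eq.trans ?_ this)).symm
    refine congrArg (· * _) ?_
    have e : ∀ (x' y' : U a) (hx : x' = x) (hy : y' = y) (r : Path x' y') (_ : ∀ t, r t = p t),
        (φ a).toFun p = (φ a).toFun r := by
      rintro x' y' rfl rfl r h
      congr 1
      ext t
      exact congrArg Subtype.val (h t).symm
    refine e _ _ ?_ ?_ (q.map (p'.line.restrictMapsTo hm).continuous) ?_
    · exact Subtype.ext p'.extend_zero
    · exact Subtype.ext p'.extend_one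
    · intro t
      exact Subtype.ext (p'.extend_apply t.2)

end VanKampen

/-! ### The Fox module of a representation -/

section FoxModule

variable {R : Type*} [CommRing R] {G : Type*} [Group G] {V : Type*} [AddCommGroup V] [Module R V]

/-- The Fox relations `[gh] ⊗ v = [h] ⊗ v + [g] ⊗ h v`. -/
noncomputable def foxRelations (ρ : G →* Module.End R V) : Submodule R (G →₀ V) :=
  Submodule.span R {c | ∃ (g h : G) (v : V),
    c = Finsupp.single (g * h) v - (Finsupp.single h v + Finsupp.single g (ρ h v))}

/-- The Fox module of a representation: the target of the universal crossed homomorphism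
`g ↦ [g]` from `G` to the homomorphisms out of `V`. In degree one of the bar complex it is the
quotient of the chains by the boundaries. -/
abbrev FoxModule (ρ : G →* Module.End R V) : Type _ := (G →₀ V) ⧸ foxRelations ρ

namespace FoxModule

variable (ρ : G →* Module.End R V)

/-- The universal crossed homomorphism. -/
noncomputable def of (g : G) : V →ₗ[R] FoxModule ρ := (foxRelations ρ).mkQ ∘ₗ Finsupp.lsingle g

theorem of_mul (g h : G) : of ρ (g * h) = of ρ h + of ρ g ∘ₗ ρ h := by
  ext v
  have : (Finsupp.single (g * h) v - (Finsupp.single h v + Finsupp.single g (ρ h v)) : G →₀ V) ∈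
    foxRelations ρ := Submodule.subset_span ⟨g, h, v, rfl⟩
  have := (Submodule.Quotient.eq _).2 this
  simpa [of] using this

theorem of_mul_apply (g h : G) (v : V) : of ρ (g * h) v = of ρ h v + of ρ g (ρ h v) := by
  rw [of_mul]; rfl

variable {ρ}

variable {W : Type*} [AddCommGroup W] [Module R W]

/-- The linear map out of the Fox module that belongs to a crossed homomorphism. -/
noncomputable def lift (D : G → V →ₗ[R] W) (hD : ∀ g h v, D (g * h) v = D h v + D g (ρ h v)) :
    FoxModule ρ →ₗ[R] W :=
  (foxRelations ρ).liftQ (Finsupp.lsum R D) (by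
    rw [foxRelations, Submodule.span_le]
    rintro _ ⟨g, h, v, rfl⟩
    simp only [SetLike.mem_coe, LinearMap.mem_ker, map_sub, map_add, Finsupp.lsum_single, hD, sub_self])

@[simp] theorem lift_of (D : G → V →ₗ[R] W) (hD : ∀ g h v, D (g * h) v = D h v + D g (ρ h v))
    (g : G) (v : V) : lift D hD (of ρ g v) = D g v :=
  Finsupp.lsum_single R D g v

theorem hom_ext {f f' : FoxModule ρ →ₗ[R] W} (h : ∀ g v, f (of ρ g v) = f' (of ρ g v)) :
    f = f' := by
  refine Submodule.linearMap_qext _ (Finsupp.lhom_ext fun g v => h g v)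

theorem induction_on {p : FoxModule ρ → Prop} (x : FoxModule ρ) (h0 : p 0)
    (h : ∀ g v, p (of ρ g v)) (ha : ∀ x y, p x → p y → p (x + y)) : p x := by
  induction x using Submodule.Quotient.induction_on with | _ x =>
  induction x using Finsupp.induction_linear with
  | zero => exact h0
  | add x y hx hy => exact ha _ _ hx hy
  | single g v => exact h g v

variable (ρ)

/-- The boundary map `[g] ⊗ v ↦ g v - v`. -/
noncomputable def boundary : FoxModule ρ →ₗ[R] V :=
  lift (fun g => ρ g - 1) (fun g h v => by simp)

@[simp] theorem boundary_of (g : G) (v : V) : boundary ρ (of ρ g v) = ρ g v - v := by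
  simp [boundary]

/-- The first homology of `G` with coefficients in `ρ`. -/
abbrev H1 : Type _ := LinearMap.ker (boundary ρ)

/-- The coinvariants of `ρ`, the homology of `G` in degree zero. -/
abbrev H0 : Type _ := V ⧸ LinearMap.range (boundary ρ)

end FoxModule

end FoxModule

/-! ### Singular simplices of the universal cover -/

section CoverPoints

variable {X : Type*} [TopologicalSpace X] {x₀ : X}

variable (x₀) in
/-- The points of the universal cover. -/
abbrev CoverPoint : Type _ := Σ x : X, Path.Homotopic.Quotient x₀ x

/-- The path in the 1-simplex from the vertex `0` to the vertex `1`. -/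
noncomputable def simplexEdge :
    Path (stdSimplex.vertex 0 : stdSimplex ℝ (Fin 2)) (stdSimplex.vertex 1) where
  toFun := stdSimplexHomeomorphUnitInterval.symm
  continuous_toFun := stdSimplexHomeomorphUnitInterval.symm.continuous
  source' := by
    rw [Homeomorph.symm_apply_eq]; exact stdSimplexHomeomorphUnitInterval_zero.symm
  target' := by
    rw [Homeomorph.symm_apply_eq]; exact stdSimplexHomeomorphUnitInterval_one.symm

theorem faceInclusion_vertex (n : ℕ) (i : Fin (n + 2)) (j : Fin (n + 1)) :
    faceInclusion n i (stdSimplex.vertex j) = stdSimplex.vertex (i.succAbove j) := by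
  simp [faceInclusion]

theorem stdSimplex_nonempty_path {n : ℕ} (s t : stdSimplex ℝ (Fin (n + 1))) :
    Nonempty (Path s t) :=
  (convex_stdSimplex ℝ (Fin (n + 1))).nonempty_path s t

theorem stdSimplex_homotopic {n : ℕ} {s t : stdSimplex ℝ (Fin (n + 1))} (p q : Path s t) :
    p.Homotopic q :=
  (convex_stdSimplex ℝ (Fin (n + 1))).homotopic_path p q

namespace LiftedSimplex

variable {n : ℕ}

/-- The value of a singular simplex of the universal cover. -/
def eval (σ : LiftedSimplex X x₀ n) (s : stdSimplex ℝ (Fin (n + 1))) : CoverPoint x₀ :=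
  ⟨σ.toMap s, σ.lift s⟩

/-- The vertices of a singular simplex of the universal cover. -/
noncomputable def vert (σ : LiftedSimplex X x₀ n) (i : Fin (n + 1)) : CoverPoint x₀ :=
  σ.eval (stdSimplex.vertex i)

theorem eval_face (σ : LiftedSimplex X x₀ (n + 1)) (i : Fin (n + 2))
    (s : stdSimplex ℝ (Fin (n + 1))) : (σ.face i).eval s = σ.eval (faceInclusion n i s) := rfl

theorem vert_face (σ : LiftedSimplex X x₀ (n + 1)) (i : Fin (n + 2)) (j : Fin (n + 1)) :
    (σ.face i).vert j = σ.vert (i.succAbove j) := by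
  rw [vert, eval_face, faceInclusion_vertex, vert]

theorem ext_of_eval {σ τ : LiftedSimplex X x₀ n} (h : σ.toMap = τ.toMap)
    (s : stdSimplex ℝ (Fin (n + 1))) (hs : σ.eval s = τ.eval s) : σ = τ := by
  obtain ⟨m, l, hl⟩ := σ
  obtain ⟨m', l', hl'⟩ := τ
  obtain rfl : m = m' := h
  have e : l s = l' s := eq_of_heq (Sigma.mk.inj hs).2
  have : l = l' := by
    funext t
    obtain ⟨p⟩ := stdSimplex_nonempty_path s t
    rw [hl s t p, hl' s t p, e]
  subst this
  rfl

theorem exists_lift (m : C(stdSimplex ℝ (Fin (n + 1)), X)) (s : stdSimplex ℝ (Fin (n + 1)))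
    (e : CoverPoint x₀) (h : e.1 = m s) : ∃ σ : LiftedSimplex X x₀ n, σ.toMap = m ∧ σ.eval s = e := by
  obtain ⟨x, u⟩ := e
  obtain rfl : x = m s := h
  refine ⟨⟨m, fun t => u.trans (Path.Homotopic.Quotient.mk
    ((stdSimplex_nonempty_path s t).some.map m.continuous)), fun t t' p => ?_⟩, rfl, ?_⟩
  · rw [Path.Homotopic.Quotient.trans_assoc, ← Path.Homotopic.Quotient.mk_trans, ← Path.map_trans]
    congr 1
    exact Path.Homotopic.Quotient.eq.2 ((stdSimplex_homotopic _ _).map m)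
  · refine Sigma.ext rfl (heq_of_eq ?_)
    change u.trans _ = u
    rw [Path.Homotopic.Quotient.eq.2 ((stdSimplex_homotopic
      (stdSimplex_nonempty_path s s).some (Path.refl s)).map m)]
    exact Path.Homotopic.Quotient.trans_refl u

/-- The values of a simplex of the universal cover along a path in the standard simplex form the
lift of the path in `X`. -/
theorem eval_of_path (σ : LiftedSimplex X x₀ n) {s t : stdSimplex ℝ (Fin (n + 1))} (r : Path s t)
    {x y : X} (p : Path x y) (hp : ∀ a, σ.toMap (r a) = p a) (u : Path.Homotopic.Quotient x₀ x)
    (h : σ.eval s = ⟨x, u⟩) :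
    σ.eval t = ⟨y, u.trans (Path.Homotopic.Quotient.mk p)⟩ := by
  have key : ∀ {x' y' : X} (q : Path x' y') (u' : Path.Homotopic.Quotient x₀ x')
      (_ : ∀ a, q a = p a) (_ : (⟨x', u'⟩ : CoverPoint x₀) = ⟨x, u⟩),
      (⟨y', u'.trans (Path.Homotopic.Quotient.mk q)⟩ : CoverPoint x₀) =
        ⟨y, u.trans (Path.Homotopic.Quotient.mk p)⟩ := by
    rintro x' y' q u' hq he
    obtain ⟨rfl, hu⟩ := Sigma.mk.inj he
    obtain rfl := eq_of_heq hu
    obtain rfl : y' = y := by simpa using hq 1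
    congr 3
    ext a
    exact hq a
  have e := key (r.map σ.toMap.continuous) (σ.lift s) hp h
  rw [← σ.lift_path s t r] at e
  exact e

theorem eval_of_const (σ : LiftedSimplex X x₀ n) {s t : stdSimplex ℝ (Fin (n + 1))} {x : X}
    (hx : ∀ a, σ.toMap a = x) : σ.eval t = σ.eval s := by
  obtain ⟨p⟩ := stdSimplex_nonempty_path s t
  have h0 : (σ.eval s).1 = x := hx s
  rcases he : σ.eval s with ⟨y, u⟩
  rw [he] at h0
  obtain rfl : y = x := h0
  rw [σ.eval_of_path p (Path.refl y) (fun a => hx _) u he]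
  exact congrArg _ (Path.Homotopic.Quotient.trans_refl u)

/-- Two points of the universal cover are joined by a 1-simplex. -/
theorem exists_edge (e e' : CoverPoint x₀) :
    ∃ σ : LiftedSimplex X x₀ 1, σ.vert 0 = e ∧ σ.vert 1 = e' := by
  obtain ⟨x, u⟩ := e
  obtain ⟨y, w⟩ := e'
  obtain ⟨p, hp⟩ := Path.Homotopic.Quotient.mk_surjective (u.symm.trans w)
  obtain ⟨σ, hm, h0⟩ := exists_lift (x₀ := x₀)
    (⟨fun s => p (stdSimplexHomeomorphUnitInterval s), by fun_prop⟩ : C(stdSimplex ℝ (Fin 2), X))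
    (stdSimplex.vertex 0) ⟨x, u⟩ (by
      change x = p (stdSimplexHomeomorphUnitInterval _)
      rw [stdSimplexHomeomorphUnitInterval_zero, p.source])
  refine ⟨σ, h0, ?_⟩
  rw [vert, σ.eval_of_path simplexEdge p (fun a => by
    rw [hm]; exact congrArg p (stdSimplexHomeomorphUnitInterval.apply_symm_apply a)) u h0, hp,
    ← Path.Homotopic.Quotient.trans_assoc, Path.Homotopic.Quotient.trans_symm,
    Path.Homotopic.Quotient.refl_trans]

theorem path_of_edge (σ : LiftedSimplex X x₀ 1) :
    ∃ p : Path (σ.vert 0).1 (σ.vert 1).1,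
      (∀ s, σ.toMap s = p (stdSimplexHomeomorphUnitInterval s)) ∧
      (σ.vert 1).2 = (σ.vert 0).2.trans (Path.Homotopic.Quotient.mk p) :=
  ⟨simplexEdge.map σ.toMap.continuous, fun s => congrArg σ.toMap
    (stdSimplexHomeomorphUnitInterval.symm_apply_apply s).symm, σ.lift_path _ _ _⟩

theorem faceInclusion_apply_succAbove (n : ℕ) (i : Fin (n + 2)) (s : stdSimplex ℝ (Fin (n + 1)))
    (j : Fin (n + 1)) : faceInclusion n i s (i.succAbove j) = s j := by
  change FunOnFinite.linearMap ℝ ℝ i.succAbove s (i.succAbove j) = s j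
  rw [FunOnFinite.linearMap_apply_apply, Finset.sum_eq_single j]
  · intro k hk hkj
    exact (hkj (Fin.succAbove_right_injective (Finset.mem_filter.1 hk).2)).elim
  · simp

theorem faceInclusion_apply_self (n : ℕ) (i : Fin (n + 2)) (s : stdSimplex ℝ (Fin (n + 1))) :
    faceInclusion n i s i = 0 := by
  change FunOnFinite.linearMap ℝ ℝ i.succAbove s i = 0
  rw [FunOnFinite.linearMap_apply_apply]
  refine Finset.sum_eq_zero fun k hk => ?_
  exact (Fin.succAbove_ne i k (Finset.mem_filter.1 hk).2).elim

end LiftedSimplex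

end CoverPoints

namespace LiftedSimplex

variable {X : Type*} [TopologicalSpace X] {x₀ : X}

theorem faceInclusion_one_coords (s : stdSimplex ℝ (Fin 2)) :
    (faceInclusion 1 0 s 1 = s 0 ∧ faceInclusion 1 0 s 2 = s 1) ∧
    (faceInclusion 1 1 s 1 = 0 ∧ faceInclusion 1 1 s 2 = s 1) ∧
    (faceInclusion 1 2 s 1 = s 1 ∧ faceInclusion 1 2 s 2 = 0) :=
  ⟨⟨faceInclusion_apply_succAbove 1 0 s 0, faceInclusion_apply_succAbove 1 0 s 1⟩,
    ⟨faceInclusion_apply_self 1 1 s, faceInclusion_apply_succAbove 1 1 s 1⟩,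
    faceInclusion_apply_succAbove 1 2 s 1, faceInclusion_apply_self 1 2 s⟩

theorem continuous_coord (i : Fin 3) : Continuous fun s : stdSimplex ℝ (Fin 3) => s i :=
  (continuous_apply i).comp continuous_subtype_val

/-- Two composable 1-simplices of the universal cover are two sides of a 2-simplex. -/
theorem exists_concat (a b : LiftedSimplex X x₀ 1) (h : a.vert 1 = b.vert 0) :
    ∃ τ : LiftedSimplex X x₀ 2, τ.face 2 = a ∧ τ.face 0 = b := by
  obtain ⟨p, hp, -⟩ := a.path_of_edge
  obtain ⟨q, hq, -⟩ := b.path_of_edge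
  let q' := q.cast (congrArg Sigma.fst h) rfl
  let m : C(stdSimplex ℝ (Fin 3), X) :=
    ⟨fun s => (p.trans q').extend (s 1 / 2 + s 2), (p.trans q').continuous_extend.comp
      (((continuous_coord 1).div_const 2).add (continuous_coord 2))⟩
  have h2 : m.comp (faceInclusion 1 2) = a.toMap := by
    ext s
    obtain ⟨-, -, e1, e2⟩ := faceInclusion_one_coords s
    change (p.trans q').extend (_ / 2 + _) = _
    have h0 := stdSimplex.zero_le s 1
    have h1 := stdSimplex.le_one s 1
    rw [e1, e2, hp, Path.extend_apply _ ⟨by linarith, by linarith⟩, Path.trans_apply, dif_pos (by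
      simp only; linarith)]
    congr 1
    ext
    change 2 * (s 1 / 2 + 0) = s 1
    ring
  have h0 : m.comp (faceInclusion 1 0) = b.toMap := by
    ext s
    obtain ⟨⟨e1, e2⟩, -, -⟩ := faceInclusion_one_coords s
    change (p.trans q').extend (_ / 2 + _) = _
    have h0 := stdSimplex.zero_le s 1
    have h1 := stdSimplex.le_one s 1
    have h01 := stdSimplex.add_eq_one s
    rw [e1, e2, hq, Path.extend_apply _ ⟨by linarith, by linarith⟩]
    rcases eq_or_lt_of_le h0 with hs | hs
    · have : stdSimplexHomeomorphUnitInterval s = 0 := Subtype.ext hs.symm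
      rw [this, q.source, Path.trans_apply, dif_pos (by
        simp only; linarith)]
      have e : ∀ h, (⟨2 * (s 0 / 2 + s 1), h⟩ : unitInterval) = 1 := fun h => Subtype.ext (by
        change 2 * (s 0 / 2 + s 1) = 1; linarith)
      simp only [e, Path.target]
      exact congrArg Sigma.fst h
    · rw [Path.trans_apply, dif_neg (by
        simp only; linarith)]
      change q _ = q _
      congr 1
      ext
      change 2 * (s 0 / 2 + s 1) - 1 = s 1
      linarith
  obtain ⟨τ, hm, hτ⟩ := exists_lift (x₀ := x₀) m (stdSimplex.vertex 0) (a.vert 0) (by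
    have := congrArg (fun f : C(stdSimplex ℝ (Fin 2), X) => f (stdSimplex.vertex 0)) h2
    change m (faceInclusion 1 2 (stdSimplex.vertex 0)) = _ at this
    rw [faceInclusion_vertex] at this
    exact this.symm)
  have f2 : τ.face 2 = a := by
    refine ext_of_eval (s := stdSimplex.vertex 0) ?_ ?_
    · change τ.toMap.comp _ = _
      rw [hm, h2]
    · exact (vert_face τ 2 0).trans hτ
  refine ⟨τ, f2, ext_of_eval (s := stdSimplex.vertex 0) ?_ ?_⟩
  · change τ.toMap.comp _ = _
    rw [hm, h0]
  · refine (vert_face τ 0 0).trans (Eq.trans ?_ h)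
    rw [← f2]
    exact (vert_face τ 2 1).symm

/-- Two 1-simplices of the universal cover with the same end points: they are two opposite sides of
a square, the other sides being constant, and the square is cut into two triangles. -/
theorem exists_square (a b : LiftedSimplex X x₀ 1) (h0 : a.vert 0 = b.vert 0)
    (h1 : a.vert 1 = b.vert 1) :
    ∃ τ τ' : LiftedSimplex X x₀ 2, τ.face 2 = a ∧ τ'.face 0 = b ∧ τ.face 1 = τ'.face 1 ∧
      (∃ x, ∀ s, (τ.face 0).toMap s = x) ∧ (∃ x, ∀ s, (τ'.face 2).toMap s = x) := by
  have key : ∀ {x y x' y' : X} (p : Path x y) (p' : Path x' y') (u : Path.Homotopic.Quotient x₀ x)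
      (u' : Path.Homotopic.Quotient x₀ x') (w : Path.Homotopic.Quotient x₀ y)
      (w' : Path.Homotopic.Quotient x₀ y') (_ : w = u.trans (.mk p)) (_ : w' = u'.trans (.mk p'))
      (_ : (⟨x, u⟩ : CoverPoint x₀) = ⟨x', u'⟩) (_ : (⟨y, w⟩ : CoverPoint x₀) = ⟨y', w'⟩),
      ∃ F : C(unitInterval × unitInterval, X), (∀ t, F (0, t) = p t) ∧ (∀ t, F (1, t) = p' t) ∧
        (∀ s, F (s, 0) = x) ∧ (∀ s, F (s, 1) = y) := by
    rintro x y x' y' p p' u u' w w' hw hw' e0 e1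
    obtain ⟨rfl, hu⟩ := Sigma.mk.inj e0
    obtain rfl := eq_of_heq hu
    obtain ⟨rfl, hy⟩ := Sigma.mk.inj e1
    obtain rfl := eq_of_heq hy
    have : Path.Homotopic.Quotient.mk p = Path.Homotopic.Quotient.mk p' := by
      have := congrArg u.symm.trans (hw.symm.trans hw')
      rwa [← Path.Homotopic.Quotient.trans_assoc, ← Path.Homotopic.Quotient.trans_assoc,
        Path.Homotopic.Quotient.symm_trans, Path.Homotopic.Quotient.refl_trans,
        Path.Homotopic.Quotient.refl_trans] at this
    obtain ⟨F⟩ := Path.Homotopic.Quotient.exact this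
    exact ⟨F.toContinuousMap, F.apply_zero, F.apply_one, F.source, F.target⟩
  obtain ⟨p, hp, ep⟩ := a.path_of_edge
  obtain ⟨q, hq, eq⟩ := b.path_of_edge
  obtain ⟨F, F0, F1, Fx, Fy⟩ := key p q _ _ _ _ ep eq h0 h1
  let P : ℝ → unitInterval := Set.projIcc 0 1 zero_le_one
  have hP : Continuous P := continuous_projIcc
  have P0 : P 0 = 0 := Set.projIcc_left _
  have P1 : P 1 = 1 := Set.projIcc_right _
  have Ps : ∀ s : stdSimplex ℝ (Fin 2), P (s 1) = stdSimplexHomeomorphUnitInterval s := fun s =>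
    Set.projIcc_of_mem _ ⟨stdSimplex.zero_le s 1, stdSimplex.le_one s 1⟩
  let m : C(stdSimplex ℝ (Fin 3), X) := ⟨fun s => F (P (s 2), P (s 1 + s 2)), F.continuous.comp
    ((hP.comp (continuous_coord 2)).prodMk (hP.comp ((continuous_coord 1).add (continuous_coord 2))))⟩
  let m' : C(stdSimplex ℝ (Fin 3), X) := ⟨fun s => F (P (s 1 + s 2), P (s 2)), F.continuous.comp
    ((hP.comp ((continuous_coord 1).add (continuous_coord 2))).prodMk (hP.comp (continuous_coord 2)))⟩
  have mz : m (stdSimplex.vertex 0) = (a.vert 0).1 := by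
    change F (P ((Pi.single 0 1 : Fin 3 → ℝ) 2), _) = _
    have : P ((Pi.single 0 1 : Fin 3 → ℝ) 1 + (Pi.single 0 1 : Fin 3 → ℝ) 2) = 0 := by simp [P0]
    exact (congrArg (fun z => F (_, z)) this).trans (Fx _)
  have mz' : m' (stdSimplex.vertex 0) = (a.vert 0).1 := by
    change F (_, P ((Pi.single 0 1 : Fin 3 → ℝ) 2)) = _
    have : P ((Pi.single 0 1 : Fin 3 → ℝ) 2) = 0 := by simp [P0]
    exact (congrArg (fun z => F (_, z)) this).trans (Fx _)
  obtain ⟨τ, hm, hτ⟩ := exists_lift (x₀ := x₀) m (stdSimplex.vertex 0) (a.vert 0) mz.symm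
  obtain ⟨τ', hm', hτ'⟩ := exists_lift (x₀ := x₀) m' (stdSimplex.vertex 0) (a.vert 0) mz'.symm
  have f2 : τ.face 2 = a := by
    refine ext_of_eval (s := stdSimplex.vertex 0) ?_ ((vert_face τ 2 0).trans hτ)
    ext s
    change τ.toMap (faceInclusion 1 2 s) = _
    obtain ⟨-, -, e1, e2⟩ := faceInclusion_one_coords s
    rw [hm, hp]
    change F (P _, P (_ + _)) = _
    rw [e1, e2, add_zero, P0, Ps, F0]
  have c2 : ∀ s, (τ'.face 2).toMap s = (a.vert 0).1 := fun s => by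
    change τ'.toMap (faceInclusion 1 2 s) = _
    obtain ⟨-, -, e1, e2⟩ := faceInclusion_one_coords s
    rw [hm']
    change F (P (_ + _), P _) = _
    rw [e1, e2, P0, Fx]
  refine ⟨τ, τ', f2, ?_, ?_, ⟨(a.vert 1).1, fun s => ?_⟩, ⟨(a.vert 0).1, c2⟩⟩
  · refine ext_of_eval (s := stdSimplex.vertex 0) ?_ ?_
    · ext s
      change τ'.toMap (faceInclusion 1 0 s) = _
      obtain ⟨⟨e1, e2⟩, -, -⟩ := faceInclusion_one_coords s
      rw [hm', hq]
      change F (P (_ + _), P _) = _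
      rw [e1, e2, stdSimplex.add_eq_one, P1, Ps, F1]
    · refine (vert_face τ' 0 0).trans (Eq.trans ?_ h0)
      rw [← hτ']
      refine Eq.trans ?_ (eval_of_const (τ'.face 2) (s := stdSimplex.vertex 0)
        (t := stdSimplex.vertex 1) c2 |>.trans (vert_face τ' 2 0))
      exact (vert_face τ' 2 1).symm
  · refine ext_of_eval (s := stdSimplex.vertex 0) ?_ ?_
    · ext s
      change τ.toMap (faceInclusion 1 1 s) = τ'.toMap (faceInclusion 1 1 s)
      obtain ⟨-, ⟨e1, e2⟩, -⟩ := faceInclusion_one_coords s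
      rw [hm', hm]
      change F (P _, P (_ + _)) = F (P (_ + _), P _)
      rw [e1, e2, zero_add]
    · exact ((vert_face τ 1 0).trans hτ).trans ((vert_face τ' 1 0).trans hτ').symm
  · change τ.toMap (faceInclusion 1 0 s) = _
    obtain ⟨⟨e1, e2⟩, -, -⟩ := faceInclusion_one_coords s
    rw [hm]
    change F (P _, P (_ + _)) = _
    rw [e1, e2, stdSimplex.add_eq_one, P1, Fy]

/-- A constant 1-simplex is the face of a constant 2-simplex. -/
theorem exists_const (a : LiftedSimplex X x₀ 1) (h : ∃ x, ∀ s, a.toMap s = x) :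
    ∃ τ : LiftedSimplex X x₀ 2, ∀ i, τ.face i = a := by
  obtain ⟨x, hx⟩ := h
  obtain ⟨τ, hm, hτ⟩ := exists_lift (x₀ := x₀) (ContinuousMap.const (stdSimplex ℝ (Fin 3)) x)
    (stdSimplex.vertex 0) (a.vert 0) (hx _)
  refine ⟨τ, fun i => ext_of_eval (s := stdSimplex.vertex 0) ?_ ?_⟩
  · ext s
    change τ.toMap _ = _
    rw [hm, hx]
    rfl
  · rw [eval_face, τ.eval_of_const (s := stdSimplex.vertex 0) (x := x) (fun s => by rw [hm]; rfl)]
    exact hτ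

end LiftedSimplex

/-! ### Twisted homology of a space and of its fundamental group -/

section TwistedHomologyOfGroup

variable {F : Type*} [Field F] {k : ℕ} {A : Type*} [AddCommGroup A]
  {X : Type*} [TopologicalSpace X] {x₀ : X}

/-- The representation of a group `G` on `F[A]^k` given by `α` and `ψ`. -/
noncomputable def twistedRep {G : Type*} [Group G] (α : G →* GL (Fin k) F)
    (ψ : G →* Multiplicative A) : G →* Module.End (AddMonoidAlgebra F A)
      (Fin k → AddMonoidAlgebra F A) where
  toFun := twistedAction α ψ
  map_one' := by
    simp only [twistedAction, map_one, Units.val_one, toAdd_one]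
    rw [Matrix.map_one _ (map_zero _) (map_one _), Matrix.toLin'_one, ← AddMonoidAlgebra.one_def,
      one_smul]
    rfl
  map_mul' g h := by
    simp only [twistedAction, map_mul, Units.val_mul, toAdd_mul]
    rw [Matrix.map_mul, Matrix.toLin'_mul, ← mul_one (1 : F), ← AddMonoidAlgebra.single_mul_single,
      mul_one, mul_smul]
    refine LinearMap.ext fun v => ?_
    simp only [LinearMap.smul_apply, LinearMap.comp_apply, Module.End.mul_apply, map_smul]
    exact smul_comm _ _ _

variable (α : FundamentalGroup X x₀ →* GL (Fin k) F) (ψ : FundamentalGroup X x₀ →* Multiplicative A)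

namespace TwistedChains

/-- The chain `σ ⊗ v`. -/
noncomputable def cls {n : ℕ} (σ : LiftedSimplex X x₀ n) :
    (Fin k → AddMonoidAlgebra F A) →ₗ[AddMonoidAlgebra F A] TwistedChains α ψ n :=
  (twistedRelations α ψ n).mkQ ∘ₗ Finsupp.lsingle σ

theorem cls_act {n : ℕ} (σ : LiftedSimplex X x₀ n) (g : FundamentalGroup X x₀)
    (v : Fin k → AddMonoidAlgebra F A) :
    cls α ψ (σ.act g) v = cls α ψ σ (twistedRep α ψ g v) :=
  (Submodule.Quotient.eq _).2 (Submodule.subset_span ⟨σ, g, v, rfl⟩)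

theorem boundary_cls {n : ℕ} (σ : LiftedSimplex X x₀ (n + 1)) (v : Fin k → AddMonoidAlgebra F A) :
    twistedBoundary α ψ n (cls α ψ σ v) =
      ∑ i : Fin (n + 2), ((-1 : AddMonoidAlgebra F A) ^ (i : ℕ)) • cls α ψ (σ.face i) v := by
  have : twistedBoundary α ψ n (cls α ψ σ v) =
    (twistedRelations α ψ n).mkQ (freeBoundary F k A x₀ n (Finsupp.single σ v)) := rfl
  rw [this, freeBoundary_single, map_sum]
  simp only [map_smul]
  rfl

theorem boundary_cls_one (σ : LiftedSimplex X x₀ 1) (v : Fin k → AddMonoidAlgebra F A) :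
    twistedBoundary α ψ 0 (cls α ψ σ v) = cls α ψ (σ.face 0) v - cls α ψ (σ.face 1) v := by
  rw [boundary_cls, Fin.sum_univ_two]
  simp [sub_eq_add_neg]

theorem boundary_cls_two (σ : LiftedSimplex X x₀ 2) (v : Fin k → AddMonoidAlgebra F A) :
    twistedBoundary α ψ 1 (cls α ψ σ v) =
      cls α ψ (σ.face 0) v - cls α ψ (σ.face 1) v + cls α ψ (σ.face 2) v := by
  rw [boundary_cls, Fin.sum_univ_three]
  simp [sub_eq_add_neg]

variable {α ψ}

theorem hom_ext {n : ℕ} {W : Type*} [AddCommGroup W] [Module (AddMonoidAlgebra F A) W]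
    {f f' : TwistedChains α ψ n →ₗ[AddMonoidAlgebra F A] W}
    (h : ∀ σ v, f (cls α ψ σ v) = f' (cls α ψ σ v)) : f = f' :=
  Submodule.linearMap_qext _ (Finsupp.lhom_ext fun σ v => h σ v)

/-- The linear map out of the twisted chains given by an equivariant family. -/
noncomputable def lift {n : ℕ} {W : Type*} [AddCommGroup W] [Module (AddMonoidAlgebra F A) W]
    (f : LiftedSimplex X x₀ n → (Fin k → AddMonoidAlgebra F A) →ₗ[AddMonoidAlgebra F A] W)
    (hf : ∀ σ g v, f (σ.act g) v = f σ (twistedRep α ψ g v)) :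
    TwistedChains α ψ n →ₗ[AddMonoidAlgebra F A] W :=
  (twistedRelations α ψ n).liftQ (Finsupp.lsum (AddMonoidAlgebra F A) f) (by
    rw [twistedRelations, Submodule.span_le]
    rintro _ ⟨σ, g, v, rfl⟩
    simp only [SetLike.mem_coe, LinearMap.mem_ker, map_sub, Finsupp.lsum_single]
    exact sub_eq_zero.2 (hf σ g v))

theorem lift_cls {n : ℕ} {W : Type*} [AddCommGroup W] [Module (AddMonoidAlgebra F A) W]
    (f : LiftedSimplex X x₀ n → (Fin k → AddMonoidAlgebra F A) →ₗ[AddMonoidAlgebra F A] W)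
    (hf : ∀ σ g v, f (σ.act g) v = f σ (twistedRep α ψ g v)) (σ : LiftedSimplex X x₀ n)
    (v : Fin k → AddMonoidAlgebra F A) : lift f hf (cls α ψ σ v) = f σ v :=
  Finsupp.lsum_single (AddMonoidAlgebra F A) f σ v

end TwistedChains

open TwistedChains

theorem LiftedSimplex.ext_of_vert {σ τ : LiftedSimplex X x₀ 0} (h : σ.vert 0 = τ.vert 0) : σ = τ := by
  refine LiftedSimplex.ext_of_eval (s := stdSimplex.vertex 0) ?_ h
  ext s
  rw [Subsingleton.elim s (stdSimplex.vertex 0)]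
  exact congrArg Sigma.fst h

theorem LiftedSimplex.exists_vert (e : CoverPoint x₀) : ∃ σ : LiftedSimplex X x₀ 0, σ.vert 0 = e := by
  obtain ⟨σ, -, h⟩ := LiftedSimplex.exists_lift (x₀ := x₀)
    (ContinuousMap.const (stdSimplex ℝ (Fin 1)) e.1) (stdSimplex.vertex 0) e rfl
  exact ⟨σ, h⟩

/-- The class of `σ ⊗ v` modulo boundaries, for a 1-simplex `σ`. -/
noncomputable def edgeClass (σ : LiftedSimplex X x₀ 1) :
    (Fin k → AddMonoidAlgebra F A) →ₗ[AddMonoidAlgebra F A]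
      TwistedChains α ψ 1 ⧸ LinearMap.range (twistedBoundary α ψ 1) :=
  (LinearMap.range (twistedBoundary α ψ 1)).mkQ ∘ₗ cls α ψ σ

theorem edgeClass_face (τ : LiftedSimplex X x₀ 2) :
    edgeClass α ψ (τ.face 1) = edgeClass α ψ (τ.face 2) + edgeClass α ψ (τ.face 0) := by
  refine LinearMap.ext fun v => ?_
  refine sub_eq_zero.1 ?_
  have : (LinearMap.range (twistedBoundary α ψ 1)).mkQ (twistedBoundary α ψ 1 (cls α ψ τ v)) = 0 :=
    (Submodule.Quotient.mk_eq_zero _).2 ⟨_, rfl⟩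
  rw [boundary_cls_two, map_add, map_sub] at this
  change edgeClass α ψ (τ.face 0) v - edgeClass α ψ (τ.face 1) v + edgeClass α ψ (τ.face 2) v = 0
    at this
  rw [LinearMap.add_apply, ← neg_eq_zero, ← this]
  abel

theorem edgeClass_const (σ : LiftedSimplex X x₀ 1) (h : ∃ x, ∀ s, σ.toMap s = x) :
    edgeClass α ψ σ = 0 := by
  obtain ⟨τ, hτ⟩ := σ.exists_const h
  have := edgeClass_face α ψ τ
  rw [hτ, hτ, hτ] at this
  exact left_eq_add.1 this

theorem edgeClass_eq {σ τ : LiftedSimplex X x₀ 1} (h0 : σ.vert 0 = τ.vert 0)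
    (h1 : σ.vert 1 = τ.vert 1) : edgeClass α ψ σ = edgeClass α ψ τ := by
  obtain ⟨a, b, ha, hb, hab, ca, cb⟩ := LiftedSimplex.exists_square σ τ h0 h1
  have e := edgeClass_face α ψ a
  have e' := edgeClass_face α ψ b
  rw [edgeClass_const α ψ _ ca, ha, add_zero] at e
  rw [edgeClass_const α ψ _ cb, hb, zero_add] at e'
  rw [← e, ← e', hab]

/-- The class modulo boundaries of an edge between two points of the universal cover. -/
noncomputable def joinClass (e e' : CoverPoint x₀) :
    (Fin k → AddMonoidAlgebra F A) →ₗ[AddMonoidAlgebra F A]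
      TwistedChains α ψ 1 ⧸ LinearMap.range (twistedBoundary α ψ 1) :=
  edgeClass α ψ (LiftedSimplex.exists_edge e e').choose

theorem edgeClass_eq_joinClass (σ : LiftedSimplex X x₀ 1) :
    edgeClass α ψ σ = joinClass α ψ (σ.vert 0) (σ.vert 1) :=
  edgeClass_eq α ψ (LiftedSimplex.exists_edge _ _).choose_spec.1.symm
    (LiftedSimplex.exists_edge _ _).choose_spec.2.symm

theorem joinClass_add (e e' e'' : CoverPoint x₀) :
    joinClass α ψ e e'' = joinClass α ψ e e' + joinClass α ψ e' e'' := by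
  obtain ⟨a, ha0, ha1⟩ := LiftedSimplex.exists_edge e e'
  obtain ⟨b, hb0, hb1⟩ := LiftedSimplex.exists_edge e' e''
  obtain ⟨τ, h2, h0⟩ := LiftedSimplex.exists_concat a b (ha1.trans hb0.symm)
  have := edgeClass_face α ψ τ
  rw [h2, h0] at this
  simp only [edgeClass_eq_joinClass, ha0, ha1, hb0, hb1] at this
  have e0 : (τ.face 1).vert 0 = e := by
    rw [← ha0, ← h2, LiftedSimplex.vert_face, LiftedSimplex.vert_face]; rfl
  have e1 : (τ.face 1).vert 1 = e'' := by
    rw [← hb1, ← h0, LiftedSimplex.vert_face, LiftedSimplex.vert_face]; rfl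
  rwa [e0, e1] at this

theorem joinClass_self (e : CoverPoint x₀) : joinClass α ψ e e = 0 :=
  left_eq_add.1 (joinClass_add α ψ e e e)

theorem joinClass_symm (e e' : CoverPoint x₀) : joinClass α ψ e e' = -joinClass α ψ e' e := by
  rw [eq_neg_iff_add_eq_zero, ← joinClass_add, joinClass_self]

namespace CoverPoint

/-- The right action of the fundamental group on the universal cover. -/
noncomputable def act (e : CoverPoint x₀) (g : FundamentalGroup X x₀) : CoverPoint x₀ :=
  ⟨e.1, (FundamentalGroup.toPath g).trans e.2⟩

variable (x₀) in
/-- The base point of the universal cover. -/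
def base : CoverPoint x₀ := ⟨x₀, .refl x₀⟩

theorem act_mul (e : CoverPoint x₀) (g h : FundamentalGroup X x₀) : e.act (g * h) = (e.act g).act h :=
  congrArg (Sigma.mk e.1) (Path.Homotopic.Quotient.trans_assoc
    (FundamentalGroup.toPath h) (FundamentalGroup.toPath g) e.2)

open Classical in
/-- A choice of a path class from the base point to every point that it can be joined with, the
constant one at the base point. -/
noncomputable def basePath (x : X) (h : Nonempty (Path.Homotopic.Quotient x₀ x)) :
    Path.Homotopic.Quotient x₀ x :=
  if hx : x = x₀ then (Path.Homotopic.Quotient.refl x₀).cast rfl hx else h.some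

/-- The element of the fundamental group that moves the chosen lift of a point of `X` to the given
one. -/
noncomputable def index (e : CoverPoint x₀) : FundamentalGroup X x₀ :=
  FundamentalGroup.fromPath (e.2.trans (basePath e.1 ⟨e.2⟩).symm)

theorem index_act (e : CoverPoint x₀) (g : FundamentalGroup X x₀) :
    (e.act g).index = e.index * g :=
  Path.Homotopic.Quotient.trans_assoc (FundamentalGroup.toPath g) e.2 (basePath e.1 ⟨e.2⟩).symm

theorem index_base : (base x₀).index = 1 := by
  have : basePath x₀ ⟨Path.Homotopic.Quotient.refl x₀⟩ = .refl x₀ := by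
    rw [basePath, dif_pos rfl]
    exact Path.Homotopic.Quotient.cast_rfl_rfl _
  change (Path.Homotopic.Quotient.refl x₀).trans (basePath x₀ _).symm = _
  rw [this]
  exact Path.Homotopic.Quotient.trans_symm _

theorem index_base_act (g : FundamentalGroup X x₀) : ((base x₀).act g).index = g := by
  rw [index_act, index_base, one_mul]

end CoverPoint

open CoverPoint

theorem joinClass_act (e e' : CoverPoint x₀) (g : FundamentalGroup X x₀)
    (v : Fin k → AddMonoidAlgebra F A) :
    joinClass α ψ (e.act g) (e'.act g) v = joinClass α ψ e e' (twistedRep α ψ g v) := by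
  obtain ⟨a, rfl, rfl⟩ := LiftedSimplex.exists_edge e e'
  rw [← edgeClass_eq_joinClass]
  have : joinClass α ψ ((a.vert 0).act g) ((a.vert 1).act g) = edgeClass α ψ (a.act g) :=
    (edgeClass_eq_joinClass α ψ (a.act g)).symm
  rw [this]
  exact congrArg _ (cls_act α ψ a g v)

/-- From the Fox module of the fundamental group to the twisted chains modulo boundaries. -/
noncomputable def foxToChains : FoxModule (twistedRep α ψ) →ₗ[AddMonoidAlgebra F A]
    TwistedChains α ψ 1 ⧸ LinearMap.range (twistedBoundary α ψ 1) :=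
  FoxModule.lift (fun g => joinClass α ψ (base x₀) ((base x₀).act g)) (fun g h v => by
    rw [joinClass_add α ψ _ ((base x₀).act h), act_mul, LinearMap.add_apply, joinClass_act])

/-- From the twisted 1-chains to the Fox module of the fundamental group. -/
noncomputable def chainsToFox : TwistedChains α ψ 1 →ₗ[AddMonoidAlgebra F A]
    FoxModule (twistedRep α ψ) :=
  TwistedChains.lift (fun σ => FoxModule.of (twistedRep α ψ) ((σ.vert 1).index * (σ.vert 0).index⁻¹)
    ∘ₗ twistedRep α ψ (σ.vert 0).index) (fun σ g v => by
    have h : ∀ i, ((σ.act g).vert i).index = (σ.vert i).index * g := fun i =>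
      index_act (σ.vert i) g
    rw [h, h, mul_inv_rev, mul_assoc, mul_inv_cancel_left, map_mul]
    rfl)

/-- From the twisted 0-chains to the coefficients. -/
noncomputable def chainsToCoeff : TwistedChains α ψ 0 →ₗ[AddMonoidAlgebra F A]
    (Fin k → AddMonoidAlgebra F A) :=
  TwistedChains.lift (fun σ => twistedRep α ψ (σ.vert 0).index) (fun σ g v => by
    have h : ((σ.act g).vert 0).index = (σ.vert 0).index * g := index_act (σ.vert 0) g
    rw [h, map_mul]
    rfl)

/-- The chain homotopy in degree zero: it joins a point of the universal cover with the chosen lift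
of the base point. -/
noncomputable def coneClass : TwistedChains α ψ 0 →ₗ[AddMonoidAlgebra F A]
    TwistedChains α ψ 1 ⧸ LinearMap.range (twistedBoundary α ψ 1) :=
  TwistedChains.lift (fun σ => joinClass α ψ ((base x₀).act (σ.vert 0).index) (σ.vert 0))
    (fun σ g v => by
      have h : (σ.act g).vert 0 = (σ.vert 0).act g := rfl
      rw [h, index_act, act_mul, joinClass_act])

/-- The Fox relations hold for the three sides of a 2-simplex. -/
theorem chainsToFox_boundary (z : TwistedChains α ψ 2) :
    chainsToFox α ψ (twistedBoundary α ψ 1 z) = 0 := by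
  have : chainsToFox α ψ ∘ₗ twistedBoundary α ψ 1 = 0 := by
    refine TwistedChains.hom_ext fun σ v => ?_
    rw [LinearMap.comp_apply, boundary_cls_two, map_add, map_sub]
    simp only [chainsToFox, TwistedChains.lift_cls, LiftedSimplex.vert_face]
    change FoxModule.of _ ((σ.vert 2).index * (σ.vert 1).index⁻¹) (twistedRep α ψ (σ.vert 1).index v)
      - FoxModule.of _ ((σ.vert 2).index * (σ.vert 0).index⁻¹) (twistedRep α ψ (σ.vert 0).index v)
      + FoxModule.of _ ((σ.vert 1).index * (σ.vert 0).index⁻¹) (twistedRep α ψ (σ.vert 0).index v)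
        = 0
    have e : (σ.vert 2).index * (σ.vert 0).index⁻¹ = ((σ.vert 2).index * (σ.vert 1).index⁻¹) *
      ((σ.vert 1).index * (σ.vert 0).index⁻¹) := by group
    rw [e, FoxModule.of_mul_apply _ ((σ.vert 2).index * (σ.vert 1).index⁻¹), ← Module.End.mul_apply, ← map_mul, inv_mul_cancel_right]
    abel
  exact LinearMap.congr_fun this z

theorem boundary_chainsToFox (z : TwistedChains α ψ 1) :
    FoxModule.boundary _ (chainsToFox α ψ z) = chainsToCoeff α ψ (twistedBoundary α ψ 0 z) := by
  have : FoxModule.boundary _ ∘ₗ chainsToFox α ψ = chainsToCoeff α ψ ∘ₗ twistedBoundary α ψ 0 := by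
    refine TwistedChains.hom_ext fun σ v => ?_
    rw [LinearMap.comp_apply, LinearMap.comp_apply, boundary_cls_one, map_sub]
    simp only [chainsToFox, chainsToCoeff, TwistedChains.lift_cls, LiftedSimplex.vert_face,
      LinearMap.comp_apply, FoxModule.boundary_of]
    rw [← Module.End.mul_apply, ← map_mul, inv_mul_cancel_right]
    rfl
  exact LinearMap.congr_fun this z

/-- The homotopy between the identity of the twisted chains and the composition through the Fox
module, in degree one. -/
theorem foxToChains_chainsToFox (z : TwistedChains α ψ 1) :
    foxToChains α ψ (chainsToFox α ψ z) =
      Submodule.Quotient.mk z - coneClass α ψ (twistedBoundary α ψ 0 z) := by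
  have : foxToChains α ψ ∘ₗ chainsToFox α ψ =
      (LinearMap.range (twistedBoundary α ψ 1)).mkQ - coneClass α ψ ∘ₗ twistedBoundary α ψ 0 := by
    refine TwistedChains.hom_ext fun σ v => ?_
    rw [LinearMap.comp_apply, LinearMap.sub_apply, LinearMap.comp_apply, boundary_cls_one, map_sub]
    have e : (LinearMap.range (twistedBoundary α ψ 1)).mkQ (cls α ψ σ v) =
      joinClass α ψ (σ.vert 0) (σ.vert 1) v := by
        rw [← edgeClass_eq_joinClass]; rfl
    rw [e]
    simp only [chainsToFox, coneClass, foxToChains, TwistedChains.lift_cls, LiftedSimplex.vert_face,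
      LinearMap.comp_apply, FoxModule.lift_of]
    rw [← joinClass_act, ← act_mul, inv_mul_cancel_right]
    change joinClass α ψ _ _ v = joinClass α ψ _ _ v - (joinClass α ψ ((base x₀).act (σ.vert 1).index)
      (σ.vert 1) v - joinClass α ψ ((base x₀).act (σ.vert 0).index) (σ.vert 0) v)
    rw [joinClass_add α ψ _ (σ.vert 0) ((base x₀).act (σ.vert 1).index),
      joinClass_add α ψ (σ.vert 0) (σ.vert 1) ((base x₀).act (σ.vert 1).index),
      joinClass_symm α ψ (σ.vert 1) ((base x₀).act (σ.vert 1).index)]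
    simp only [LinearMap.add_apply, LinearMap.neg_apply]
    abel
  exact LinearMap.congr_fun this z

/-- Every element of the first homology of the group comes from a cycle: `[g] ⊗ v` is the image of
an edge from the base point to its translate by `g`, with coefficient `v`. -/
theorem exists_chainsToFox_eq (w : FoxModule (twistedRep α ψ))
    (hw : FoxModule.boundary _ w = 0) :
    ∃ z, twistedBoundary α ψ 0 z = 0 ∧ chainsToFox α ψ z = w := by
  obtain ⟨b, hb⟩ := LiftedSimplex.exists_vert (base x₀)
  have key : ∀ w : FoxModule (twistedRep α ψ), ∃ z, twistedBoundary α ψ 0 z =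
      cls α ψ b (FoxModule.boundary _ w) ∧ chainsToFox α ψ z = w := by
    intro w
    induction w using FoxModule.induction_on with
    | h0 => exact ⟨0, by simp⟩
    | ha x y hx hy =>
      obtain ⟨z, h1, h2⟩ := hx
      obtain ⟨z', h1', h2'⟩ := hy
      exact ⟨z + z', by simp [h1, h1'], by simp [h2, h2']⟩
    | h g v =>
      obtain ⟨a, ha0, ha1⟩ := LiftedSimplex.exists_edge (base x₀) ((base x₀).act g)
      refine ⟨cls α ψ a v, ?_, ?_⟩
      · have e0 : a.face 0 = b.act g := LiftedSimplex.ext_of_vert (by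
          rw [LiftedSimplex.vert_face]
          exact ha1.trans (congrArg (fun e => CoverPoint.act e g) hb).symm)
        have e1 : a.face 1 = b := LiftedSimplex.ext_of_vert (by
          rw [LiftedSimplex.vert_face]
          exact ha0.trans hb.symm)
        rw [boundary_cls_one, e0, e1, cls_act, FoxModule.boundary_of, map_sub]
      · rw [chainsToFox, TwistedChains.lift_cls, ha0, ha1, LinearMap.comp_apply, index_base,
          index_base_act, inv_one, mul_one, map_one]
        rfl
  obtain ⟨z, h1, h2⟩ := key w
  exact ⟨z, by rw [h1, hw, map_zero], h2⟩

/-- The first twisted homology of a space is the first homology of its fundamental group. -/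
theorem nonempty_twistedHomology_one_equiv :
    Nonempty (TwistedHomology α ψ 1 ≃ₗ[AddMonoidAlgebra F A] FoxModule.H1 (twistedRep α ψ)) := by
  let f : twistedCycles α ψ 1 →ₗ[AddMonoidAlgebra F A] FoxModule.H1 (twistedRep α ψ) :=
    (chainsToFox α ψ).restrict (p := twistedCycles α ψ 1) (fun z hz => by
      rw [LinearMap.mem_ker, boundary_chainsToFox, LinearMap.mem_ker.1 hz, map_zero])
  have hf : Function.Surjective f := by
    rintro ⟨w, hw⟩
    obtain ⟨z, hz, rfl⟩ := exists_chainsToFox_eq α ψ w hw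
    exact ⟨⟨z, hz⟩, rfl⟩
  refine ⟨(Submodule.quotEquivOfEq _ _ ?_).trans (f.quotKerEquivOfSurjective hf)⟩
  ext ⟨z, hz⟩
  have hz' : twistedBoundary α ψ 0 z = 0 := hz
  rw [LinearMap.mem_ker]
  change z ∈ LinearMap.range (twistedBoundary α ψ 1) ↔ _
  constructor
  · rintro ⟨y, rfl⟩
    exact Subtype.ext (chainsToFox_boundary α ψ y)
  · intro h
    have h' : chainsToFox α ψ z = 0 := congrArg Subtype.val h
    have := foxToChains_chainsToFox α ψ z
    rw [h', map_zero, hz', map_zero, sub_zero] at this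
    exact (Submodule.Quotient.mk_eq_zero _).1 this.symm

/-- The twisted homology of a space in degree zero is given by the coinvariants of the
representation of its fundamental group. -/
theorem nonempty_twistedHomology_zero_equiv :
    Nonempty (TwistedHomology α ψ 0 ≃ₗ[AddMonoidAlgebra F A] FoxModule.H0 (twistedRep α ψ)) := by
  obtain ⟨b, hb⟩ := LiftedSimplex.exists_vert (base x₀)
  let f : twistedCycles α ψ 0 →ₗ[AddMonoidAlgebra F A] FoxModule.H0 (twistedRep α ψ) :=
    (LinearMap.range (FoxModule.boundary (twistedRep α ψ))).mkQ ∘ₗ chainsToCoeff α ψ ∘ₗ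
      (twistedCycles α ψ 0).subtype
  have hf : Function.Surjective f := by
    intro w
    induction w using Submodule.Quotient.induction_on with | _ v =>
    refine ⟨⟨cls α ψ b v, trivial⟩, ?_⟩
    change Submodule.Quotient.mk (chainsToCoeff α ψ (cls α ψ b v)) = _
    rw [chainsToCoeff, TwistedChains.lift_cls, hb, index_base, map_one]
    rfl
  refine ⟨(Submodule.quotEquivOfEq _ _ ?_).trans (f.quotKerEquivOfSurjective hf)⟩
  ext ⟨z, hz⟩
  rw [LinearMap.mem_ker]
  change z ∈ LinearMap.range (twistedBoundary α ψ 0) ↔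
    Submodule.Quotient.mk (p := LinearMap.range (FoxModule.boundary (twistedRep α ψ)))
      (chainsToCoeff α ψ z) = 0
  rw [Submodule.Quotient.mk_eq_zero]
  have act_sub : ∀ (e e' : LiftedSimplex X x₀ 0) (v : Fin k → AddMonoidAlgebra F A),
      cls α ψ e v - cls α ψ e' v ∈ LinearMap.range (twistedBoundary α ψ 0) := by
    intro e e' v
    obtain ⟨a, ha0, ha1⟩ := LiftedSimplex.exists_edge (e'.vert 0) (e.vert 0)
    refine ⟨cls α ψ a v, ?_⟩
    rw [boundary_cls_one]
    congr 3
    · exact LiftedSimplex.ext_of_vert ((LiftedSimplex.vert_face a 0 0).trans ha1)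
    · exact LiftedSimplex.ext_of_vert ((LiftedSimplex.vert_face a 1 0).trans ha0)
  have boundary_mem : ∀ w : FoxModule (twistedRep α ψ),
      cls α ψ b (FoxModule.boundary _ w) ∈ LinearMap.range (twistedBoundary α ψ 0) := by
    intro w
    induction w using FoxModule.induction_on with
    | h0 => simp
    | ha x y hx hy =>
      rw [map_add, map_add]
      exact add_mem hx hy
    | h g v =>
      rw [FoxModule.boundary_of, map_sub, ← cls_act]
      exact act_sub _ _ _
  constructor
  · rintro ⟨y, rfl⟩
    exact ⟨chainsToFox α ψ y, boundary_chainsToFox α ψ y⟩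
  · rintro ⟨w, hw⟩
    have h1 : z - cls α ψ b (chainsToCoeff α ψ z) ∈ LinearMap.range (twistedBoundary α ψ 0) := by
      have : (LinearMap.range (twistedBoundary α ψ 0)).mkQ ∘ₗ
          (LinearMap.id - cls α ψ b ∘ₗ chainsToCoeff α ψ) = 0 := by
        refine TwistedChains.hom_ext fun σ v => ?_
        refine (Submodule.Quotient.mk_eq_zero _).2 ?_
        change cls α ψ σ v - cls α ψ b (chainsToCoeff α ψ (cls α ψ σ v)) ∈ _
        rw [chainsToCoeff, TwistedChains.lift_cls, ← cls_act]
        exact act_sub _ _ _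
      exact (Submodule.Quotient.mk_eq_zero _).1 (LinearMap.congr_fun this z)
    have h2 := boundary_mem w
    rw [hw] at h2
    simpa using add_mem h1 h2

end TwistedHomologyOfGroup

/-! ### Functoriality and base change of the Fox module -/

namespace FoxModule

section Functoriality

variable {R : Type*} [CommRing R] {G G' : Type*} [Group G] [Group G']
  {V V' : Type*} [AddCommGroup V] [Module R V] [AddCommGroup V'] [Module R V']
  {ρ : G →* Module.End R V} {ρ' : G' →* Module.End R V'}

/-- The map of Fox modules induced by a homomorphism of groups and an equivariant map. -/
noncomputable def map (φ : G →* G') (f : V →ₗ[R] V') (h : ∀ g v, f (ρ g v) = ρ' (φ g) (f v)) :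
    FoxModule ρ →ₗ[R] FoxModule ρ' :=
  lift (fun g => of ρ' (φ g) ∘ₗ f) (fun g g' v => by
    simp only [LinearMap.comp_apply]
    rw [map_mul, of_mul_apply, h])

@[simp] theorem map_of (φ : G →* G') (f : V →ₗ[R] V') (h : ∀ g v, f (ρ g v) = ρ' (φ g) (f v))
    (g : G) (v : V) : map φ f h (of ρ g v) = of ρ' (φ g) (f v) := by
  simp [map]

theorem boundary_map (φ : G →* G') (f : V →ₗ[R] V') (h : ∀ g v, f (ρ g v) = ρ' (φ g) (f v))
    (x : FoxModule ρ) : boundary ρ' (map φ f h x) = f (boundary ρ x) := by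
  have : boundary ρ' ∘ₗ map φ f h = f ∘ₗ boundary ρ := hom_ext fun g v => by simp [h]
  exact LinearMap.congr_fun this x

/-- The isomorphism of Fox modules induced by an isomorphism of representations. -/
noncomputable def mapEquiv (φ : G ≃* G') (f : V ≃ₗ[R] V') (h : ∀ g v, f (ρ g v) = ρ' (φ g) (f v)) :
    FoxModule ρ ≃ₗ[R] FoxModule ρ' :=
  LinearEquiv.ofLinearMap (map φ.toMonoidHom f.toLinearMap h)
    (map φ.symm.toMonoidHom f.symm.toLinearMap (fun g v => by
      apply f.injective
      simp [h]))
    (hom_ext fun g v => by simp) (hom_ext fun g v => by simp)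

theorem boundary_mapEquiv (φ : G ≃* G') (f : V ≃ₗ[R] V') (h : ∀ g v, f (ρ g v) = ρ' (φ g) (f v))
    (x : FoxModule ρ) : boundary ρ' (mapEquiv φ f h x) = f (boundary ρ x) :=
  boundary_map φ.toMonoidHom f.toLinearMap h x

theorem nonempty_H1_equiv (φ : G ≃* G') (f : V ≃ₗ[R] V') (h : ∀ g v, f (ρ g v) = ρ' (φ g) (f v)) :
    Nonempty (H1 ρ ≃ₗ[R] H1 ρ') := by
  refine ⟨(mapEquiv φ f h).ofSubmodules _ _ ?_⟩
  ext x
  simp only [Submodule.mem_map, LinearMap.mem_ker]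
  constructor
  · rintro ⟨y, hy, rfl⟩
    refine (boundary_mapEquiv φ f h y).trans ?_
    rw [hy, map_zero]
  · intro hx
    refine ⟨(mapEquiv φ f h).symm x, ?_, (mapEquiv φ f h).apply_symm_apply x⟩
    apply f.injective
    rw [← boundary_mapEquiv φ f h, LinearEquiv.apply_symm_apply, hx, map_zero]

theorem nonempty_H0_equiv (φ : G ≃* G') (f : V ≃ₗ[R] V') (h : ∀ g v, f (ρ g v) = ρ' (φ g) (f v)) :
    Nonempty (H0 ρ ≃ₗ[R] H0 ρ') := by
  refine ⟨Submodule.Quotient.equiv _ _ f ?_⟩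
  ext x
  simp only [Submodule.mem_map, LinearMap.mem_range]
  constructor
  · rintro ⟨_, ⟨y, rfl⟩, rfl⟩
    exact ⟨mapEquiv φ f h y, boundary_mapEquiv φ f h y⟩
  · rintro ⟨y, rfl⟩
    refine ⟨_, ⟨(mapEquiv φ f h).symm y, rfl⟩, ?_⟩
    refine (boundary_mapEquiv φ f h _).symm.trans ?_
    rw [LinearEquiv.apply_symm_apply]

end Functoriality

section BaseChange

open TensorProduct

variable {R : Type*} (S : Type*) [CommRing R] [CommRing S] [Algebra R S] {G : Type*} [Group G]
  {V : Type*} [AddCommGroup V] [Module R V] (ρ : G →* Module.End R V)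

/-- The base change of a representation. -/
noncomputable def repBaseChange : G →* Module.End S (S ⊗[R] V) where
  toFun g := (ρ g).baseChange S
  map_one' := by rw [map_one]; exact LinearMap.baseChange_one ..
  map_mul' g h := by rw [map_mul]; exact LinearMap.baseChange_mul ..

/-- Fox modules commute with base change. -/
noncomputable def baseChangeEquiv : S ⊗[R] FoxModule ρ ≃ₗ[S] FoxModule (repBaseChange S ρ) :=
  LinearEquiv.ofLinearMap
    ((lift (fun g => (of (repBaseChange S ρ) g).restrictScalars R ∘ₗ TensorProduct.mk R S V 1)
      (fun g h v => by
        simp only [LinearMap.comp_apply, LinearMap.restrictScalars_apply, TensorProduct.mk_apply]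
        rw [of_mul_apply]
        rfl) : FoxModule ρ →ₗ[R] FoxModule (repBaseChange S ρ)).liftBaseChange S)
    (lift (fun g => (of ρ g).baseChange S) (fun g h v => by
      rw [of_mul, LinearMap.baseChange_add, LinearMap.baseChange_comp]
      rfl))
    (hom_ext fun g v => by
      induction v using TensorProduct.induction_on with
      | zero => simp
      | add x y hx hy => simp only [map_add, hx, hy]
      | tmul s v =>
        simp only [LinearMap.comp_apply, lift_of, LinearMap.baseChange_tmul,
          LinearMap.liftBaseChange_tmul, LinearMap.restrictScalars_apply, TensorProduct.mk_apply,
          LinearMap.id_apply]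
        rw [← map_smul, TensorProduct.smul_tmul', smul_eq_mul, mul_one])
    (by
      refine TensorProduct.AlgebraTensorModule.ext fun s x => ?_
      induction x using FoxModule.induction_on with
      | h0 => simp
      | ha x y hx hy =>
        simpa only [map_add, TensorProduct.tmul_add] using congrArg₂ (· + ·) hx hy
      | h g v => simp [TensorProduct.smul_tmul'])

theorem baseChangeEquiv_tmul_of (s : S) (g : G) (v : V) :
    baseChangeEquiv S ρ (s ⊗ₜ of ρ g v) = of (repBaseChange S ρ) g (s ⊗ₜ v) := by
  refine (LinearMap.liftBaseChange_tmul (A := S) _ s (of ρ g v)).trans ?_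
  rw [lift_of]
  simp only [LinearMap.comp_apply, LinearMap.restrictScalars_apply, TensorProduct.mk_apply]
  rw [← map_smul, TensorProduct.smul_tmul', smul_eq_mul, mul_one]

theorem boundary_baseChangeEquiv (x : S ⊗[R] FoxModule ρ) :
    boundary (repBaseChange S ρ) (baseChangeEquiv S ρ x) = (boundary ρ).baseChange S x := by
  have : boundary (repBaseChange S ρ) ∘ₗ (baseChangeEquiv S ρ).toLinearMap =
      (boundary ρ).baseChange S := by
    refine TensorProduct.AlgebraTensorModule.ext fun s x => ?_
    induction x using FoxModule.induction_on with
    | h0 => simp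
    | ha x y hx hy =>
      simpa only [map_add, TensorProduct.tmul_add] using congrArg₂ (· + ·) hx hy
    | h g v =>
      change boundary _ (baseChangeEquiv S ρ (s ⊗ₜ of ρ g v)) = s ⊗ₜ boundary ρ (of ρ g v)
      rw [baseChangeEquiv_tmul_of, boundary_of, boundary_of, TensorProduct.tmul_sub]
      rfl
  exact LinearMap.congr_fun this x

/-- The first homology is a kernel, hence it commutes with flat base change. -/
theorem nonempty_H1_baseChange [Module.Flat R S] :
    Nonempty (S ⊗[R] H1 ρ ≃ₗ[S] H1 (repBaseChange S ρ)) := by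
  refine ⟨(LinearMap.tensorKerEquiv S S (boundary ρ)).trans
    ((baseChangeEquiv S ρ).ofSubmodules _ _ ?_)⟩
  ext x
  simp only [Submodule.mem_map, LinearMap.mem_ker]
  constructor
  · rintro ⟨y, hy, rfl⟩
    exact (boundary_baseChangeEquiv S ρ y).trans hy
  · intro hx
    refine ⟨(baseChangeEquiv S ρ).symm x, ?_, (baseChangeEquiv S ρ).apply_symm_apply x⟩
    refine (boundary_baseChangeEquiv S ρ _).symm.trans ?_
    rw [LinearEquiv.apply_symm_apply, hx]

/-- The coinvariants are a cokernel, hence they commute with every base change. -/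
theorem nonempty_H0_baseChange :
    Nonempty (S ⊗[R] H0 ρ ≃ₗ[S] H0 (repBaseChange S ρ)) := by
  let f := (LinearMap.range (boundary ρ)).mkQ.baseChange S
  have hf : Function.Surjective f :=
    LinearMap.lTensor_surjective S (Submodule.mkQ_surjective (LinearMap.range (boundary ρ)))
  have hex := lTensor_exact S (LinearMap.exact_map_mkQ_range (boundary ρ))
    (Submodule.mkQ_surjective (LinearMap.range (boundary ρ)))
  refine ⟨((Submodule.quotEquivOfEq _ _ ?_).trans (f.quotKerEquivOfSurjective hf)).symm⟩
  ext x
  rw [LinearMap.mem_ker]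
  constructor
  · rintro ⟨y, rfl⟩
    refine (hex _).2 ⟨(baseChangeEquiv S ρ).symm y, ?_⟩
    refine (boundary_baseChangeEquiv S ρ _).symm.trans ?_
    rw [LinearEquiv.apply_symm_apply]
  · intro hx
    obtain ⟨y, hy⟩ := (hex _).1 hx
    exact ⟨baseChangeEquiv S ρ y, (boundary_baseChangeEquiv S ρ y).trans hy⟩

end BaseChange

section MatrixRepresentations

open TensorProduct

variable {R : Type*} {S : Type*} [CommRing R] [CommRing S] [Algebra R S] {G : Type*} [Group G]
  {k : ℕ}

/-- The representation given by matrices. -/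
noncomputable def matrixRep (M : G →* Matrix (Fin k) (Fin k) R) :
    G →* Module.End R (Fin k → R) :=
  (Matrix.toLinAlgEquiv' : Matrix (Fin k) (Fin k) R ≃ₐ[R] _).toAlgHom.toRingHom.toMonoidHom.comp M

theorem matrixRep_apply (M : G →* Matrix (Fin k) (Fin k) R) (g : G) (v : Fin k → R) :
    matrixRep M g v = (M g).mulVec v := rfl

variable (S) in
/-- Matrices over `R`, considered as matrices over the `R`-algebra `S`. -/
noncomputable def matrixBaseChange (M : G →* Matrix (Fin k) (Fin k) R) :
    G →* Matrix (Fin k) (Fin k) S :=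
  (algebraMap R S).mapMatrix.toMonoidHom.comp M

/-- The identification of `S ⊗ Rᵏ` with `Sᵏ` is equivariant. -/
theorem matrixRep_baseChange (M : G →* Matrix (Fin k) (Fin k) R) (g : G)
    (x : S ⊗[R] (Fin k → R)) :
    TensorProduct.piScalarRight R S S (Fin k) (repBaseChange S (matrixRep M) g x) =
      matrixRep (matrixBaseChange S M) g (TensorProduct.piScalarRight R S S (Fin k) x) := by
  induction x using TensorProduct.induction_on with
  | zero => simp
  | add x y hx hy => simp only [map_add, hx, hy]
  | tmul s v =>
    change TensorProduct.piScalarRight R S S (Fin k) (s ⊗ₜ (M g).mulVec v) = _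
    rw [matrixRep_apply, TensorProduct.piScalarRight_apply, TensorProduct.piScalarRight_apply,
      TensorProduct.piScalarRightHom_tmul, TensorProduct.piScalarRightHom_tmul]
    ext i
    simp only [matrixBaseChange, Matrix.mulVec, dotProduct, MonoidHom.comp_apply]
    change _ = ∑ j, algebraMap R S (M g i j) * _
    rw [Finset.sum_smul]
    refine Finset.sum_congr rfl fun j _ => ?_
    rw [Algebra.smul_def, Algebra.smul_def, map_mul, mul_assoc]

theorem nonempty_H1_matrix_baseChange [Module.Flat R S] (M : G →* Matrix (Fin k) (Fin k) R) :
    Nonempty (S ⊗[R] H1 (matrixRep M) ≃ₗ[S] H1 (matrixRep (matrixBaseChange S M))) := by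
  obtain ⟨e⟩ := nonempty_H1_baseChange S (matrixRep M)
  obtain ⟨e'⟩ := nonempty_H1_equiv (MulEquiv.refl G) (TensorProduct.piScalarRight R S S (Fin k))
    (matrixRep_baseChange (S := S) M)
  exact ⟨e.trans e'⟩

theorem nonempty_H0_matrix_baseChange (M : G →* Matrix (Fin k) (Fin k) R) :
    Nonempty (S ⊗[R] H0 (matrixRep M) ≃ₗ[S] H0 (matrixRep (matrixBaseChange S M))) := by
  obtain ⟨e⟩ := nonempty_H0_baseChange S (matrixRep M)
  obtain ⟨e'⟩ := nonempty_H0_equiv (MulEquiv.refl G) (TensorProduct.piScalarRight R S S (Fin k))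
    (matrixRep_baseChange (S := S) M)
  exact ⟨e.trans e'⟩

end MatrixRepresentations

end FoxModule

/-! ### Pushouts with commuting elements -/

/-- `G` is the quotient of the free product of `G₀` and `G₁` by the relation that `m₀ ∈ G₀` and
`m₁ ∈ G₁` commute, in the form of the universal property for groups in a fixed universe. -/
structure IsCommutingPushout.{u, v, v₀, v₁} {G : Type v} {G₀ : Type v₀} {G₁ : Type v₁} [Group G]
    [Group G₀] [Group G₁] (j₀ : G₀ →* G) (j₁ : G₁ →* G) (m₀ : G₀) (m₁ : G₁) : Prop where
  commute : Commute (j₀ m₀) (j₁ m₁)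
  exists_hom : ∀ (H : Type u) [Group H] (f₀ : G₀ →* H) (f₁ : G₁ →* H), Commute (f₀ m₀) (f₁ m₁) →
    ∃ f : G →* H, f.comp j₀ = f₀ ∧ f.comp j₁ = f₁
  hom_ext : ∀ (H : Type u) [Group H] (f f' : G →* H), f.comp j₀ = f'.comp j₀ →
    f.comp j₁ = f'.comp j₁ → f = f'

theorem IsCommutingPushout.symm.{u, v, v₀, v₁} {G : Type v} {G₀ : Type v₀} {G₁ : Type v₁} [Group G]
    [Group G₀] [Group G₁] {j₀ : G₀ →* G} {j₁ : G₁ →* G} {m₀ : G₀} {m₁ : G₁}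
    (h : IsCommutingPushout.{u} j₀ j₁ m₀ m₁) : IsCommutingPushout.{u} j₁ j₀ m₁ m₀ where
  commute := h.commute.symm
  exists_hom H _ f₀ f₁ hf := by
    obtain ⟨f, h0, h1⟩ := h.exists_hom H f₁ f₀ hf.symm
    exact ⟨f, h1, h0⟩
  hom_ext H _ f f' h0 h1 := h.hom_ext H f f' h1 h0

section CrossedHomomorphisms

variable {R : Type*} [CommRing R] {V W : Type*} [AddCommGroup V] [Module R V]
  [AddCommGroup W] [Module R W]

variable (R V W) in
/-- The action of the automorphisms of `V` on the homomorphisms from `V` to `W`. -/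
def homAction : (Module.End R V)ˣ →* MulAut (Multiplicative (V →ₗ[R] W)) where
  toFun u :=
    { toFun n := .ofAdd (n.toAdd ∘ₗ (u⁻¹ : (Module.End R V)ˣ).val)
      invFun n := .ofAdd (n.toAdd ∘ₗ u.val)
      left_inv n := by
        refine Multiplicative.toAdd.injective (LinearMap.ext fun v => ?_)
        change n.toAdd (((u⁻¹ : (Module.End R V)ˣ).val * u.val) v) = n.toAdd v
        rw [Units.inv_mul]; rfl
      right_inv n := by
        refine Multiplicative.toAdd.injective (LinearMap.ext fun v => ?_)
        change n.toAdd ((u.val * (u⁻¹ : (Module.End R V)ˣ).val) v) = n.toAdd v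
        rw [Units.mul_inv]; rfl
      map_mul' _ _ := rfl }
  map_one' := rfl
  map_mul' u u' := by
    ext n : 1
    refine Multiplicative.toAdd.injective (LinearMap.ext fun v => ?_)
    change n.toAdd (((u * u')⁻¹ : (Module.End R V)ˣ).val v) = _
    rw [mul_inv_rev]
    rfl

/-- The element of the semidirect product that stands for the block triangular automorphism
`(v, w) ↦ (u v, d v + w)` of `V × W`. -/
def blockElement (d : V →ₗ[R] W) (u : (Module.End R V)ˣ) :
    Multiplicative (V →ₗ[R] W) ⋊[homAction R V W] (Module.End R V)ˣ :=
  ⟨.ofAdd (d ∘ₗ (u⁻¹ : (Module.End R V)ˣ).val), u⟩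

theorem blockElement_mul (d d' : V →ₗ[R] W) (u u' : (Module.End R V)ˣ) :
    blockElement d u * blockElement d' u' = blockElement (d' + d ∘ₗ u'.val) (u * u') := by
  refine SemidirectProduct.ext (Multiplicative.toAdd.injective (LinearMap.ext fun v => ?_)) rfl
  change d ((u⁻¹ : (Module.End R V)ˣ).val v) + d' ((u'⁻¹ : (Module.End R V)ˣ).val
    ((u⁻¹ : (Module.End R V)ˣ).val v)) = d' (((u * u')⁻¹ : (Module.End R V)ˣ).val v) +
    d (u'.val (((u * u')⁻¹ : (Module.End R V)ˣ).val v))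
  have : ∀ x, u'.val ((u'⁻¹ : (Module.End R V)ˣ).val x) = x := fun x => by
    rw [← Module.End.mul_apply, Units.mul_inv]; rfl
  rw [mul_inv_rev, Units.val_mul, Module.End.mul_apply, this, add_comm]

theorem blockElement_injective {d d' : V →ₗ[R] W} {u : (Module.End R V)ˣ}
    (h : blockElement d u = blockElement d' u) : d = d' := by
  have h1 : d ∘ₗ (u⁻¹ : (Module.End R V)ˣ).val = d' ∘ₗ (u⁻¹ : (Module.End R V)ˣ).val :=
    congrArg (fun x => x.left.toAdd) h
  refine LinearMap.ext fun v => ?_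
  have := LinearMap.congr_fun h1 (u.val v)
  have e : (u⁻¹ : (Module.End R V)ˣ).val (u.val v) = v := by
    rw [← Module.End.mul_apply, Units.inv_mul]; rfl
  simpa [e] using this

theorem exists_blockElement (x : Multiplicative (V →ₗ[R] W) ⋊[homAction R V W] (Module.End R V)ˣ) :
    x = blockElement (x.left.toAdd ∘ₗ x.right.val) x.right := by
  refine SemidirectProduct.ext (Multiplicative.toAdd.injective (LinearMap.ext fun v => ?_)) rfl
  change x.left.toAdd v = x.left.toAdd ((x.right.val * (x.right⁻¹ : (Module.End R V)ˣ).val) v)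
  rw [Units.mul_inv]
  rfl

theorem toHomUnits_comp {M G G' : Type*} [Monoid M] [Group G] [Group G'] (f : G →* M)
    (j : G' →* G) (g : G') : (f.comp j).toHomUnits g = f.toHomUnits (j g) :=
  Units.ext rfl

variable {G : Type*} [Group G] {ρ : G →* Module.End R V}

/-- The homomorphism to the semidirect product that belongs to a crossed homomorphism. -/
def blockHom (D : G → V →ₗ[R] W) (hD : ∀ g h v, D (g * h) v = D h v + D g (ρ h v)) :
    G →* Multiplicative (V →ₗ[R] W) ⋊[homAction R V W] (Module.End R V)ˣ :=
  MonoidHom.mk' (fun g => blockElement (D g) (ρ.toHomUnits g)) (fun g h => by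
    rw [blockElement_mul, ← map_mul]
    congr 1
    exact LinearMap.ext fun v => hD g h v)

/-- Crossed homomorphisms on the two parts of a commuting pushout extend if they satisfy the Fox
derivative of the commutation relation. -/
theorem IsCommutingPushout.exists_crossedHom.{u} {R : Type*} [CommRing R] {V W : Type u}
    [AddCommGroup V] [Module R V] [AddCommGroup W] [Module R W]
    {G G₀ G₁ : Type*} [Group G] [Group G₀] [Group G₁] {j₀ : G₀ →* G} {j₁ : G₁ →* G} {m₀ : G₀}
    {m₁ : G₁} (hj : IsCommutingPushout.{u} j₀ j₁ m₀ m₁) (ρ : G →* Module.End R V)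
    (D₀ : G₀ → V →ₗ[R] W) (h₀ : ∀ g h v, D₀ (g * h) v = D₀ h v + D₀ g (ρ (j₀ h) v))
    (D₁ : G₁ → V →ₗ[R] W) (h₁ : ∀ g h v, D₁ (g * h) v = D₁ h v + D₁ g (ρ (j₁ h) v))
    (hc : ∀ v, D₁ m₁ v + D₀ m₀ (ρ (j₁ m₁) v) = D₀ m₀ v + D₁ m₁ (ρ (j₀ m₀) v)) :
    ∃ D : G → V →ₗ[R] W, (∀ g h v, D (g * h) v = D h v + D g (ρ h v)) ∧
      (∀ g, D (j₀ g) = D₀ g) ∧ ∀ g, D (j₁ g) = D₁ g := by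
  let f₀ := blockHom (ρ := ρ.comp j₀) D₀ h₀
  let f₁ := blockHom (ρ := ρ.comp j₁) D₁ h₁
  -- `hc` says that the block triangular matrices of `m₀` and `m₁` commute
  obtain ⟨f, e0, e1⟩ := hj.exists_hom _ f₀ f₁ (by
    change blockElement _ _ * blockElement _ _ = blockElement _ _ * blockElement _ _
    rw [blockElement_mul, blockElement_mul]
    congr 1
    · exact LinearMap.ext fun v => hc v
    · refine Units.ext ?_
      change ρ (j₀ m₀) * ρ (j₁ m₁) = ρ (j₁ m₁) * ρ (j₀ m₀)
      rw [← map_mul, ← map_mul, hj.commute.eq])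
  -- the diagonal block of the extension is `ρ`, by the uniqueness part of the universal property
  have hr : SemidirectProduct.rightHom.comp f = ρ.toHomUnits :=
    hj.hom_ext _ _ _
      (by rw [MonoidHom.comp_assoc, e0]; exact MonoidHom.ext (toHomUnits_comp ρ j₀))
      (by rw [MonoidHom.comp_assoc, e1]; exact MonoidHom.ext (toHomUnits_comp ρ j₁))
  have hr' : ∀ g, (f g).right = ρ.toHomUnits g := fun g => DFunLike.congr_fun hr g
  have hf : ∀ g, f g = blockElement ((f g).left.toAdd ∘ₗ ρ g) (ρ.toHomUnits g) := fun g => by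
    have := exists_blockElement (f g)
    rw [hr'] at this
    exact this
  refine ⟨fun g => (f g).left.toAdd ∘ₗ ρ g, fun g h v => ?_, fun g => ?_, fun g => ?_⟩
  · have := map_mul f g h
    rw [hf g, hf h, hf (g * h), blockElement_mul, ← map_mul] at this
    exact LinearMap.congr_fun (blockElement_injective this) v
  · have : f (j₀ g) = blockElement (D₀ g) (ρ.toHomUnits (j₀ g)) := by
      rw [← toHomUnits_comp]
      exact DFunLike.congr_fun e0 g
    rw [hf (j₀ g)] at this
    exact blockElement_injective this
  · have : f (j₁ g) = blockElement (D₁ g) (ρ.toHomUnits (j₁ g)) := by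
      rw [← toHomUnits_comp]
      exact DFunLike.congr_fun e1 g
    rw [hf (j₁ g)] at this
    exact blockElement_injective this

/-- A crossed homomorphism that vanishes on both parts of a commuting pushout is zero, since the
corresponding homomorphism agrees with that of the zero map. -/
theorem IsCommutingPushout.crossedHom_eq_zero.{u} {R : Type*} [CommRing R] {V W : Type u}
    [AddCommGroup V] [Module R V] [AddCommGroup W] [Module R W]
    {G G₀ G₁ : Type*} [Group G] [Group G₀] [Group G₁] {j₀ : G₀ →* G} {j₁ : G₁ →* G} {m₀ : G₀}
    {m₁ : G₁} (hj : IsCommutingPushout.{u} j₀ j₁ m₀ m₁) (ρ : G →* Module.End R V)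
    (D : G → V →ₗ[R] W) (hD : ∀ g h v, D (g * h) v = D h v + D g (ρ h v))
    (h₀ : ∀ g, D (j₀ g) = 0) (h₁ : ∀ g, D (j₁ g) = 0) (g : G) : D g = 0 := by
  have := hj.hom_ext _ (blockHom D hD)
    (blockHom (ρ := ρ) (fun _ => (0 : V →ₗ[R] W)) (fun _ _ _ => by simp))
    (MonoidHom.ext fun g => by
      change blockElement (D (j₀ g)) _ = blockElement 0 _
      rw [h₀])
    (MonoidHom.ext fun g => by
      change blockElement (D (j₁ g)) _ = blockElement 0 _
      rw [h₁])
  exact blockElement_injective (DFunLike.congr_fun this g)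

end CrossedHomomorphisms

namespace IsCommutingPushout

universe u

variable {R : Type*} [CommRing R] {V : Type u} [AddCommGroup V] [Module R V]
  {G : Type} {G₀ : Type} {G₁ : Type} [Group G] [Group G₀] [Group G₁] {j₀ : G₀ →* G} {j₁ : G₁ →* G}
  {m₀ : G₀} {m₁ : G₁} (ρ : G →* Module.End R V)

open FoxModule

variable (j₀ j₁) in
/-- The map from the sum of the Fox modules of the two parts to that of the pushout. -/
noncomputable def foxCoprod :
    FoxModule (ρ.comp j₀) × FoxModule (ρ.comp j₁) →ₗ[R] FoxModule ρ :=
  LinearMap.coprod (FoxModule.map j₀ LinearMap.id (fun _ _ => rfl))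
    (FoxModule.map j₁ LinearMap.id (fun _ _ => rfl))

variable (j₀ j₁ m₀ m₁) in
/-- The relation between the Fox modules of the two parts that results from the commutation of `m₀`
and `m₁`. -/
noncomputable def foxCommutator : V →ₗ[R] FoxModule (ρ.comp j₀) × FoxModule (ρ.comp j₁) :=
  LinearMap.prod (FoxModule.of (ρ.comp j₀) m₀ ∘ₗ (ρ (j₁ m₁) - 1))
    (-(FoxModule.of (ρ.comp j₁) m₁ ∘ₗ (ρ (j₀ m₀) - 1)))

variable {ρ}

theorem foxCoprod_surjective (hj : IsCommutingPushout.{u} j₀ j₁ m₀ m₁) :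
    Function.Surjective (foxCoprod j₀ j₁ ρ) := by
  rw [← LinearMap.range_eq_top]
  have key : ∀ g, (LinearMap.range (foxCoprod j₀ j₁ ρ)).mkQ ∘ₗ FoxModule.of ρ g = 0 := by
    refine hj.crossedHom_eq_zero ρ _ (fun g h v => ?_) (fun g => ?_) (fun g => ?_)
    · rw [of_mul, LinearMap.comp_add]
      rfl
    · refine LinearMap.ext fun v => (Submodule.Quotient.mk_eq_zero _).2 ⟨(of _ g v, 0), ?_⟩
      simp [foxCoprod]
    · refine LinearMap.ext fun v => (Submodule.Quotient.mk_eq_zero _).2 ⟨(0, of _ g v), ?_⟩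
      simp [foxCoprod]
  refine eq_top_iff.2 fun x _ => ?_
  induction x using FoxModule.induction_on with
  | h0 => exact zero_mem _
  | ha x y hx hy => exact add_mem (hx trivial) (hy trivial)
  | h g v => exact (Submodule.Quotient.mk_eq_zero _).1 (LinearMap.congr_fun (key g) v)

/-- With `foxCoprod_surjective`, a presentation of the Fox module of the pushout: the sum of the Fox
modules of the parts modulo the Fox derivatives of the commutator of `m₀` and `m₁`. -/
theorem ker_foxCoprod (hj : IsCommutingPushout.{u} j₀ j₁ m₀ m₁) :
    LinearMap.ker (foxCoprod j₀ j₁ ρ) = LinearMap.range (foxCommutator j₀ j₁ m₀ m₁ ρ) := by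
  apply le_antisymm
  · let Q := LinearMap.range (foxCommutator j₀ j₁ m₀ m₁ ρ)
    obtain ⟨D, hD, h0, h1⟩ := hj.exists_crossedHom ρ
      (fun g => Q.mkQ ∘ₗ LinearMap.inl R _ _ ∘ₗ FoxModule.of (ρ.comp j₀) g)
      (fun g h v => by simp only [of_mul, LinearMap.comp_add]; rfl)
      (fun g => Q.mkQ ∘ₗ LinearMap.inr R _ _ ∘ₗ FoxModule.of (ρ.comp j₁) g)
      (fun g h v => by simp only [of_mul, LinearMap.comp_add]; rfl)
      (fun v => by
        have : Q.mkQ (foxCommutator j₀ j₁ m₀ m₁ ρ v) = 0 :=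
          (Submodule.Quotient.mk_eq_zero _).2 ⟨v, rfl⟩
        have e : foxCommutator j₀ j₁ m₀ m₁ ρ v =
            (LinearMap.inr R _ _ (of _ m₁ v) + LinearMap.inl R _ _ (of _ m₀ (ρ (j₁ m₁) v))) -
            (LinearMap.inl R _ _ (of _ m₀ v) + LinearMap.inr R _ _ (of _ m₁ (ρ (j₀ m₀) v))) := by
          simp [foxCommutator]
        rw [e, map_sub, sub_eq_zero, map_add, map_add] at this
        exact this)
    have hL : lift D hD ∘ₗ foxCoprod j₀ j₁ ρ = Q.mkQ := by
      refine LinearMap.prod_ext (FoxModule.hom_ext fun g v => ?_) (FoxModule.hom_ext fun g v => ?_)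
      · simp [foxCoprod, h0]
      · simp [foxCoprod, h1]
    intro x hx
    have := LinearMap.congr_fun hL x
    rw [LinearMap.comp_apply, LinearMap.mem_ker.1 hx, map_zero] at this
    exact (Submodule.Quotient.mk_eq_zero _).1 this.symm
  · rintro _ ⟨v, rfl⟩
    have h1 := of_mul_apply ρ (j₀ m₀) (j₁ m₁) v
    rw [hj.commute.eq, of_mul_apply] at h1
    have e : foxCoprod j₀ j₁ ρ (foxCommutator j₀ j₁ m₀ m₁ ρ v) =
        (of ρ (j₀ m₀) (ρ (j₁ m₁) v) - of ρ (j₀ m₀) v) -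
          (of ρ (j₁ m₁) (ρ (j₀ m₀) v) - of ρ (j₁ m₁) v) := by
      simp [foxCoprod, foxCommutator, sub_eq_add_neg]
    rw [LinearMap.mem_ker, e, sub_eq_zero, sub_eq_sub_iff_add_eq_add, add_comm, ← h1, add_comm]

end IsCommutingPushout

/-! ### The first homology of a commuting pushout -/

theorem Module.length_add_length_eq_of_exact {R A B C D : Type*} [CommRing R] [AddCommGroup A]
    [AddCommGroup B] [AddCommGroup C] [AddCommGroup D] [Module R A] [Module R B] [Module R C]
    [Module R D] (f : A →ₗ[R] B) (g : B →ₗ[R] C) (h : C →ₗ[R] D) (hf : Function.Injective f)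
    (hfg : Function.Exact f g) (hgh : Function.Exact g h) (hh : Function.Surjective h) :
    Module.length R B + Module.length R D = Module.length R A + Module.length R C := by
  have h1 := Module.length_eq_add_of_exact f g.rangeRestrict hf g.surjective_rangeRestrict
    (fun x => by rw [← hfg x]; exact Subtype.ext_iff)
  have h2 := Module.length_eq_add_of_exact (LinearMap.range g).subtype h
    (LinearMap.range g).injective_subtype hh
    (fun x => by
      rw [hgh x]
      constructor
      · rintro ⟨y, rfl⟩; exact ⟨⟨_, y, rfl⟩, rfl⟩
      · rintro ⟨⟨_, y, rfl⟩, rfl⟩; exact ⟨y, rfl⟩)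
  rw [h1, h2, add_assoc]

namespace IsCommutingPushout

universe u

variable {R : Type*} [CommRing R] {V : Type u} [AddCommGroup V] [Module R V]
  {G : Type} {G₀ : Type} {G₁ : Type} [Group G] [Group G₀] [Group G₁] {j₀ : G₀ →* G} {j₁ : G₁ →* G}
  {m₀ : G₀} {m₁ : G₁} {ρ : G →* Module.End R V}

open FoxModule

theorem boundary_foxCoprod (a : FoxModule (ρ.comp j₀)) (b : FoxModule (ρ.comp j₁)) :
    boundary ρ (foxCoprod j₀ j₁ ρ (a, b)) = boundary _ a + boundary _ b := by
  rw [foxCoprod, LinearMap.coprod_apply, map_add, boundary_map, boundary_map]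
  rfl

theorem foxCommutator_apply (v : V) : foxCommutator j₀ j₁ m₀ m₁ ρ v =
    (of (ρ.comp j₀) m₀ (ρ (j₁ m₁) v - v), -of (ρ.comp j₁) m₁ (ρ (j₀ m₀) v - v)) := rfl

/-- The additivity of the homology of a commuting pushout, in the case that the coefficients have
no homology on the subgroup generated by `m₀`. -/
theorem length_H1_aux (hj : IsCommutingPushout.{u} j₀ j₁ m₀ m₁)
    (h₀ : Function.Bijective ⇑(ρ (j₀ m₀) - 1)) (h₁ : Function.Injective ⇑(ρ (j₁ m₁) - 1)) :
    Module.length R (H1 ρ) + Module.length R (H0 (ρ.comp j₁)) =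
      Module.length R (H1 (ρ.comp j₀)) + (Module.length R (H1 (ρ.comp j₁)) +
        Module.length R (V ⧸ LinearMap.range (ρ (j₁ m₁) - 1))) := by
  -- the Fox module of the second part relative to its meridian
  let N := LinearMap.range (of (ρ.comp j₁) m₁)
  let X := FoxModule (ρ.comp j₁) ⧸ N
  have hN : ∀ v, N.mkQ (of (ρ.comp j₁) m₁ v) = 0 := fun v =>
    (Submodule.Quotient.mk_eq_zero _).2 ⟨v, rfl⟩
  obtain ⟨D, hD, hD0, hD1⟩ := hj.exists_crossedHom (W := X) ρ (fun _ => 0) (fun _ _ _ => by simp)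
    (fun g => N.mkQ ∘ₗ of (ρ.comp j₁) g) (fun g h v => by rw [of_mul]; rfl)
    (fun v => by
      change N.mkQ (of (ρ.comp j₁) m₁ v) + 0 = 0 + N.mkQ (of (ρ.comp j₁) m₁ (ρ (j₀ m₀) v))
      rw [hN, hN])
  let T : FoxModule ρ →ₗ[R] X := lift D hD
  have hT : ∀ a b, T (foxCoprod j₀ j₁ ρ (a, b)) = N.mkQ b := by
    have : T ∘ₗ foxCoprod j₀ j₁ ρ = N.mkQ ∘ₗ LinearMap.snd R _ _ :=
      LinearMap.prod_ext (FoxModule.hom_ext fun g v => by simp [T, foxCoprod, hD0])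
        (FoxModule.hom_ext fun g v => by simp [T, foxCoprod, hD1]; rfl)
    exact fun a b => LinearMap.congr_fun this (a, b)
  have hcomm : ∀ v, (ρ (j₁ m₁) - 1) ((ρ (j₀ m₀) - 1) v) = (ρ (j₀ m₀) - 1) ((ρ (j₁ m₁) - 1) v) := by
    have : Commute (ρ (j₁ m₁)) (ρ (j₀ m₀)) := (hj.commute.map ρ).symm
    have := (this.sub_left (Commute.one_left _)).sub_right
      ((Commute.one_right (ρ (j₁ m₁) - 1)))
    exact fun v => LinearMap.congr_fun this.eq v
  -- the exact sequence `0 → H1 (ρ.comp j₀) → H1 ρ → X → 0`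
  have key : Module.length R (H1 ρ) = Module.length R (H1 (ρ.comp j₀)) + Module.length R X := by
    let f : H1 (ρ.comp j₀) →ₗ[R] H1 ρ :=
      (foxCoprod j₀ j₁ ρ ∘ₗ LinearMap.inl R _ _ ∘ₗ Submodule.subtype _).codRestrict _ (fun a => by
        change boundary ρ (foxCoprod j₀ j₁ ρ (a.1, 0)) = 0
        rw [boundary_foxCoprod, a.2, map_zero, zero_add])
    refine Module.length_eq_add_of_exact f (T ∘ₗ Submodule.subtype _) ?_ ?_ ?_
    · rw [← LinearMap.ker_eq_bot, LinearMap.ker_eq_bot']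
      rintro ⟨a, ha⟩ hf
      have hf : foxCoprod j₀ j₁ ρ (a, 0) = 0 := congrArg Subtype.val hf
      rw [← LinearMap.mem_ker, hj.ker_foxCoprod] at hf
      obtain ⟨v, hv⟩ := hf
      rw [foxCommutator_apply, Prod.mk.injEq] at hv
      have h2 := congrArg (boundary _) hv.2
      rw [map_neg, map_zero, neg_eq_zero, boundary_of] at h2
      have h3 : (ρ (j₁ m₁) - 1) ((ρ (j₀ m₀) - 1) v) = 0 := h2
      have h4 : v = 0 := h₀.1 (h₁ (h3.trans (by simp)))
      refine Subtype.ext (hv.1.symm.trans ?_)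
      rw [h4]
      simp
    · intro x
      obtain ⟨b, rfl⟩ := N.mkQ_surjective x
      obtain ⟨v, hv⟩ := h₀.2 (-boundary _ b)
      refine ⟨⟨foxCoprod j₀ j₁ ρ (of _ m₀ v, b), ?_⟩, hT _ _⟩
      rw [LinearMap.mem_ker, boundary_foxCoprod, boundary_of]
      change (ρ (j₀ m₀) - 1) v + _ = 0
      rw [hv, neg_add_cancel]
    · rintro ⟨x, hx⟩
      constructor
      · intro h
        obtain ⟨⟨a, b⟩, rfl⟩ := hj.foxCoprod_surjective x
        have h : N.mkQ b = 0 := (hT a b).symm.trans h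
        obtain ⟨w, rfl⟩ := (Submodule.Quotient.mk_eq_zero _).1 h
        obtain ⟨v, rfl⟩ := h₀.2 w
        have e : foxCoprod j₀ j₁ ρ (a, of _ m₁ ((ρ (j₀ m₀) - 1) v)) =
            foxCoprod j₀ j₁ ρ (a + of _ m₀ (ρ (j₁ m₁) v - v), 0) := by
          rw [← sub_eq_zero, ← map_sub, ← LinearMap.mem_ker, hj.ker_foxCoprod]
          refine ⟨-v, ?_⟩
          rw [map_neg, foxCommutator_apply]
          simp
        rw [LinearMap.mem_ker, e, boundary_foxCoprod, map_zero, add_zero] at hx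
        exact ⟨⟨_, hx⟩, Subtype.ext e.symm⟩
      · rintro ⟨a, ha⟩
        rw [← ha]
        exact (hT _ _).trans (map_zero _)
  -- the exact sequence `0 → H1 (ρ.comp j₁) → X → V / (m₁ - 1) V → H0 (ρ.comp j₁) → 0`
  have hle : LinearMap.range (ρ (j₁ m₁) - 1) ≤ LinearMap.range (boundary (ρ.comp j₁)) := by
    rintro _ ⟨v, rfl⟩
    exact ⟨of _ m₁ v, boundary_of _ _ _⟩
  have key2 : Module.length R X + Module.length R (H0 (ρ.comp j₁)) =
      Module.length R (H1 (ρ.comp j₁)) + Module.length R (V ⧸ LinearMap.range (ρ (j₁ m₁) - 1)) := by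
    refine Module.length_add_length_eq_of_exact (N.mkQ ∘ₗ Submodule.subtype _)
      (Submodule.mapQ N _ (boundary (ρ.comp j₁)) ?_) (Submodule.factor hle) ?_ ?_ ?_
      (Submodule.factor_surjective hle)
    · rintro _ ⟨v, rfl⟩
      exact ⟨v, (boundary_of (ρ.comp j₁) m₁ v).symm⟩
    · rw [← LinearMap.ker_eq_bot, LinearMap.ker_eq_bot']
      rintro ⟨b, hb⟩ h
      obtain ⟨w, rfl⟩ := (Submodule.Quotient.mk_eq_zero _).1 h
      rw [LinearMap.mem_ker, boundary_of] at hb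
      have : w = 0 := h₁ (Eq.trans hb (by simp))
      exact Subtype.ext ((congrArg _ this).trans (map_zero _))
    · intro x
      obtain ⟨b, rfl⟩ := N.mkQ_surjective x
      constructor
      · intro h
        obtain ⟨w, hw⟩ := (Submodule.Quotient.mk_eq_zero _).1 h
        refine ⟨⟨b - of _ m₁ w, ?_⟩, ?_⟩
        · rw [LinearMap.mem_ker, map_sub, boundary_of, ← hw]
          exact sub_self _
        · change N.mkQ (b - of _ m₁ w) = N.mkQ b
          rw [map_sub, hN, sub_zero]
      · rintro ⟨⟨y, hy⟩, hyb⟩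
        rw [← hyb]
        change Submodule.Quotient.mk (boundary (ρ.comp j₁) y) = _
        rw [hy]
        rfl
    · intro x
      induction x using Submodule.Quotient.induction_on with | _ v =>
      constructor
      · intro h
        obtain ⟨b, hb⟩ := (Submodule.Quotient.mk_eq_zero _).1 h
        exact ⟨N.mkQ b, congrArg Submodule.Quotient.mk hb⟩
      · rintro ⟨y, hy⟩
        obtain ⟨b, rfl⟩ := N.mkQ_surjective y
        rw [← hy]
        exact (Submodule.Quotient.mk_eq_zero _).2 ⟨b, rfl⟩
  rw [key, add_assoc, key2]

theorem length_H0_eq_zero {G : Type*} [Group G] {ρ : G →* Module.End R V} {m : G}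
    (h : Function.Surjective ⇑(ρ m - 1)) : Module.length R (H0 ρ) = 0 := by
  rw [Module.length_eq_zero_iff, Submodule.Quotient.subsingleton_iff, LinearMap.range_eq_top]
  intro v
  obtain ⟨w, rfl⟩ := h v
  exact ⟨of _ m w, boundary_of _ _ _⟩

/-- Additivity of the length of the homology of a commuting pushout. The injectivity assumptions and
the surjectivity assumption on one of the meridians make the homology of the subgroup generated by
`m₀` and `m₁` vanish. -/
theorem length_H1 (hj : IsCommutingPushout.{u} j₀ j₁ m₀ m₁)
    (h₀ : Function.Injective ⇑(ρ (j₀ m₀) - 1)) (h₁ : Function.Injective ⇑(ρ (j₁ m₁) - 1))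
    (h : Function.Surjective ⇑(ρ (j₀ m₀) - 1) ∨ Function.Surjective ⇑(ρ (j₁ m₁) - 1)) :
    Module.length R (H1 ρ) + (Module.length R (H0 (ρ.comp j₀)) +
        Module.length R (H0 (ρ.comp j₁))) =
      (Module.length R (H1 (ρ.comp j₀)) + Module.length R (V ⧸ LinearMap.range (ρ (j₀ m₀) - 1))) +
      (Module.length R (H1 (ρ.comp j₁)) +
        Module.length R (V ⧸ LinearMap.range (ρ (j₁ m₁) - 1))) := by
  have aux : ∀ f : Module.End R V, Function.Surjective f →
      Module.length R (V ⧸ LinearMap.range f) = 0 := fun f hf => by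
    rw [Module.length_eq_zero_iff, Submodule.Quotient.subsingleton_iff,
      LinearMap.range_eq_top.2 hf]
  -- `H₀` of a part is a quotient of `V / (m - 1) V`, hence it vanishes if `m - 1` is surjective
  rcases h with h | h
  · have e : Module.length R (H0 (ρ.comp j₀)) = 0 := length_H0_eq_zero (m := m₀) h
    rw [e, aux _ h, zero_add, add_zero]
    exact hj.length_H1_aux ⟨h₀, h⟩ h₁
  · have e : Module.length R (H0 (ρ.comp j₁)) = 0 := length_H0_eq_zero (m := m₁) h
    rw [e, aux _ h, add_zero, add_zero, add_comm _ (Module.length R (H1 (ρ.comp j₁)))]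
    exact hj.symm.length_H1_aux ⟨h₁, h⟩ h₀

/-- The first homology of a commuting pushout is an extension of a submodule of
`V / (m₁ - 1) (m₀ - 1) V` by a quotient of the sum of the homologies of the two parts. -/
theorem exists_ker_le_range (hj : IsCommutingPushout.{u} j₀ j₁ m₀ m₁) :
    ∃ (f : H1 (ρ.comp j₀) × H1 (ρ.comp j₁) →ₗ[R] H1 ρ)
      (T : H1 ρ →ₗ[R] V ⧸ LinearMap.range ((ρ (j₁ m₁) - 1) ∘ₗ (ρ (j₀ m₀) - 1))),
      LinearMap.ker T ≤ LinearMap.range f := by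
  let N := LinearMap.range ((ρ (j₁ m₁) - 1) ∘ₗ (ρ (j₀ m₀) - 1))
  have hcomm : ∀ v, ρ (j₁ m₁) (ρ (j₀ m₀) v) = ρ (j₀ m₀) (ρ (j₁ m₁) v) := fun v =>
    LinearMap.congr_fun (hj.commute.map ρ).symm.eq v
  obtain ⟨D, hD, hD0, hD1⟩ := hj.exists_crossedHom (W := V ⧸ N) ρ
    (fun g => N.mkQ ∘ₗ (ρ (j₀ g) - 1)) (fun g h v => by simp)
    (fun _ => 0) (fun _ _ _ => by simp)
    (fun v => by
      rw [LinearMap.zero_apply, LinearMap.zero_apply, zero_add, add_zero, ← sub_eq_zero,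
        LinearMap.comp_apply, LinearMap.comp_apply, ← map_sub]
      refine (Submodule.Quotient.mk_eq_zero _).2 ⟨v, ?_⟩
      simp only [LinearMap.comp_apply, LinearMap.sub_apply, Module.End.one_apply, map_sub, hcomm]
      abel)
  let T : FoxModule ρ →ₗ[R] V ⧸ N := lift D hD
  have hT : ∀ a b, T (foxCoprod j₀ j₁ ρ (a, b)) = N.mkQ (boundary _ a) := by
    have : T ∘ₗ foxCoprod j₀ j₁ ρ = N.mkQ ∘ₗ boundary _ ∘ₗ LinearMap.fst R _ _ :=
      LinearMap.prod_ext (FoxModule.hom_ext fun g v => by simp [T, foxCoprod, hD0])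
        (FoxModule.hom_ext fun g v => by simp [T, foxCoprod, hD1])
    exact fun a b => LinearMap.congr_fun this (a, b)
  let f : H1 (ρ.comp j₀) × H1 (ρ.comp j₁) →ₗ[R] H1 ρ :=
    (foxCoprod j₀ j₁ ρ ∘ₗ LinearMap.prodMap (Submodule.subtype _) (Submodule.subtype _)).codRestrict
      _ (fun x => by
        change boundary ρ (foxCoprod j₀ j₁ ρ (x.1.1, x.2.1)) = 0
        rw [boundary_foxCoprod, x.1.2, x.2.2, add_zero])
  refine ⟨f, T ∘ₗ Submodule.subtype _, ?_⟩
  rintro ⟨x, hx⟩ h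
  obtain ⟨⟨a, b⟩, rfl⟩ := hj.foxCoprod_surjective x
  have h : N.mkQ (boundary _ a) = 0 := (hT a b).symm.trans h
  obtain ⟨v, hv⟩ := (Submodule.Quotient.mk_eq_zero _).1 h
  rw [LinearMap.mem_ker, boundary_foxCoprod] at hx
  have ha : boundary (ρ.comp j₀) (a - of _ m₀ (ρ (j₁ m₁) v - v)) = 0 := by
    rw [map_sub, boundary_of, ← hv]
    simp only [LinearMap.comp_apply, LinearMap.sub_apply, Module.End.one_apply, map_sub,
      MonoidHom.comp_apply, hcomm]
    abel
  have hab : foxCoprod j₀ j₁ ρ (a, b) = foxCoprod j₀ j₁ ρ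
      (a - of _ m₀ (ρ (j₁ m₁) v - v), b + of _ m₁ (ρ (j₀ m₀) v - v)) := by
    rw [← sub_eq_zero, ← map_sub, ← LinearMap.mem_ker, hj.ker_foxCoprod]
    refine ⟨v, ?_⟩
    rw [foxCommutator_apply]
    simp
  have hb : boundary (ρ.comp j₁) (b + of _ m₁ (ρ (j₀ m₀) v - v)) = 0 := by
    have h2 : boundary ρ (foxCoprod j₀ j₁ ρ (a, b)) = 0 := by rw [boundary_foxCoprod, hx]
    rw [hab, boundary_foxCoprod, ha, zero_add] at h2
    exact h2
  exact ⟨(⟨_, ha⟩, ⟨_, hb⟩), Subtype.ext hab.symm⟩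

theorem finite_H1 [IsNoetherianRing R] [Module.Finite R V]
    (hj : IsCommutingPushout.{u} j₀ j₁ m₀ m₁) [Module.Finite R (H1 (ρ.comp j₀))]
    [Module.Finite R (H1 (ρ.comp j₁))] : Module.Finite R (H1 ρ) := by
  obtain ⟨f, T, h⟩ := hj.exists_ker_le_range (ρ := ρ)
  have : Module.Finite R (LinearMap.ker T) :=
    Module.Finite.of_injective _ (Submodule.inclusion_injective h)
  have := Module.Finite.equiv T.quotKerEquivRange.symm
  exact Module.Finite.of_submodule_quotient (LinearMap.ker T)

/-- The first homology of a commuting pushout is torsion if the homologies of the parts and the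
cokernels of `m₀ - 1` and `m₁ - 1` are. -/
theorem smul_H1_eq_zero (hj : IsCommutingPushout.{u} j₀ j₁ m₀ m₁) {a₀ a₁ d₀ d₁ : R}
    (h₀ : ∀ x : H1 (ρ.comp j₀), a₀ • x = 0) (h₁ : ∀ x : H1 (ρ.comp j₁), a₁ • x = 0)
    (hd₀ : ∀ v, d₀ • v ∈ LinearMap.range (ρ (j₀ m₀) - 1))
    (hd₁ : ∀ v, d₁ • v ∈ LinearMap.range (ρ (j₁ m₁) - 1)) (x : H1 ρ) :
    (a₀ * a₁ * (d₀ * d₁)) • x = 0 := by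
  obtain ⟨f, T, h⟩ := hj.exists_ker_le_range (ρ := ρ)
  have hx : (d₀ * d₁) • x ∈ LinearMap.ker T := by
    rw [LinearMap.mem_ker, map_smul]
    induction T x using Submodule.Quotient.induction_on with | _ v =>
    rw [← Submodule.Quotient.mk_smul, Submodule.Quotient.mk_eq_zero]
    obtain ⟨w, hw⟩ := hd₁ v
    obtain ⟨w', hw'⟩ := hd₀ w
    refine ⟨w', ?_⟩
    rw [LinearMap.comp_apply, hw', map_smul, hw, smul_smul]
  obtain ⟨y, hy⟩ := h hx
  have hy0 : (a₀ * a₁) • y = 0 := by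
    refine Prod.ext ?_ ?_
    · rw [Prod.smul_fst, mul_comm, mul_smul, h₀, smul_zero]; rfl
    · rw [Prod.smul_snd, mul_smul, h₁, smul_zero]; rfl
  rw [mul_smul, ← hy, ← map_smul, hy0, map_zero]

end IsCommutingPushout

/-! ### Laurent polynomial rings -/

section LaurentRings

open LaurentPolynomial

theorem isPrincipalIdealRing_of_isLocalization {R : Type*} [CommRing R] [IsPrincipalIdealRing R]
    (M : Submonoid R) (S : Type*) [CommRing S] [Algebra R S] [IsLocalization M S] :
    IsPrincipalIdealRing S where
  principal I := by
    obtain ⟨a, ha⟩ := (IsPrincipalIdealRing.principal (I.comap (algebraMap R S))).principal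
    refine ⟨algebraMap R S a, ?_⟩
    rw [← IsLocalization.map_under M S I]
    change Ideal.map _ (I.comap (algebraMap R S)) = Ideal.span _
    rw [ha]
    change Ideal.map _ (Ideal.span _) = Ideal.span _
    rw [Ideal.map_span, Set.image_singleton]

instance LaurentPolynomial.isPrincipalIdealRing {F : Type*} [Field F] :
    IsPrincipalIdealRing (LaurentPolynomial F) :=
  isPrincipalIdealRing_of_isLocalization (Submonoid.powers (Polynomial.X : Polynomial F)) _

theorem LaurentPolynomial.isNoetherianRing {R : Type*} [CommRing R] [IsNoetherianRing R] :
    IsNoetherianRing (LaurentPolynomial R) :=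
  IsLocalization.isNoetherianRing (Submonoid.powers (Polynomial.X : Polynomial R)) _
    Polynomial.isNoetherianRing

theorem LaurentPolynomial.uniqueFactorizationMonoid {R : Type*} [CommRing R] [IsDomain R]
    [UniqueFactorizationMonoid R] : UniqueFactorizationMonoid (LaurentPolynomial R) :=
  UniqueFactorizationMonoid.of_isLocalization (Submonoid.powers (Polynomial.X : Polynomial R)) _

/-- A nonzero Laurent polynomial is the product of a power of the variable and of a polynomial with
nonzero constant coefficient. -/
theorem LaurentPolynomial.exists_eq_toLaurent_mul_T {R : Type*} [CommRing R]
    {f : LaurentPolynomial R} (hf : f ≠ 0) :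
    ∃ (P : Polynomial R) (n : ℤ), P.coeff 0 ≠ 0 ∧ f = P.toLaurent * T n := by
  obtain ⟨n, P, hP⟩ := f.exists_T_pow
  have hP0 : P ≠ 0 := by
    rintro rfl
    apply hf
    rw [map_zero] at hP
    exact (isUnit_T (R := R) (n : ℤ)).mul_left_eq_zero.1 hP.symm
  obtain ⟨Q, hQ, hd⟩ := Polynomial.exists_eq_pow_rootMultiplicity_mul_and_not_dvd P hP0 0
  rw [map_zero, sub_zero] at hQ hd
  set m := P.rootMultiplicity 0
  refine ⟨Q, m - n, fun h => hd (Polynomial.X_dvd_iff.2 h), ?_⟩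
  have e : f = P.toLaurent * T (-n) := by
    rw [hP, mul_assoc, ← T_add, add_neg_cancel, T_zero, mul_one]
  rw [e, hQ, map_mul, Polynomial.toLaurent_X_pow, sub_eq_add_neg, T_add, mul_comm (T _), mul_assoc]

/-- The divisors of a nonzero constant are the products of a constant and a power of the
variable. -/
theorem LaurentPolynomial.eq_C_mul_T_of_dvd_C {R : Type*} [CommRing R] [IsDomain R] {a : R}
    (ha : a ≠ 0) {p : LaurentPolynomial R} (hp : p ∣ C a) : ∃ c n, p = C c * T n := by
  obtain ⟨q, hq⟩ := hp
  have h0 : C a ≠ 0 := by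
    rw [← Polynomial.toLaurent_C, Polynomial.toLaurent_ne_zero]
    simpa using ha
  have hp0 : p ≠ 0 := by rintro rfl; simp [hq] at h0
  have hq0 : q ≠ 0 := by rintro rfl; simp [hq] at h0
  obtain ⟨P, n, hP, rfl⟩ := exists_eq_toLaurent_mul_T hp0
  obtain ⟨Q, m, hQ, rfl⟩ := exists_eq_toLaurent_mul_T hq0
  have e : C a = (P * Q).toLaurent * T (n + m) := by
    rw [hq, map_mul, T_add]; ring
  have hPQ : (P * Q).coeff 0 ≠ 0 := by
    rw [Polynomial.mul_coeff_zero]; exact mul_ne_zero hP hQ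
  have hnm : (P * Q).natDegree = 0 := by
    obtain ⟨k, hk | hk⟩ := Int.eq_nat_or_neg (n + m)
    · have : Polynomial.C a = P * Q * Polynomial.X ^ k := by
        apply Polynomial.toLaurent_injective
        rw [Polynomial.toLaurent_C, e, map_mul (Polynomial.toLaurent) (P * Q),
          Polynomial.toLaurent_X_pow, hk]
      have := congrArg Polynomial.natDegree this
      rw [Polynomial.natDegree_C, Polynomial.natDegree_mul_X_pow] at this
      · omega
      · rintro h; simp [h] at hPQ
    · have : Polynomial.C a * Polynomial.X ^ k = P * Q := by
        apply Polynomial.toLaurent_injective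
        rw [map_mul, Polynomial.toLaurent_C, e, Polynomial.toLaurent_X_pow, mul_assoc, ← T_add, hk,
          neg_add_cancel, T_zero, mul_one]
      have hk0 : k = 0 := by
        by_contra hk0
        rw [← this, Polynomial.coeff_mul_X_pow', if_neg (by omega)] at hPQ
        exact hPQ rfl
      rw [← this, hk0, pow_zero, mul_one, Polynomial.natDegree_C]
  have hP0 : P.natDegree = 0 := by
    rw [Polynomial.natDegree_mul (by rintro rfl; simp at hP) (by rintro rfl; simp at hQ)] at hnm
    omega
  obtain ⟨c, rfl⟩ := Polynomial.natDegree_eq_zero.1 hP0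
  exact ⟨c, n, by rw [Polynomial.toLaurent_C]⟩

end LaurentRings

section Width

open LaurentPolynomial

variable {F : Type*} [Field F]

theorem laurentWidth_toLaurent_mul_T {P : Polynomial F} (hP : P.coeff 0 ≠ 0) (n : ℤ) :
    laurentWidth (P.toLaurent * T n) = P.natDegree := by
  have hs : ∀ e : ℤ, e ∈ (P.toLaurent * T n).coeff.support ↔ ∃ k : ℕ, P.coeff k ≠ 0 ∧ e = k + n := by
    intro e
    rw [Finsupp.mem_support_iff, T, AddMonoidAlgebra.coeff_mul_single_apply, mul_one,
      ← Finsupp.mem_support_iff, support_coeff_toLaurent, Finset.mem_map]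
    simp only [Polynomial.mem_support_iff, Nat.castEmbedding_apply]
    exact exists_congr fun k => and_congr_right fun _ => by omega
  apply le_antisymm
  · refine Finset.sup_le fun e he => ?_
    obtain ⟨h1, h2⟩ := Finset.mem_product.1 he
    obtain ⟨k, hk, e1⟩ := (hs _).1 h1
    obtain ⟨l, hl, e2⟩ := (hs _).1 h2
    have := Polynomial.le_natDegree_of_ne_zero hk
    omega
  · have hP0 : P ≠ 0 := by rintro rfl; simp at hP
    have : ((P.natDegree : ℤ) + n, (0 : ℕ) + n) ∈
        (P.toLaurent * T n).coeff.support ×ˢ (P.toLaurent * T n).coeff.support :=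
      Finset.mem_product.2 ⟨(hs _).2 ⟨_, by simpa using hP0, rfl⟩, (hs _).2 ⟨0, hP, rfl⟩⟩
    refine le_trans ?_ (Finset.le_sup (f := fun e : ℤ × ℤ => (e.1 - e.2).toNat) this)
    simp

theorem laurentWidth_mul {f g : LaurentPolynomial F} (hf : f ≠ 0) (hg : g ≠ 0) :
    laurentWidth (f * g) = laurentWidth f + laurentWidth g := by
  obtain ⟨P, n, hP, rfl⟩ := exists_eq_toLaurent_mul_T hf
  obtain ⟨Q, m, hQ, rfl⟩ := exists_eq_toLaurent_mul_T hg
  have e : P.toLaurent * T n * (Q.toLaurent * T m) = (P * Q).toLaurent * T (n + m) := by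
    rw [map_mul, T_add]; ring
  have hPQ : (P * Q).coeff 0 ≠ 0 := by
    rw [Polynomial.mul_coeff_zero]; exact mul_ne_zero hP hQ
  rw [e, laurentWidth_toLaurent_mul_T hP, laurentWidth_toLaurent_mul_T hQ,
    laurentWidth_toLaurent_mul_T hPQ,
    Polynomial.natDegree_mul (by rintro rfl; simp at hP) (by rintro rfl; simp at hQ)]

/-- `det (B x - 1)` is a polynomial in `x` of degree `k`, with leading coefficient `det B` and
nonzero constant coefficient. -/
theorem exists_detPolynomial_eq {k : ℕ} (B : GL (Fin k) F) :
    ∃ P : Polynomial F, P.coeff 0 ≠ 0 ∧ P.natDegree = k ∧ detPolynomial B = P.toLaurent := by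
  let P := ((Polynomial.X : Polynomial F) • B.val.map Polynomial.C +
    (-1 : Matrix (Fin k) (Fin k) F).map Polynomial.C).det
  have hk : P.coeff k ≠ 0 := by
    have := Polynomial.coeff_det_X_add_C_card B.val (-1)
    rw [Fintype.card_fin] at this
    rw [this]
    exact (Matrix.isUnit_iff_isUnit_det _).1 B.isUnit |>.ne_zero
  refine ⟨P, ?_, le_antisymm ?_ (Polynomial.le_natDegree_of_ne_zero hk), ?_⟩
  · rw [Polynomial.coeff_det_X_add_C_zero, Matrix.det_neg, Matrix.det_one, mul_one]
    exact pow_ne_zero _ (neg_ne_zero.2 one_ne_zero)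
  · simpa using Polynomial.natDegree_det_X_add_C_le B.val (-1)
  · rw [detPolynomial, RingHom.map_det]
    congr 1
    ext i j : 1
    by_cases h : i = j
    · subst h
      simp [sub_eq_add_neg]
    · simp [h]

theorem detPolynomial_ne_zero {k : ℕ} (B : GL (Fin k) F) : detPolynomial B ≠ 0 := by
  obtain ⟨P, h0, _, e⟩ := exists_detPolynomial_eq B
  rw [e, Polynomial.toLaurent_ne_zero]
  rintro rfl
  simp at h0

theorem laurentWidth_detPolynomial {k : ℕ} (B : GL (Fin k) F) :
    laurentWidth (detPolynomial B) = k := by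
  obtain ⟨P, h0, hk, e⟩ := exists_detPolynomial_eq B
  have := laurentWidth_toLaurent_mul_T h0 0
  rwa [T_zero, mul_one, ← e, hk] at this

end Width

section TwoVariables

open LaurentPolynomial

variable (F : Type*) [Field F]

/-- The pairs `(a (1 - i), a i)` of exponents. -/
def exponentEquiv (i : Fin 2) : (Fin 2 → ℤ) ≃+ ℤ × ℤ where
  toFun a := (a (1 - i), a i)
  invFun b j := if j = i then b.2 else b.1
  left_inv a := by
    ext j
    fin_cases i <;> fin_cases j <;> simp
  right_inv b := by fin_cases i <;> simp
  map_add' _ _ := rfl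

/-- Laurent polynomials in two variables as Laurent polynomials in the variable `x₁₋ᵢ`, with Laurent
polynomials in the variable `xᵢ` as coefficients. -/
noncomputable def separateVariables (i : Fin 2) :
    AddMonoidAlgebra F (Fin 2 → ℤ) ≃+* LaurentPolynomial (LaurentPolynomial F) :=
  (AddMonoidAlgebra.mapDomainRingEquiv F (exponentEquiv i)).trans AddMonoidAlgebra.curryRingEquiv

theorem separateVariables_single (i : Fin 2) (a : Fin 2 → ℤ) (r : F) :
    separateVariables F i (AddMonoidAlgebra.single a r) =
      AddMonoidAlgebra.single (a (1 - i)) (AddMonoidAlgebra.single (a i) r) := by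
  rw [separateVariables, RingEquiv.trans_apply, AddMonoidAlgebra.mapDomainRingEquiv_single]
  exact AddMonoidAlgebra.curryRingEquiv_single _ _ _

theorem inVariable_single (i : Fin 2) (n : ℤ) (r : F) :
    inVariable F i (AddMonoidAlgebra.single n r) =
      AddMonoidAlgebra.single (Pi.single i n) r :=
  AddMonoidAlgebra.mapDomain_single

theorem separateVariables_inVariable (i : Fin 2) (f : LaurentPolynomial F) :
    separateVariables F i (inVariable F i f) = C f := by
  have h : ∀ n r, separateVariables F i (inVariable F i (AddMonoidAlgebra.single n r)) =
      C (AddMonoidAlgebra.single n r) := fun n r => by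
    rw [inVariable_single, separateVariables_single, Pi.single_eq_same,
      Pi.single_eq_of_ne (by fin_cases i <;> decide)]
    rfl
  have : (separateVariables F i).toRingHom.comp (inVariable F i) = C :=
    AddMonoidAlgebra.ringHom_ext (fun r => h 0 r) (fun n => h n 1)
  exact DFunLike.congr_fun this f

theorem separateVariables_inVariable_other {i j : Fin 2} (hij : i ≠ j) (f : LaurentPolynomial F) :
    separateVariables F i (inVariable F j f) = AddMonoidAlgebra.mapRingHom ℤ C f := by
  have h : ∀ n r, separateVariables F i (inVariable F j (AddMonoidAlgebra.single n r)) =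
      AddMonoidAlgebra.mapRingHom ℤ C (AddMonoidAlgebra.single n r) := fun n r => by
    obtain rfl : j = 1 - i := by revert i j; decide
    rw [inVariable_single, separateVariables_single, Pi.single_eq_same, Pi.single_eq_of_ne hij,
      AddMonoidAlgebra.mapRingHom_single]
    rfl
  have : (separateVariables F i).toRingHom.comp (inVariable F j) =
      AddMonoidAlgebra.mapRingHom ℤ C :=
    AddMonoidAlgebra.ringHom_ext (fun r => h 0 r) (fun n => h n 1)
  exact DFunLike.congr_fun this f

instance : IsNoetherianRing (AddMonoidAlgebra F (Fin 2 → ℤ)) :=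
  have := LaurentPolynomial.isNoetherianRing (R := LaurentPolynomial F)
  isNoetherianRing_of_ringEquiv _ (separateVariables F 0).symm

instance : UniqueFactorizationMonoid (AddMonoidAlgebra F (Fin 2 → ℤ)) :=
  have := LaurentPolynomial.uniqueFactorizationMonoid (R := LaurentPolynomial F)
  (separateVariables F 0).toMulEquiv.symm.uniqueFactorizationMonoid inferInstance

variable {F}

theorem inVariable_injective (i : Fin 2) : Function.Injective (inVariable F i) := by
  intro f g h
  have := congrArg (separateVariables F i) h
  rw [separateVariables_inVariable, separateVariables_inVariable] at this
  simpa using congrArg (fun x : LaurentPolynomial (LaurentPolynomial F) => x.coeff 0) this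

/-- Nonzero polynomials in different variables are coprime. -/
theorem isUnit_of_dvd_inVariable {f g : LaurentPolynomial F} (hf : f ≠ 0) (hg : g ≠ 0)
    {p : AddMonoidAlgebra F (Fin 2 → ℤ)} (h0 : p ∣ inVariable F 0 f) (h1 : p ∣ inVariable F 1 g) :
    IsUnit p := by
  have h0 := map_dvd (separateVariables F 0) h0
  have h1 := map_dvd (separateVariables F 0) h1
  rw [separateVariables_inVariable] at h0
  rw [separateVariables_inVariable_other F (by decide : (0 : Fin 2) ≠ 1)] at h1
  obtain ⟨c, n, hc⟩ := eq_C_mul_T_of_dvd_C hf h0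
  obtain ⟨m, hm⟩ : ∃ m, g.coeff m ≠ 0 := by
    by_contra h
    push Not at h
    exact hg (LaurentPolynomial.ext h)
  have hcu : IsUnit c := by
    obtain ⟨q, hq⟩ : C c ∣ AddMonoidAlgebra.mapRingHom ℤ C g := by
      exact (Dvd.intro (T n) hc.symm).trans h1
    have e : C (g.coeff m) = c * q.coeff m := by
      rw [← smul_eq_C_mul] at hq
      rw [← smul_eq_mul]
      simpa using congrArg (fun x : LaurentPolynomial (LaurentPolynomial F) => x.coeff m) hq
    exact isUnit_of_dvd_unit ⟨_, e⟩ ((isUnit_iff_ne_zero.2 hm).map C)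
  rw [← MulEquiv.isUnit_map (separateVariables F 0), hc]
  exact (hcu.map C).mul (isUnit_T n)

end TwoVariables

/-! ### Presentations and elementary ideals -/

section Presentations

open TensorProduct

variable {R : Type*} [CommRing R]

/-- The rows of `P` are the relations of a presentation of the module `A`. -/
def IsPresentation {r s : ℕ} (P : Matrix (Fin r) (Fin s) R) (A : Type*) [AddCommGroup A]
    [Module R A] : Prop :=
  ∃ q : (Fin s → R) →ₗ[R] A, Function.Surjective q ∧ LinearMap.range P.vecMulLinear = LinearMap.ker q

theorem exists_isPresentation (A : Type*) [AddCommGroup A] [Module R A] [IsNoetherianRing R]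
    [Module.Finite R A] : ∃ (r s : ℕ) (P : Matrix (Fin r) (Fin s) R), IsPresentation P A := by
  obtain ⟨s, q, hq⟩ := Module.Finite.exists_fin' R A
  obtain ⟨r, g, hg⟩ := Module.Finite.exists_fin' R (LinearMap.ker q)
  refine ⟨r, s, fun i => (g (Pi.single i 1)).1, q, hq, ?_⟩
  have : Matrix.vecMulLinear (fun i => (g (Pi.single i 1)).1) = (LinearMap.ker q).subtype ∘ₗ g := by
    refine LinearMap.pi_ext' fun i => LinearMap.ext_ring ?_
    exact Matrix.single_one_vecMul i (Matrix.of fun i => (g (Pi.single i 1)).1)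
  rw [this, LinearMap.range_comp, LinearMap.range_eq_top.2 hg, Submodule.map_top,
    Submodule.range_subtype]

/-- The elementary ideal depends only on the module of relations, and monotonically. -/
theorem elementaryIdeal_mono {r r' s : ℕ} {P : Matrix (Fin r) (Fin s) R}
    {Q : Matrix (Fin r') (Fin s) R}
    (h : LinearMap.range P.vecMulLinear ≤ LinearMap.range Q.vecMulLinear) :
    elementaryIdeal P ≤ elementaryIdeal Q := by
  have : ∀ i, ∃ c : Fin r' → R, P i = ∑ j, c j • Q j := fun i => by
    obtain ⟨c, hc⟩ := h ⟨Pi.single i 1, rfl⟩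
    refine ⟨c, ?_⟩
    rw [Matrix.vecMulLinear_apply, Matrix.vecMulLinear_apply, Matrix.single_one_vecMul] at hc
    refine hc.symm.trans ?_
    ext k
    simp [Matrix.vecMul, dotProduct]
  choose c hc using this
  rw [elementaryIdeal, Ideal.span_le]
  rintro _ ⟨f, rfl⟩
  have e : (P.submatrix f id).det =
      Matrix.detRowAlternating.toMultilinearMap (fun i => ∑ j, c (f i) j • Q j) := by
    change Matrix.detRowAlternating (fun i => P (f i)) = _
    simp only [hc]
    rfl
  refine Set.mem_of_eq_of_mem e ?_
  rw [MultilinearMap.map_sum]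
  refine Submodule.sum_mem _ fun g _ => ?_
  rw [MultilinearMap.map_smul_univ]
  exact Submodule.smul_mem _ _ (Ideal.subset_span ⟨g, rfl⟩)

namespace IsPresentation

variable {A : Type*} [AddCommGroup A] [Module R A] {r s : ℕ} {P : Matrix (Fin r) (Fin s) R}

/-- Cramer's rule: the minors annihilate the module. -/
theorem smul_eq_zero (h : IsPresentation P A) {a : R} (ha : a ∈ elementaryIdeal P) (x : A) :
    a • x = 0 := by
  obtain ⟨q, hq, hP⟩ := h
  obtain ⟨v, rfl⟩ := hq x
  rw [← map_smul, ← LinearMap.mem_ker, ← hP]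
  induction ha using Submodule.span_induction with
  | mem a ha =>
    obtain ⟨f, rfl⟩ := ha
    let M := P.submatrix f id
    refine ⟨∑ i, (Matrix.vecMul v M.adjugate i) • Pi.single (f i) 1, ?_⟩
    rw [map_sum]
    simp only [map_smul, Matrix.vecMulLinear_apply, Matrix.single_one_vecMul]
    have e : Matrix.vecMul (Matrix.vecMul v M.adjugate) M = M.det • v := by
      rw [Matrix.vecMul_vecMul, Matrix.adjugate_mul, Matrix.vecMul_smul, Matrix.vecMul_one]
    refine Eq.trans ?_ e
    ext k
    simp [Matrix.vecMul, dotProduct, M]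
  | zero => rw [zero_smul]; exact zero_mem _
  | add a b _ _ ha hb => rw [add_smul]; exact add_mem ha hb
  | smul c a _ ha => rw [smul_assoc]; exact Submodule.smul_mem _ _ ha

theorem elementaryIdeal_ne_bot [IsDomain R] (h : IsPresentation P A) {a : R} (ha : a ≠ 0)
    (hA : ∀ x : A, a • x = 0) : elementaryIdeal P ≠ ⊥ := by
  obtain ⟨q, hq, hP⟩ := h
  intro h0
  have hle : elementaryIdeal (a • (1 : Matrix (Fin s) (Fin s) R)) ≤ elementaryIdeal P := by
    refine elementaryIdeal_mono ?_
    rintro _ ⟨v, rfl⟩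
    rw [hP, LinearMap.mem_ker, Matrix.vecMulLinear_apply, Matrix.vecMul_smul, map_smul]
    exact hA _
  have hd : (a • (1 : Matrix (Fin s) (Fin s) R)).det ∈ elementaryIdeal P :=
    hle (Ideal.subset_span ⟨id, rfl⟩)
  rw [h0, Ideal.mem_bot, Matrix.det_smul, Matrix.det_one, mul_one] at hd
  exact pow_ne_zero _ ha hd

theorem of_equiv {B : Type*} [AddCommGroup B] [Module R B] (h : IsPresentation P A)
    (e : A ≃ₗ[R] B) : IsPresentation P B := by
  obtain ⟨q, hq, hP⟩ := h
  refine ⟨e.toLinearMap ∘ₗ q, e.surjective.comp hq, ?_⟩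
  rw [hP, LinearMap.ker_comp_of_ker_eq_bot _ e.ker]

variable (S : Type*) [CommRing S] [Algebra R S]

theorem baseChange (h : IsPresentation P A) :
    IsPresentation (P.map (algebraMap R S)) (S ⊗[R] A) := by
  obtain ⟨q, hq, hP⟩ := h
  let e := TensorProduct.piScalarRight R S S (Fin s)
  let e' := TensorProduct.piScalarRight R S S (Fin r)
  have hex : Function.Exact (P.vecMulLinear.lTensor S) (q.lTensor S) :=
    lTensor_exact S (LinearMap.exact_iff.2 hP.symm) hq
  have hc : (P.map (algebraMap R S)).vecMulLinear ∘ₗ e'.toLinearMap =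
      e.toLinearMap ∘ₗ P.vecMulLinear.baseChange S := by
    refine TensorProduct.AlgebraTensorModule.ext fun a x => ?_
    ext k
    simp [e, e', Matrix.vecMul, dotProduct, Algebra.smul_def, Finset.sum_mul]
    refine Finset.sum_congr rfl fun _ _ => ?_
    ring
  refine ⟨q.baseChange S ∘ₗ e.symm.toLinearMap, ?_, ?_⟩
  · exact (LinearMap.lTensor_surjective S hq).comp e.symm.surjective
  · ext y
    rw [LinearMap.mem_ker, LinearMap.comp_apply]
    refine Iff.trans ?_ (hex (e.symm y)).symm
    constructor
    · rintro ⟨x, rfl⟩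
      refine ⟨e'.symm x, ?_⟩
      apply e.injective
      have := LinearMap.congr_fun hc (e'.symm x)
      simp only [LinearMap.comp_apply, LinearEquiv.coe_coe, LinearEquiv.apply_symm_apply] at this
      rw [LinearEquiv.apply_symm_apply, this]
      rfl
    · rintro ⟨x, hx⟩
      refine ⟨e' x, ?_⟩
      have := LinearMap.congr_fun hc x
      simp only [LinearMap.comp_apply, LinearEquiv.coe_coe] at this
      rw [this, ← e.apply_symm_apply y, ← hx]
      rfl

end IsPresentation

theorem elementaryIdeal_map (S : Type*) [CommRing S] [Algebra R S] {r s : ℕ}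
    (P : Matrix (Fin r) (Fin s) R) :
    elementaryIdeal (P.map (algebraMap R S)) = (elementaryIdeal P).map (algebraMap R S) := by
  rw [elementaryIdeal, elementaryIdeal, Ideal.map_span, ← Set.range_comp]
  congr 2
  ext f
  rw [Function.comp_apply, RingHom.map_det]
  rfl

theorem elementaryIdeal_square {s : ℕ} (Q : Matrix (Fin s) (Fin s) R) :
    elementaryIdeal Q = Ideal.span {Q.det} := by
  apply le_antisymm
  · rw [elementaryIdeal, Ideal.span_le]
    rintro _ ⟨f, rfl⟩
    by_cases hf : Function.Injective f
    · let e := Equiv.ofBijective f (Finite.injective_iff_bijective.1 hf)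
      change (Q.submatrix e id).det ∈ _
      rw [Matrix.det_permute]
      exact Ideal.mul_mem_left _ _ (Ideal.mem_span_singleton_self _)
    · simp only [Function.Injective, not_forall] at hf
      obtain ⟨i, j, hij, hne⟩ := hf
      have : (Q.submatrix f id).det = 0 :=
        Matrix.det_zero_of_row_eq hne (by ext k; simp [hij])
      exact Set.mem_of_eq_of_mem this (zero_mem _)
  · rw [Ideal.span_singleton_le_iff_mem]
    exact Ideal.subset_span ⟨id, rfl⟩

/-- Over a principal ideal domain, a module whose elementary ideal is generated by `d ≠ 0` has the
same length as the quotient by `d`. -/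
theorem IsPresentation.length_eq [IsDomain R] [IsPrincipalIdealRing R] {A : Type*} [AddCommGroup A]
    [Module R A] {r s : ℕ} {P : Matrix (Fin r) (Fin s) R} (h : IsPresentation P A) {d : R}
    (hd : d ≠ 0) (hE : elementaryIdeal P = Ideal.span {d}) : Module.length R A = Ring.ord R d := by
  obtain ⟨q, hq, hP⟩ := h
  let N := LinearMap.ker q
  let b := Pi.basisFun R (Fin s)
  have hrow : ∀ i, P i ∈ N := fun i => by
    change _ ∈ LinearMap.ker q
    rw [← hP]
    exact ⟨Pi.single i 1, Matrix.single_one_vecMul i P⟩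
  -- a nonzero minor shows that the relations have full rank
  have hrank : Module.finrank R N = Module.finrank R (Fin s → R) := by
    apply le_antisymm (Submodule.finrank_le N)
    obtain ⟨f, hf⟩ : ∃ f : Fin s → Fin r, (P.submatrix f id).det ≠ 0 := by
      by_contra hcon
      push Not at hcon
      have : elementaryIdeal P ≤ ⊥ := by
        rw [elementaryIdeal, Ideal.span_le]
        rintro _ ⟨f, rfl⟩
        exact hcon f
      rw [hE, Ideal.span_singleton_le_iff_mem] at this
      exact hd this
    have hli : LinearIndependent R (fun i => (⟨P (f i), hrow _⟩ : N)) := by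
      apply LinearIndependent.of_comp N.subtype
      exact Matrix.linearIndependent_rows_of_det_ne_zero hf
    simpa using hli.fintype_card_le_finrank
  -- the module of relations also has a square matrix of relations `Q`, from its Smith normal form
  let a := Submodule.smithNormalFormCoeffs b hrank
  let bM := Submodule.smithNormalFormTopBasis b hrank
  let bN := Submodule.smithNormalFormBotBasis b hrank
  have hsnf : ∀ i, (bN i : Fin s → R) = a i • bM i := Submodule.smithNormalFormBotBasis_def b hrank
  let Q : Matrix (Fin s) (Fin s) R := fun i => bN i
  have hQ : LinearMap.range Q.vecMulLinear = N := by
    have : Q.vecMulLinear = N.subtype ∘ₗ bN.equivFun.symm.toLinearMap := by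
      refine LinearMap.pi_ext' fun i => LinearMap.ext_ring ?_
      simp
      rfl
    rw [this, LinearMap.range_comp, LinearEquiv.range, Submodule.map_top, Submodule.range_subtype]
  have hQE : Ideal.span {d} = Ideal.span {Q.det} := by
    rw [← hE, ← elementaryIdeal_square]
    exact le_antisymm (elementaryIdeal_mono (hP.trans hQ.symm).le)
      (elementaryIdeal_mono (hQ.trans hP.symm).le)
  have hQd : Q.det = (∏ i, a i) * b.det bM := by
    have : Q = Matrix.diagonal a * (b.toMatrix bM).transpose := by
      ext i j
      rw [Matrix.diagonal_mul]
      change (bN i : Fin s → R) j = _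
      rw [hsnf]
      simp [Module.Basis.toMatrix, b]
    rw [this, Matrix.det_mul, Matrix.det_diagonal, Matrix.det_transpose, Module.Basis.det_apply]
  have hu : IsUnit (b.det bM) := b.isUnit_det bM
  have hord : Ring.ord R d = Ring.ord R (∏ i, a i) := by
    rw [Ring.ord_eq_of_associated (Ideal.span_singleton_eq_span_singleton.1 hQE), hQd,
      Ring.ord_mul_of_isUnit_right hu]
  have hprod : ∀ t : Finset (Fin s), Ring.ord R (∏ i ∈ t, a i) = ∑ i ∈ t, Ring.ord R (a i) := by
    intro t
    induction t using Finset.induction_on with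
    | empty => simp
    | insert i t hi ih =>
      rw [Finset.prod_insert hi, Finset.sum_insert hi, Ring.ord_mul, ih]
      exact mem_nonZeroDivisors_of_ne_zero (Finset.prod_ne_zero_iff.2 fun j _ =>
        Submodule.smithNormalFormCoeffs_ne_zero b hrank j)
  have e : A ≃ₗ[R] (Fin s → R) ⧸ N := (q.quotKerEquivOfSurjective hq).symm
  rw [hord, hprod, e.length_eq, (Submodule.quotientEquivPiSpan N b hrank).length_eq,
    Module.length_pi_of_fintype]
  rfl

end Presentations

/-! ### Orders and localization at prime elements -/

section LocalizationAtPrimeElements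

variable {R : Type*} [CommRing R]

theorem Localization.AtPrime.isPrincipalIdealRing_of_span [IsDomain R] [IsNoetherianRing R] (p : R)
    [(Ideal.span {p}).IsPrime] :
    IsPrincipalIdealRing (Localization.AtPrime (Ideal.span {p})) := by
  let S := Localization.AtPrime (Ideal.span {p})
  have : IsNoetherianRing S := IsLocalization.isNoetherianRing (Ideal.span {p}).primeCompl S
    inferInstance
  have : IsDomain S := IsLocalization.isDomain_localization
    (Ideal.primeCompl_le_nonZeroDivisors _)
  have h : (IsLocalRing.maximalIdeal S).IsPrincipal := by
    rw [← Localization.AtPrime.map_eq_maximalIdeal, Ideal.map_span, Set.image_singleton]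
    exact ⟨_, rfl⟩
  exact ((tfae_of_isNoetherianRing_of_isLocalRing_of_isDomain S).out 0 4).2 h

theorem Localization.AtPrime.isUnit_algebraMap_span_iff (p : R) [(Ideal.span {p}).IsPrime] (a : R) :
    IsUnit (algebraMap R (Localization.AtPrime (Ideal.span {p})) a) ↔ ¬ p ∣ a := by
  rw [IsLocalization.AtPrime.isUnit_to_map_iff _ (Ideal.span {p}) a, ← Ideal.mem_span_singleton]
  rfl

theorem Localization.AtPrime.algebraMap_injective [IsDomain R] (P : Ideal R) [P.IsPrime] :
    Function.Injective (algebraMap R (Localization.AtPrime P)) :=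
  IsLocalization.injective _ P.primeCompl_le_nonZeroDivisors

theorem Ring.ord_pos_iff {S : Type*} [CommRing S] (x : S) : Ring.ord S x ≠ 0 ↔ ¬ IsUnit x := by
  rw [Ring.ord, ne_eq, Module.length_eq_zero_iff, Submodule.Quotient.subsingleton_iff,
    Ideal.span_singleton_eq_top]

/-- In a unique factorization domain, divisibility may be tested by the orders of vanishing at the
prime elements. -/
theorem dvd_of_forall_ord_le [IsDomain R] [IsNoetherianRing R] [UniqueFactorizationMonoid R] {a b : R}
    (ha : a ≠ 0) (hb : b ≠ 0)
    (h : ∀ (p : R) [(Ideal.span {p}).IsPrime], p ≠ 0 →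
      Ring.ord (Localization.AtPrime (Ideal.span {p})) (algebraMap R _ a) ≤
        Ring.ord (Localization.AtPrime (Ideal.span {p})) (algebraMap R _ b)) : a ∣ b := by
  induction a using UniqueFactorizationMonoid.induction_on_prime generalizing b with
  | h₁ => exact absurd rfl ha
  | h₂ u hu => exact hu.dvd
  | h₃ a p ha0 hp ih =>
    have hpb : p ∣ b := by
      have := (Ideal.span_singleton_prime hp.ne_zero).2 hp
      by_contra hpb
      have h1 := (Localization.AtPrime.isUnit_algebraMap_span_iff p b).2 hpb
      have h2 := h p hp.ne_zero
      rw [Ring.ord_of_isUnit h1, nonpos_iff_eq_zero] at h2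
      have h3 := not_not.1 (mt (Ring.ord_pos_iff _).2 (not_not.2 h2))
      exact (Localization.AtPrime.isUnit_algebraMap_span_iff p _).1 h3 (Dvd.intro _ rfl)
    obtain ⟨c, rfl⟩ := hpb
    refine mul_dvd_mul_left p (ih ha0 (right_ne_zero_of_mul hb) fun q hq hq0 => ?_)
    let S := Localization.AtPrime (Ideal.span {q})
    have := Localization.AtPrime.isPrincipalIdealRing_of_span q
    have : IsDomain S := IsLocalization.isDomain_localization
      (Ideal.primeCompl_le_nonZeroDivisors _)
    have hn : ∀ x : R, x ≠ 0 → algebraMap R S x ∈ nonZeroDivisors S := fun x hx =>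
      mem_nonZeroDivisors_of_ne_zero
        ((map_ne_zero_iff _ (Localization.AtPrime.algebraMap_injective _)).2 hx)
    have := h q hq0
    rw [map_mul, map_mul, Ring.ord_mul' _ (hn p hp.ne_zero), Ring.ord_mul' _ (hn p hp.ne_zero)] at this
    exact (ENat.add_le_add_iff_left (Ring.ord_ne_top (hn p hp.ne_zero))).1 this

end LocalizationAtPrimeElements

namespace IsOrder

open TensorProduct

variable {R : Type*} [CommRing R] {A : Type*} [AddCommGroup A] [Module R A] {d : R}

theorem of_equiv {B : Type*} [AddCommGroup B] [Module R B] (h : IsOrder A d) (e : A ≃ₗ[R] B) :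
    IsOrder B d := by
  obtain ⟨r, s, P, q, hq, hP, hd⟩ := h
  obtain ⟨q', hq', hP'⟩ := IsPresentation.of_equiv ⟨q, hq, hP⟩ e
  exact ⟨r, s, P, q', hq', hP', hd⟩

theorem ne_zero [IsDomain R] (h : IsOrder A d) {a : R} (ha : a ≠ 0) (hA : ∀ x : A, a • x = 0) :
    d ≠ 0 := by
  obtain ⟨r, s, P, q, hq, hP, hd, -⟩ := h
  rintro rfl
  refine IsPresentation.elementaryIdeal_ne_bot ⟨q, hq, hP⟩ ha hA (le_bot_iff.1 (hd.trans ?_))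
  simp

theorem of_associated {d' : R} (h : IsOrder A d) (hd : Associated d d') [IsDomain R] :
    IsOrder A d' := by
  rwa [IsOrder, ← Ideal.span_singleton_eq_span_singleton.2 hd]

/-- Every finitely presented module over a unique factorization domain has an order. -/
theorem exists_isOrder [IsDomain R] [UniqueFactorizationMonoid R] [IsNoetherianRing R]
    (A : Type*) [AddCommGroup A] [Module R A] [Module.Finite R A] : ∃ d : R, IsOrder A d := by
  obtain ⟨r, s, P, q, hq, hP⟩ := exists_isPresentation (R := R) A
  let _ : StrongNormalizationMonoid R := UniqueFactorizationMonoid.strongNormalizationMonoid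
  let _ : NormalizedGCDMonoid R := UniqueFactorizationMonoid.toNormalizedGCDMonoid R
  refine ⟨Finset.univ.gcd fun f : Fin s → Fin r => (P.submatrix f id).det, r, s, P, q, hq, hP,
    ?_, fun e he => ?_⟩
  · rw [elementaryIdeal, Ideal.span_le]
    rintro _ ⟨f, rfl⟩
    exact Ideal.mem_span_singleton.2 (Finset.gcd_dvd (Finset.mem_univ f))
  · rw [Ideal.span_singleton_le_span_singleton]
    exact Finset.dvd_gcd fun f _ =>
      Ideal.mem_span_singleton.1 (he (Ideal.subset_span ⟨f, rfl⟩))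

/-- Over a principal ideal ring, the order generates the elementary ideal. -/
theorem exists_isPresentation [IsPrincipalIdealRing R] (h : IsOrder A d) :
    ∃ (r s : ℕ) (P : Matrix (Fin r) (Fin s) R), IsPresentation P A ∧
      elementaryIdeal P = Ideal.span {d} := by
  obtain ⟨r, s, P, q, hq, hP, hd, hmin⟩ := h
  obtain ⟨e, he⟩ := (IsPrincipalIdealRing.principal (elementaryIdeal P)).principal
  refine ⟨r, s, P, ⟨q, hq, hP⟩, le_antisymm hd ((hmin e he.le).trans he.ge)⟩

theorem smul_eq_zero [IsPrincipalIdealRing R] (h : IsOrder A d) (x : A) : d • x = 0 := by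
  obtain ⟨r, s, P, hP, hE⟩ := h.exists_isPresentation
  exact hP.smul_eq_zero (hE ▸ Ideal.mem_span_singleton_self d) x

theorem length_baseChange [IsPrincipalIdealRing R] (h : IsOrder A d) (S : Type*) [CommRing S]
    [Algebra R S] [IsDomain S] [IsPrincipalIdealRing S] (hd : algebraMap R S d ≠ 0) :
    Module.length S (S ⊗[R] A) = Ring.ord S (algebraMap R S d) := by
  obtain ⟨r, s, P, hP, hE⟩ := h.exists_isPresentation
  refine (hP.baseChange S).length_eq hd ?_
  rw [elementaryIdeal_map, hE, Ideal.map_span, Set.image_singleton]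

/-- At a prime element, the elementary ideal is generated by the order, since the quotient of the
elementary ideal by the order has no divisors. -/
theorem length_localization [IsDomain R] [IsNoetherianRing R] (h : IsOrder A d) (hd : d ≠ 0) (p : R)
    [hp : (Ideal.span {p}).IsPrime] :
    Module.length (Localization.AtPrime (Ideal.span {p}))
      (Localization.AtPrime (Ideal.span {p}) ⊗[R] A) =
      Ring.ord (Localization.AtPrime (Ideal.span {p})) (algebraMap R _ d) := by
  obtain ⟨r, s, P, q, hq, hP, hle, hmin⟩ := h
  let S := Localization.AtPrime (Ideal.span {p})
  have := Localization.AtPrime.isPrincipalIdealRing_of_span p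
  have : IsDomain S := IsLocalization.isDomain_localization
    (Ideal.primeCompl_le_nonZeroDivisors _)
  have hpu : ¬ IsUnit p := fun hu => hp.ne_top (Ideal.span_singleton_eq_top.2 hu)
  -- otherwise `d * p` would generate a smaller principal ideal that contains the minors
  obtain ⟨x, hx, y, rfl, hy⟩ : ∃ x ∈ elementaryIdeal P, ∃ y, x = d * y ∧ ¬ p ∣ y := by
    by_contra hcon
    push Not at hcon
    have := hmin (d * p) fun x hx => by
      obtain ⟨y, rfl⟩ := Ideal.mem_span_singleton.1 (hle hx)
      exact Ideal.mem_span_singleton.2 (mul_dvd_mul_left d (hcon _ hx y rfl))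
    rw [Ideal.span_singleton_le_span_singleton] at this
    obtain ⟨z, hz⟩ := this
    refine hpu (IsUnit.of_mul_eq_one z (mul_left_cancel₀ hd ?_))
    rw [mul_one, ← mul_assoc, ← hz]
  refine (IsPresentation.baseChange S ⟨q, hq, hP⟩).length_eq
    ((map_ne_zero_iff _ (Localization.AtPrime.algebraMap_injective _)).2 hd) ?_
  rw [elementaryIdeal_map]
  apply le_antisymm
  · refine (Ideal.map_mono hle).trans ?_
    rw [Ideal.map_span, Set.image_singleton]
  · rw [Ideal.span_singleton_le_iff_mem]
    have h1 := Ideal.mem_map_of_mem (algebraMap R S) hx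
    rw [map_mul] at h1
    exact (Ideal.mul_unit_mem_iff_mem _
      ((Localization.AtPrime.isUnit_algebraMap_span_iff p y).2 hy)).1 h1

/-- The order of a torsion module is determined by the lengths of the localizations at the prime
elements. -/
theorem iff_associated [IsDomain R] [IsNoetherianRing R] [UniqueFactorizationMonoid R]
    [Module.Finite R A] {a : R} (ha : a ≠ 0) (hA : ∀ x : A, a • x = 0) {D : R} (hD : D ≠ 0)
    (h : ∀ (p : R) [(Ideal.span {p}).IsPrime], p ≠ 0 →
      Module.length (Localization.AtPrime (Ideal.span {p}))
        (Localization.AtPrime (Ideal.span {p}) ⊗[R] A) =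
        Ring.ord (Localization.AtPrime (Ideal.span {p})) (algebraMap R _ D)) (d : R) :
    IsOrder A d ↔ Associated d D := by
  have key : ∀ d, IsOrder A d → Associated d D := fun d hd => by
    have hd0 := hd.ne_zero ha hA
    refine associated_of_dvd_dvd ?_ ?_
    · exact dvd_of_forall_ord_le hd0 hD fun p _ hp => by
        rw [← h p hp, hd.length_localization hd0 p]
    · exact dvd_of_forall_ord_le hD hd0 fun p _ hp => by
        rw [← h p hp, hd.length_localization hd0 p]
  refine ⟨key d, fun hd => ?_⟩
  obtain ⟨d', hd'⟩ := exists_isOrder (R := R) A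
  exact hd'.of_associated ((key d' hd').trans hd.symm)

end IsOrder

/-! ### Homology of matrix representations and its order -/

section Matrices

variable {F : Type*} [Field F] {k : ℕ} {A : Type*} [AddCommGroup A]

/-- The matrices of the twisted action. -/
noncomputable def twistedMatrix {G : Type*} [Group G] (α : G →* GL (Fin k) F)
    (ψ : G →* Multiplicative A) : G →* Matrix (Fin k) (Fin k) (AddMonoidAlgebra F A) where
  toFun g := AddMonoidAlgebra.single (Multiplicative.toAdd (ψ g)) (1 : F) •
    (α g).val.map (algebraMap F (AddMonoidAlgebra F A))
  map_one' := by
    simp only [map_one, Units.val_one, toAdd_one]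
    rw [Matrix.map_one _ (map_zero _) (map_one _), ← AddMonoidAlgebra.one_def, one_smul]
  map_mul' g h := by
    simp only [map_mul, Units.val_mul, toAdd_mul]
    rw [Matrix.map_mul, ← mul_one (1 : F), ← AddMonoidAlgebra.single_mul_single, mul_one, smul_mul_smul_comm]

theorem matrixRep_twistedMatrix {G : Type*} [Group G] (α : G →* GL (Fin k) F)
    (ψ : G →* Multiplicative A) : FoxModule.matrixRep (twistedMatrix α ψ) = twistedRep α ψ := by
  ext g : 1
  exact map_smul Matrix.toLin' _ _

/-- The order of the cokernel of a square matrix is its determinant. -/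
theorem IsOrder.quotient_range_mulVecLin {R : Type*} [CommRing R] (N : Matrix (Fin k) (Fin k) R) :
    IsOrder ((Fin k → R) ⧸ LinearMap.range N.mulVecLin) N.det := by
  refine ⟨k, k, N.transpose, Submodule.mkQ _, Submodule.mkQ_surjective _, ?_, ?_, fun e he => ?_⟩
  · rw [Matrix.vecMulLinear_transpose, Submodule.ker_mkQ]
  · rw [elementaryIdeal_square, Matrix.det_transpose]
  · rwa [elementaryIdeal_square, Matrix.det_transpose] at he

theorem det_smul_mem_range_mulVecLin {R : Type*} [CommRing R] (N : Matrix (Fin k) (Fin k) R)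
    (v : Fin k → R) : N.det • v ∈ LinearMap.range N.mulVecLin :=
  ⟨N.adjugate.mulVec v, by
    rw [Matrix.mulVecLin_apply, Matrix.mulVec_mulVec, Matrix.mul_adjugate, Matrix.smul_mulVec,
      Matrix.one_mulVec]⟩

theorem IsOrder.length_eq {R : Type*} [CommRing R] [IsDomain R] [IsPrincipalIdealRing R]
    {A : Type*} [AddCommGroup A] [Module R A] {d : R} (h : IsOrder A d) (hd : d ≠ 0) :
    Module.length R A = Ring.ord R d := by
  obtain ⟨r, s, P, hP, hE⟩ := h.exists_isPresentation
  exact hP.length_eq hd hE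

theorem IsOrder.finite {R : Type*} [CommRing R] {A : Type*} [AddCommGroup A] [Module R A] {d : R}
    (h : IsOrder A d) : Module.Finite R A := by
  obtain ⟨r, s, P, q, hq, -⟩ := h
  exact Module.Finite.of_surjective q hq

/-- The order of a quotient divides the order of the module. -/
theorem IsOrder.dvd_of_surjective {R : Type*} [CommRing R] [IsDomain R] [IsNoetherianRing R]
    [UniqueFactorizationMonoid R] {A B : Type*} [AddCommGroup A] [Module R A] [AddCommGroup B]
    [Module R B] {a b : R} (hA : IsOrder A a) (hB : IsOrder B b) (ha : a ≠ 0) (hb : b ≠ 0)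
    (g : A →ₗ[R] B) (hg : Function.Surjective g) : b ∣ a :=
  dvd_of_forall_ord_le hb ha fun p _ _ => by
    rw [← hB.length_localization hb p, ← hA.length_localization ha p]
    exact Module.length_le_of_surjective (g.baseChange _) (LinearMap.lTensor_surjective _ hg)

end Matrices

namespace FoxModule

open TensorProduct

section Comparison

variable {R S : Type*} [CommRing R] [CommRing S] [Algebra R S] {k : ℕ} {G P Q : Type*} [Group G]
  [Group P] [Group Q] {M : G →* Matrix (Fin k) (Fin k) S} {MK : Q →* Matrix (Fin k) (Fin k) R}
  {ι j : P →* G} {c : G} {κ : P ≃* Q}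

/-- If `j` and `ι` are conjugate by `c`, the action of `c⁻¹` intertwines the restriction of `M`
along `j` with the base change of the representation `MK`. -/
theorem matrixRep_conj (hj : ∀ g, j g = c * ι g * c⁻¹)
    (hM : ∀ g, M (ι g) = (MK (κ g)).map (algebraMap R S)) (g : P) (v : Fin k → S) :
    matrixRep M c⁻¹ ((matrixRep M).comp j g v) =
      matrixRep (matrixBaseChange S MK) (κ g) (matrixRep M c⁻¹ v) := by
  have e : matrixRep (matrixBaseChange S MK) (κ g) = matrixRep M (ι g) := by
    refine LinearMap.ext fun v => ?_
    rw [matrixRep_apply, matrixRep_apply, hM]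
    rfl
  rw [e, MonoidHom.comp_apply, hj, ← Module.End.mul_apply, ← Module.End.mul_apply, ← map_mul,
    ← map_mul]
  group

/-- The automorphism of a representation space given by an element of the group. -/
noncomputable def actionEquiv {V : Type*} [AddCommGroup V] [Module S V] (ρ : G →* Module.End S V)
    (c : G) : V ≃ₗ[S] V :=
  LinearEquiv.ofLinearMap (ρ c) (ρ c⁻¹)
    (by change ρ c * ρ c⁻¹ = 1; rw [← map_mul, mul_inv_cancel, map_one])
    (by change ρ c⁻¹ * ρ c = 1; rw [← map_mul, inv_mul_cancel, map_one])

theorem nonempty_H1_comp_equiv [Module.Flat R S] (hj : ∀ g, j g = c * ι g * c⁻¹)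
    (hM : ∀ g, M (ι g) = (MK (κ g)).map (algebraMap R S)) :
    Nonempty (S ⊗[R] H1 (matrixRep MK) ≃ₗ[S] H1 ((matrixRep M).comp j)) := by
  obtain ⟨e⟩ := nonempty_H1_matrix_baseChange (S := S) MK
  obtain ⟨e'⟩ := nonempty_H1_equiv κ (actionEquiv (matrixRep M) c⁻¹) (matrixRep_conj hj hM)
  exact ⟨e.trans e'.symm⟩

theorem nonempty_H0_comp_equiv (hj : ∀ g, j g = c * ι g * c⁻¹)
    (hM : ∀ g, M (ι g) = (MK (κ g)).map (algebraMap R S)) :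
    Nonempty (S ⊗[R] H0 (matrixRep MK) ≃ₗ[S] H0 ((matrixRep M).comp j)) := by
  obtain ⟨e⟩ := nonempty_H0_matrix_baseChange (S := S) MK
  obtain ⟨e'⟩ := nonempty_H0_equiv κ (actionEquiv (matrixRep M) c⁻¹) (matrixRep_conj hj hM)
  exact ⟨e.trans e'.symm⟩

theorem matrixRep_sub_one (g : G) : matrixRep M g - 1 = (M g - 1).mulVecLin := by
  refine LinearMap.ext fun v => ?_
  rw [Matrix.mulVecLin_apply, Matrix.sub_mulVec, Matrix.one_mulVec]
  rfl

theorem det_conj_sub_one (hj : ∀ g, j g = c * ι g * c⁻¹)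
    (hM : ∀ g, M (ι g) = (MK (κ g)).map (algebraMap R S)) (g : P) :
    (M (j g) - 1).det = algebraMap R S (MK (κ g) - 1).det := by
  have e : M (j g) - 1 = M c * (M (ι g) - 1) * M c⁻¹ := by
    rw [hj, map_mul, map_mul, mul_sub, sub_mul, mul_one, ← map_mul M c c⁻¹, mul_inv_cancel, map_one]
  rw [e, Matrix.det_mul, mul_comm, Matrix.det_mul, ← mul_assoc, ← Matrix.det_mul, ← map_mul,
    inv_mul_cancel, map_one, Matrix.det_one, one_mul, hM, RingHom.map_det]
  congr 1
  rw [RingHom.mapMatrix_apply, Matrix.map_sub _ (map_sub _), Matrix.map_one _ (map_zero _) (map_one _)]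

end Comparison

/-- A domain that contains a principal ideal domain is torsion-free over it, hence flat. -/
theorem flat_of_algebraMap_injective {R S : Type*} [CommRing R] [IsDomain R]
    [IsPrincipalIdealRing R] [CommRing S] [IsDomain S] [Algebra R S]
    (h : Function.Injective (algebraMap R S)) : Module.Flat R S := by
  rw [Module.Flat.flat_iff_torsion_eq_bot_of_isBezout, ← Submodule.isTorsionFree_iff_torsion_eq_bot]
  have := (faithfulSMul_iff_algebraMap_injective R S).2 h
  infer_instance

end FoxModule

/-! ### The order of the first homology of a commuting pushout -/

open TensorProduct FoxModule in
/-- The order of the first homology of a commuting pushout, when the orders of the parts are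
known over smaller principal ideal domains. -/
theorem IsCommutingPushout.ord_formula.{u} {R : Type*} {S : Type u} [CommRing R]
    [IsDomain R] [IsPrincipalIdealRing R] [CommRing S] [IsDomain S] [IsPrincipalIdealRing S]
    {k : ℕ} {G : Type} {P : Fin 2 → Type} {Q : Fin 2 → Type} [Group G] [∀ i, Group (P i)]
    [∀ i, Group (Q i)]
    {M : G →* Matrix (Fin k) (Fin k) S} {MK : ∀ i, Q i →* Matrix (Fin k) (Fin k) R}
    {ι j : ∀ i, P i →* G} {c : Fin 2 → G} {κ : ∀ i, P i ≃* Q i} {m : ∀ i, P i}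
    (hpush : IsCommutingPushout.{u} (j 0) (j 1) (m 0) (m 1))
    (hj : ∀ i g, j i g = c i * ι i g * (c i)⁻¹) (f : Fin 2 → R →+* S)
    (hf : ∀ i, Function.Injective (f i))
    (hM : ∀ i g, M (ι i g) = (MK i (κ i g)).map (f i)) {d₁ d₀ : Fin 2 → R}
    (h1 : ∀ i, IsOrder (H1 (matrixRep (MK i))) (d₁ i))
    (h0 : ∀ i, IsOrder (H0 (matrixRep (MK i))) (d₀ i)) (hd₁ : ∀ i, d₁ i ≠ 0) (hd₀ : ∀ i, d₀ i ≠ 0)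
    (hdet : ∀ i, (MK i (κ i (m i)) - 1).det ≠ 0)
    (hu : IsUnit (f 0 (MK 0 (κ 0 (m 0)) - 1).det) ∨ IsUnit (f 1 (MK 1 (κ 1 (m 1)) - 1).det)) :
    Module.length S (H1 (matrixRep M)) + (Ring.ord S (f 0 (d₀ 0)) + Ring.ord S (f 1 (d₀ 1))) =
      (Ring.ord S (f 0 (d₁ 0)) + Ring.ord S (f 0 (MK 0 (κ 0 (m 0)) - 1).det)) +
      (Ring.ord S (f 1 (d₁ 1)) + Ring.ord S (f 1 (MK 1 (κ 1 (m 1)) - 1).det)) := by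
  have hne : ∀ i (x : R), x ≠ 0 → f i x ≠ 0 := fun i x hx => (map_ne_zero_iff _ (hf i)).2 hx
  have hdet' : ∀ i, (M (j i (m i)) - 1).det = f i (MK i (κ i (m i)) - 1).det := fun i => by
    let _ : Algebra R S := (f i).toAlgebra
    exact det_conj_sub_one (hj i) (hM i) (m i)
  have e1 : ∀ i, Module.length S (H1 ((matrixRep M).comp (j i))) = Ring.ord S (f i (d₁ i)) := by
    intro i
    let _ : Algebra R S := (f i).toAlgebra
    have : Module.Flat R S := flat_of_algebraMap_injective (hf i)
    obtain ⟨e⟩ := nonempty_H1_comp_equiv (hj i) (hM i)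
    rw [← e.length_eq]
    exact (h1 i).length_baseChange S (hne i _ (hd₁ i))
  have e0 : ∀ i, Module.length S (H0 ((matrixRep M).comp (j i))) = Ring.ord S (f i (d₀ i)) := by
    intro i
    let _ : Algebra R S := (f i).toAlgebra
    obtain ⟨e⟩ := nonempty_H0_comp_equiv (hj i) (hM i)
    rw [← e.length_eq]
    exact (h0 i).length_baseChange S (hne i _ (hd₀ i))
  have ed : ∀ i, Module.length S ((Fin k → S) ⧸ LinearMap.range (matrixRep M (j i (m i)) - 1)) =
      Ring.ord S (f i (MK i (κ i (m i)) - 1).det) := by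
    intro i
    rw [← hdet', matrixRep_sub_one]
    exact (IsOrder.quotient_range_mulVecLin _).length_eq (by rw [hdet']; exact hne i _ (hdet i))
  have hinj : ∀ i, Function.Injective ⇑(matrixRep M (j i (m i)) - 1) := by
    intro i
    rw [matrixRep_sub_one]
    exact Matrix.mulVec_injective_of_det_ne_zero (by rw [hdet']; exact hne i _ (hdet i))
  have hsurj : ∀ i, IsUnit (f i (MK i (κ i (m i)) - 1).det) →
      Function.Surjective ⇑(matrixRep M (j i (m i)) - 1) := by
    intro i hi
    rw [matrixRep_sub_one]
    refine Matrix.mulVec_surjective_iff_isUnit.2 ?_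
    rwa [Matrix.isUnit_iff_isUnit_det, hdet']
  have := hpush.length_H1 (ρ := matrixRep M) (hinj 0) (hinj 1) (hu.imp (hsurj 0) (hsurj 1))
  rwa [e0, e0, e1, e1, ed, ed] at this

section TwistedAlexanderPolynomials

open FoxModule TensorProduct

universe u

variable {F : Type u} [Field F] {k : ℕ}

theorem twistedMatrix_apply {A : Type*} [AddCommGroup A] {G : Type*} [Group G]
    (α : G →* GL (Fin k) F) (ψ : G →* Multiplicative A) (g : G) :
    twistedMatrix α ψ g = AddMonoidAlgebra.single (Multiplicative.toAdd (ψ g)) (1 : F) •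
      (α g).val.map (algebraMap F (AddMonoidAlgebra F A)) := rfl

theorem twistedMatrix_eq_map {G Q : Type*} [Group G] [Group Q] {α : G →* GL (Fin k) F}
    {ψ : G →* Multiplicative (Fin 2 → ℤ)} {αK : Q →* GL (Fin k) F} {ψK : Q →* Multiplicative ℤ}
    {i : Fin 2} {g : G} {q : Q} (hα : αK q = α g)
    (hψ : ψ g = Multiplicative.ofAdd (Pi.single i (Multiplicative.toAdd (ψK q)))) :
    twistedMatrix α ψ g = (twistedMatrix αK ψK q).map (inVariable F i) := by
  rw [twistedMatrix_apply, twistedMatrix_apply, hψ, hα]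
  ext a b : 1
  simp only [Matrix.smul_apply, Matrix.map_apply, smul_eq_mul, map_mul, inVariable_single,
    toAdd_ofAdd]
  congr 1
  exact ((inVariable_single F i 0 _).trans (by rw [Pi.single_zero]; rfl)).symm

theorem det_twistedMatrix_sub_one {G : Type*} [Group G] (α : G →* GL (Fin k) F)
    (ψ : G →* Multiplicative ℤ) {m : G} (hm : ψ m = Multiplicative.ofAdd 1) :
    (twistedMatrix α ψ m - 1).det = detPolynomial (α m) := by
  rw [detPolynomial]
  rw [twistedMatrix_apply, hm]
  rfl

/-- The order of the coinvariants divides `det (α (m) x - 1)`. -/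
theorem IsOrder.H0_ne_zero_and_dvd {G : Type*} [Group G] {α : G →* GL (Fin k) F}
    {ψ : G →* Multiplicative ℤ} {m : G} (hm : ψ m = Multiplicative.ofAdd 1)
    {d : LaurentPolynomial F} (h : IsOrder (H0 (twistedRep α ψ)) d) :
    d ≠ 0 ∧ d ∣ detPolynomial (α m) := by
  have hdet := detPolynomial_ne_zero (α m)
  rw [← det_twistedMatrix_sub_one α ψ hm] at hdet ⊢
  rw [← matrixRep_twistedMatrix] at h
  have hle : LinearMap.range (twistedMatrix α ψ m - 1).mulVecLin ≤
      LinearMap.range (boundary (matrixRep (twistedMatrix α ψ))) := by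
    rw [← matrixRep_sub_one]
    rintro _ ⟨v, rfl⟩
    exact ⟨of _ m v, boundary_of _ _ _⟩
  have hd : d ≠ 0 := h.ne_zero hdet fun x => by
    induction x using Submodule.Quotient.induction_on with | _ v =>
    rw [← Submodule.Quotient.mk_smul, Submodule.Quotient.mk_eq_zero]
    exact hle (det_smul_mem_range_mulVecLin _ _)
  exact ⟨hd, (IsOrder.quotient_range_mulVecLin _).dvd_of_surjective h hdet hd
    (Submodule.factor hle) (Submodule.factor_surjective hle)⟩

/-- Finite generation and torsion of the homology pass to a base change. -/
theorem finite_H1_comp {R S : Type*} [CommRing R] [IsDomain R] [IsPrincipalIdealRing R] [CommRing S]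
    [IsDomain S] {G P Q : Type*} [Group G] [Group P] [Group Q]
    {M : G →* Matrix (Fin k) (Fin k) S} {MK : Q →* Matrix (Fin k) (Fin k) R} {ι j : P →* G} {c : G}
    {κ : P ≃* Q} (hj : ∀ g, j g = c * ι g * c⁻¹) {f : R →+* S} (hf : Function.Injective f)
    (hM : ∀ g, M (ι g) = (MK (κ g)).map f) {d : R} (h : IsOrder (H1 (matrixRep MK)) d) :
    Module.Finite S (H1 ((matrixRep M).comp j)) ∧
      ∀ x : H1 ((matrixRep M).comp j), f d • x = 0 := by
  let _ : Algebra R S := f.toAlgebra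
  have : Module.Flat R S := flat_of_algebraMap_injective hf
  have := h.finite
  obtain ⟨e⟩ := nonempty_H1_comp_equiv hj hM
  refine ⟨Module.Finite.equiv e, fun x => ?_⟩
  obtain ⟨y, rfl⟩ := e.surjective x
  rw [← map_smul]
  suffices h : f d • y = 0 by rw [h, map_zero]
  induction y using TensorProduct.induction_on with
  | zero => simp
  | add x y hx hy => rw [smul_add, hx, hy, add_zero]
  | tmul s v =>
    have hs : f d • s = d • s := rfl
    rw [TensorProduct.smul_tmul', hs, TensorProduct.smul_tmul, h.smul_eq_zero,
      TensorProduct.tmul_zero]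

theorem smul_mem_range_matrixRep_sub_one {R S : Type*} [CommRing R] [CommRing S] {G P Q : Type*}
    [Group G] [Group P] [Group Q]
    {M : G →* Matrix (Fin k) (Fin k) S} {MK : Q →* Matrix (Fin k) (Fin k) R} {ι j : P →* G} {c : G}
    {κ : P ≃* Q} (hj : ∀ g, j g = c * ι g * c⁻¹) {f : R →+* S}
    (hM : ∀ g, M (ι g) = (MK (κ g)).map f) (m : P) (v : Fin k → S) :
    f (MK (κ m) - 1).det • v ∈ LinearMap.range (matrixRep M (j m) - 1) := by
  let _ : Algebra R S := f.toAlgebra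
  have e : (M (j m) - 1).det = f (MK (κ m) - 1).det := det_conj_sub_one hj hM m
  rw [matrixRep_sub_one, ← e]
  exact det_smul_mem_range_mulVecLin _ v

variable {G : Type} {P : Fin 2 → Type} {Q : Fin 2 → Type} [Group G] [∀ i, Group (P i)]
  [∀ i, Group (Q i)]

/-- The order of the first homology of a commuting pushout. The homologies of the two parts and
their meridians are defined over principal ideal domains contained in `Λ`, such that no prime
divides the determinants of both meridians. -/
theorem IsCommutingPushout.isOrder_H1_iff_of_coprime {R : Type*} {Λ : Type u} [CommRing R]
    [IsDomain R] [IsPrincipalIdealRing R] [CommRing Λ] [IsDomain Λ] [IsNoetherianRing Λ]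
    [UniqueFactorizationMonoid Λ] {M : G →* Matrix (Fin k) (Fin k) Λ}
    {MK : ∀ i, Q i →* Matrix (Fin k) (Fin k) R}
    {ι j : ∀ i, P i →* G} {c : Fin 2 → G} {κ : ∀ i, P i ≃* Q i} {m : ∀ i, P i}
    (hpush : IsCommutingPushout.{u} (j 0) (j 1) (m 0) (m 1))
    (hj : ∀ i g, j i g = c i * ι i g * (c i)⁻¹) {f : Fin 2 → R →+* Λ}
    (hf : ∀ i, Function.Injective (f i))
    (hM : ∀ i g, M (ι i g) = (MK i (κ i g)).map (f i)) {d₁ d₀ Δ : Fin 2 → R}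
    (h1 : ∀ i, IsOrder (H1 (matrixRep (MK i))) (d₁ i))
    (h0 : ∀ i, IsOrder (H0 (matrixRep (MK i))) (d₀ i)) (hd₁ : ∀ i, d₁ i ≠ 0) (hd₀ : ∀ i, d₀ i ≠ 0)
    (hdet : ∀ i, (MK i (κ i (m i)) - 1).det ≠ 0)
    (hcop : ∀ p, p ∣ f 0 (MK 0 (κ 0 (m 0)) - 1).det → p ∣ f 1 (MK 1 (κ 1 (m 1)) - 1).det → IsUnit p)
    (hΔ : ∀ i, Δ i * d₀ i = d₁ i * (MK i (κ i (m i)) - 1).det) (d : Λ) :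
    IsOrder (H1 (matrixRep M)) d ↔ Associated d (f 0 (Δ 0) * f 1 (Δ 1)) := by
  have hΔ0 : ∀ i, Δ i ≠ 0 := fun i h => by
    have := hΔ i
    rw [h, zero_mul] at this
    exact mul_ne_zero (hd₁ i) (hdet i) this.symm
  have hin : ∀ i (x : R), x ≠ 0 → f i x ≠ 0 := fun i x hx => (map_ne_zero_iff _ (hf i)).2 hx
  have hfin := fun i => finite_H1_comp (hj i) (hf i) (hM i) (h1 i)
  have hrange := fun i v => smul_mem_range_matrixRep_sub_one (hj i) (hM i) (m i) v
  have := (hfin 0).1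
  have := (hfin 1).1
  have := hpush.finite_H1 (ρ := matrixRep M)
  -- the product of the orders and determinants of both parts annihilates the module
  refine IsOrder.iff_associated
    (mul_ne_zero (mul_ne_zero (hin 0 _ (hd₁ 0)) (hin 1 _ (hd₁ 1)))
      (mul_ne_zero (hin 0 _ (hdet 0)) (hin 1 _ (hdet 1))))
    (hpush.smul_H1_eq_zero (hfin 0).2 (hfin 1).2 (hrange 0) (hrange 1))
    (mul_ne_zero (hin 0 _ (hΔ0 0)) (hin 1 _ (hΔ0 1))) (fun p hp _ => ?_) d
  let S := Localization.AtPrime (Ideal.span {p})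
  have := Localization.AtPrime.isPrincipalIdealRing_of_span p
  have : IsDomain S := IsLocalization.isDomain_localization
    (Ideal.primeCompl_le_nonZeroDivisors _)
  let f' : Fin 2 → R →+* S := fun i => (algebraMap _ S).comp (f i)
  have hf' : ∀ i, Function.Injective (f' i) := fun i =>
    (Localization.AtPrime.algebraMap_injective _).comp (hf i)
  have hne : ∀ i (x : R), x ≠ 0 → f' i x ∈ nonZeroDivisors S := fun i x hx =>
    mem_nonZeroDivisors_of_ne_zero ((map_ne_zero_iff _ (hf' i)).2 hx)
  obtain ⟨e⟩ := nonempty_H1_matrix_baseChange (S := S) M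
  -- `p` divides at most one of the determinants, so that the other is a unit of the localization
  have key := hpush.ord_formula (M := matrixBaseChange S M) hj f' hf'
    (fun i g => by
      change (M (ι i g)).map (algebraMap _ S) = _
      rw [hM, Matrix.map_map]
      rfl) h1 h0 hd₁ hd₀ hdet (by
      by_contra hcon
      simp only [f', RingHom.comp_apply, S, Localization.AtPrime.isUnit_algebraMap_span_iff, not_or,
        not_not] at hcon
      exact hp.ne_top (Ideal.span_singleton_eq_top.2 (hcop p hcon.1 hcon.2)))
  rw [e.length_eq]
  have h2 : ∀ i, Ring.ord S (f' i (d₁ i)) +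
      Ring.ord S (f' i (MK i (κ i (m i)) - 1).det) =
      Ring.ord S (f' i (Δ i)) + Ring.ord S (f' i (d₀ i)) := fun i => by
    rw [← Ring.ord_mul _ (hne i _ (hdet i)), ← Ring.ord_mul _ (hne i _ (hd₀ i)), ← map_mul,
      ← map_mul, hΔ]
  rw [h2, h2, add_add_add_comm] at key
  -- the orders of vanishing are finite, so that those of `d₀` can be cancelled in `ℕ∞`
  have h3 : Ring.ord S (f' 0 (d₀ 0)) + Ring.ord S (f' 1 (d₀ 1)) ≠ ⊤ :=
    WithTop.add_ne_top.2 ⟨Ring.ord_ne_top (hne 0 _ (hd₀ 0)), Ring.ord_ne_top (hne 1 _ (hd₀ 1))⟩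
  rw [ENat.add_left_injective_of_ne_top h3 key, map_mul]
  exact (Ring.ord_mul _ (hne 1 _ (hΔ0 1))).symm

/-- The algebraic form of the formula for the twisted Alexander polynomial of a Hopf-like link. -/
theorem IsCommutingPushout.isOrder_H1_iff {ι j : ∀ i, P i →* G} {c : Fin 2 → G}
    {κ : ∀ i, P i ≃* Q i} {m : ∀ i, P i}
    (hpush : IsCommutingPushout.{u} (j 0) (j 1) (m 0) (m 1))
    (hj : ∀ i g, j i g = c i * ι i g * (c i)⁻¹)
    {α : G →* GL (Fin k) F} {ψ : G →* Multiplicative (Fin 2 → ℤ)}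
    {αK : ∀ i, Q i →* GL (Fin k) F} {ψK : ∀ i, Q i →* Multiplicative ℤ}
    (hα : ∀ i g, αK i (κ i g) = α (ι i g))
    (hψ : ∀ i g, ψ (ι i g) = Multiplicative.ofAdd (Pi.single i (Multiplicative.toAdd (ψK i (κ i g)))))
    (hm : ∀ i, ψK i (κ i (m i)) = Multiplicative.ofAdd 1)
    {d₁ d₀ Δ : Fin 2 → LaurentPolynomial F}
    (h1 : ∀ i, IsOrder (H1 (twistedRep (αK i) (ψK i))) (d₁ i))
    (h0 : ∀ i, IsOrder (H0 (twistedRep (αK i) (ψK i))) (d₀ i)) (hd₁ : ∀ i, d₁ i ≠ 0)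
    (hΔ : ∀ i, Δ i * d₀ i = d₁ i * detPolynomial (αK i (κ i (m i))))
    (d : AddMonoidAlgebra F (Fin 2 → ℤ)) :
    IsOrder (H1 (twistedRep α ψ)) d ↔ Associated d (inVariable F 0 (Δ 0) * inVariable F 1 (Δ 1)) := by
  have hd₀ : ∀ i, d₀ i ≠ 0 := fun i => ((h0 i).H0_ne_zero_and_dvd (hm i)).1
  have hdetp : ∀ i, (twistedMatrix (αK i) (ψK i) (κ i (m i)) - 1).det =
      detPolynomial (αK i (κ i (m i))) := fun i => det_twistedMatrix_sub_one _ _ (hm i)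
  have hdet : ∀ i, (twistedMatrix (αK i) (ψK i) (κ i (m i)) - 1).det ≠ 0 := fun i => by
    rw [hdetp]; exact detPolynomial_ne_zero _
  replace h1 : ∀ i, IsOrder (H1 (matrixRep (twistedMatrix (αK i) (ψK i)))) (d₁ i) := fun i => by
    rw [matrixRep_twistedMatrix]; exact h1 i
  replace h0 : ∀ i, IsOrder (H0 (matrixRep (twistedMatrix (αK i) (ψK i)))) (d₀ i) := fun i => by
    rw [matrixRep_twistedMatrix]; exact h0 i
  rw [← matrixRep_twistedMatrix]
  exact hpush.isOrder_H1_iff_of_coprime hj inVariable_injective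
    (fun i g => twistedMatrix_eq_map (hα i g) (hψ i g)) h1 h0 hd₁ hd₀ hdet
    (fun p h h' => isUnit_of_dvd_inVariable (hdet 0) (hdet 1) h h') (fun i => by rw [hΔ, hdetp]) d

end TwistedAlexanderPolynomials

/-! ### Path cocycles and fundamental groups -/

namespace Path.Homotopic.Quotient

variable {X : Type*} [TopologicalSpace X] {x y z : X}

theorem trans_symm_trans (a : Path.Homotopic.Quotient x y) (b : Path.Homotopic.Quotient x z) :
    a.trans (a.symm.trans b) = b := by
  rw [← trans_assoc, trans_symm, refl_trans]

theorem symm_trans_trans (a : Path.Homotopic.Quotient x y) (b : Path.Homotopic.Quotient y z) :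
    a.symm.trans (a.trans b) = b := by
  rw [← trans_assoc, symm_trans, refl_trans]

theorem symm_trans_rev (a : Path.Homotopic.Quotient x y) (b : Path.Homotopic.Quotient y z) :
    (a.trans b).symm = b.symm.trans a.symm := by
  induction a using Path.Homotopic.Quotient.ind
  induction b using Path.Homotopic.Quotient.ind
  rw [← mk_trans, ← mk_symm, Path.trans_symm, mk_trans, mk_symm, mk_symm]

theorem symm_symm (a : Path.Homotopic.Quotient x y) : a.symm.symm = a := by
  induction a using Path.Homotopic.Quotient.ind
  rw [← mk_symm, ← mk_symm, Path.symm_symm]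

end Path.Homotopic.Quotient

namespace FundamentalGroup

variable {X : Type*} [TopologicalSpace X]

theorem fundamentalGroupMulEquivOfPath_apply {x y : X} (p : Path x y) (g : FundamentalGroup X x) :
    fundamentalGroupMulEquivOfPath p g =
      fromPath (((Path.Homotopic.Quotient.mk p).symm.trans (toPath g)).trans
        (Path.Homotopic.Quotient.mk p)) :=
  (Path.Homotopic.Quotient.trans_assoc (Path.Homotopic.Quotient.mk p).symm (toPath g)
    (Path.Homotopic.Quotient.mk p)).symm

theorem fundamentalGroupMulEquivOfPath_trans {x y z : X} (p : Path x y) (q : Path y z)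
    (g : FundamentalGroup X x) :
    fundamentalGroupMulEquivOfPath (p.trans q) g =
      fundamentalGroupMulEquivOfPath q (fundamentalGroupMulEquivOfPath p g) := by
  simp only [fundamentalGroupMulEquivOfPath_apply, Path.Homotopic.Quotient.mk_trans,
    Path.Homotopic.Quotient.symm_trans_rev, Path.Homotopic.Quotient.trans_assoc]

theorem fundamentalGroupMulEquivOfPath_conj {x y : X} (p q : Path x y)
    (g : FundamentalGroup X x) :
    fundamentalGroupMulEquivOfPath p g =
      fromPath (.mk (q.symm.trans p)) * fundamentalGroupMulEquivOfPath q g *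
        (fromPath (.mk (q.symm.trans p)))⁻¹ := by
  rw [mul_def, mul_def, inv_def]
  simp only [fundamentalGroupMulEquivOfPath_apply, Path.Homotopic.Quotient.mk_trans,
    Path.Homotopic.Quotient.symm_trans_rev, Path.Homotopic.Quotient.trans_assoc,
    Path.Homotopic.Quotient.mk_symm, Path.Homotopic.Quotient.symm_symm,
    Path.Homotopic.Quotient.trans_symm_trans]

end FundamentalGroup

namespace PathCocycle

variable {X Y H K : Type*} [TopologicalSpace X] [TopologicalSpace Y] [Group H] [Group K]

/-- A path cocycle with its values replaced by their images under a homomorphism. -/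
def mapHom (φ : PathCocycle X H) (f : H →* K) : PathCocycle X K where
  toFun p := f (φ.toFun p)
  map_trans p q := by rw [φ.map_trans, map_mul]
  map_homotopic h := by rw [φ.map_homotopic h]

/-- The gauge transformation of a path cocycle by a function on the space. -/
def gauge (φ : PathCocycle X H) (u : X → H) : PathCocycle X H where
  toFun {x y} p := u y * φ.toFun p * (u x)⁻¹
  map_trans p q := by rw [φ.map_trans]; group
  map_homotopic h := by rw [φ.map_homotopic h]

/-- The homomorphism on the fundamental group that is defined by a path cocycle. -/
def toHom (φ : PathCocycle X H) (x : X) : FundamentalGroup X x →* H where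
  toFun g := Quotient.lift (fun p : Path x x => φ.toFun p) (fun _ _ h => φ.map_homotopic h)
    (FundamentalGroup.toPath g)
  map_one' := φ.map_refl x
  map_mul' g h := by
    induction g using Quotient.ind
    induction h using Quotient.ind
    exact φ.map_trans _ _

theorem toHom_fromPath (φ : PathCocycle X H) {x : X} (p : Path x x) :
    φ.toHom x (FundamentalGroup.fromPath (.mk p)) = φ.toFun p := rfl

theorem toHom_map (φ : PathCocycle X H) (f : C(Y, X)) (y : Y) (g : FundamentalGroup Y y) :
    φ.toHom (f y) (FundamentalGroup.map f y g) = (φ.comap f).toHom y g := by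
  induction g using Quotient.ind
  rfl

theorem toHom_mapHom (φ : PathCocycle X H) (f : H →* K) (x : X) :
    (φ.mapHom f).toHom x = f.comp (φ.toHom x) := by
  ext g
  induction g using Quotient.ind
  rfl

theorem toHom_fundamentalGroupMulEquivOfPath (φ : PathCocycle X H) {x y : X} (p : Path x y)
    (g : FundamentalGroup X x) :
    φ.toHom y (FundamentalGroup.fundamentalGroupMulEquivOfPath p g) =
      φ.toFun p * φ.toHom x g * (φ.toFun p)⁻¹ := by
  rw [FundamentalGroup.fundamentalGroupMulEquivOfPath_apply]
  induction g using Quotient.ind with | _ a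
  change φ.toFun ((p.symm.trans a).trans p) = _ * φ.toFun a * _
  rw [φ.map_trans, φ.map_trans, φ.map_symm, mul_assoc]

section Tautological

open Classical in
/-- The path cocycle with values in the fundamental group at `o` that sends a path to the loop
which it forms with chosen paths from `o` to its end points; it is trivial outside the path
component of `o`. The chosen path from `o` to `o` is null-homotopic. -/
noncomputable def tautological (o : X) : PathCocycle X (FundamentalGroup X o) where
  toFun {x y} p := if h : Joined o x then
      .mk (((((Joined.refl o).somePath.symm.trans h.somePath).trans p).trans
        (h.trans ⟨p⟩).somePath.symm).trans (Joined.refl o).somePath) else 1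
  map_trans {x y z} p q := by
    by_cases h : Joined o x
    · have h' : Joined o y := h.trans ⟨p⟩
      rw [dif_pos h, dif_pos h, dif_pos h']
      rw [FundamentalGroup.mul_def]
      simp only [Path.Homotopic.Quotient.mk_trans, Path.Homotopic.Quotient.mk_symm]
      simp only [Path.Homotopic.Quotient.trans_assoc, Path.Homotopic.Quotient.trans_symm_trans,
        Path.Homotopic.Quotient.symm_trans_trans]
    · have h' : ¬ Joined o y := fun h' => h (h'.trans ⟨p.symm⟩)
      rw [dif_neg h, dif_neg h, dif_neg h', one_mul]
  map_homotopic {x y p q} hpq := by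
    by_cases h : Joined o x
    · rw [dif_pos h, dif_pos h]
      simp only [Path.Homotopic.Quotient.mk_trans, Path.Homotopic.Quotient.mk_symm,
        Path.Homotopic.Quotient.eq.2 hpq]
    · rw [dif_neg h, dif_neg h]

theorem tautological_loop {o : X} (p : Path o o) :
    (tautological o).toFun p = FundamentalGroup.fromPath (.mk p) := by
  refine (dif_pos (Joined.refl o)).trans ?_
  simp only [Path.Homotopic.Quotient.mk_trans, Path.Homotopic.Quotient.mk_symm,
    Path.Homotopic.Quotient.trans_assoc, Path.Homotopic.Quotient.symm_trans,
    Path.Homotopic.Quotient.trans_refl, Path.Homotopic.Quotient.refl_trans]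

theorem toHom_tautological (o : X) : (tautological o).toHom o = MonoidHom.id _ := by
  ext g
  induction g using Quotient.ind
  exact tautological_loop _

end Tautological

/-- Transport along a path: sets `E x` of values that are preserved under the action of the short
paths of an open cover are preserved under the action of all paths. -/
theorem transport_mem {ι : Type*} {U : ι → Set X} (hU : ∀ a, IsOpen (U a))
    (hcov : ∀ x, ∃ a, x ∈ U a) (Φ : PathCocycle X H) (E : X → Set H)
    (hE : ∀ a (x y : U a) (p : Path x y), ∀ e ∈ E x,
      Φ.toFun (p.map continuous_subtype_val) * e ∈ E y) {x y : X} (p : Path x y) {e : H}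
    (he : e ∈ E x) : Φ.toFun p * e ∈ E y := by
  obtain ⟨f, hf, hp⟩ := Φ.isPrimitive_of_agree
    (φ := fun a => Φ.comap ⟨(Subtype.val : U a → X), continuous_subtype_val⟩) (fun _ _ _ _ => rfl) p
  have : PreconnectedSpace (Set.Icc (0 : ℝ) 1) :=
    Subtype.preconnectedSpace (convex_Icc (0 : ℝ) 1).isPreconnected
  have hloc : IsLocallyConstant fun s : Set.Icc (0 : ℝ) 1 => {m : H | f s * m ∈ E (p.line s)} := by
    rw [IsLocallyConstant.iff_eventually_eq]
    intro s
    obtain ⟨a, ha⟩ := hcov (p.line s)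
    obtain ⟨ε, hε, hb⟩ := Metric.mem_nhds_iff.1
      (((hU a).preimage p.line.continuous).mem_nhds (show (s : ℝ) ∈ p.line ⁻¹' U a from ha))
    have hball : ∀ᶠ t : Set.Icc (0 : ℝ) 1 in nhds s, (t : ℝ) ∈ Metric.ball (s : ℝ) ε :=
      continuous_subtype_val.continuousAt.eventually (Metric.ball_mem_nhds _ hε)
    filter_upwards [hball] with t ht
    have hK : Convex ℝ (Metric.ball (s : ℝ) ε ∩ Set.Icc 0 1) :=
      (convex_ball _ _).inter (convex_Icc _ _)
    have hm : Set.MapsTo p.line (Metric.ball (s : ℝ) ε ∩ Set.Icc 0 1) (U a) := fun k hk => hb hk.1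
    have key : ∀ (s' t' : ↥(Metric.ball (s : ℝ) ε ∩ Set.Icc 0 1)),
        ∀ m : H, f s' * m ∈ E (p.line s') → f t' * m ∈ E (p.line t') := by
      intro s' t' m hm'
      obtain ⟨q⟩ := hK.nonempty_path s' t'
      have e1 := hf a _ hK Set.inter_subset_right hm s' t' q
      rw [← e1, mul_assoc]
      exact hE a _ _ (q.map (p.line.restrictMapsTo hm).continuous) _ hm'
    exact Set.Subset.antisymm
      (key ⟨t, ht, t.2⟩ ⟨s, Metric.mem_ball_self hε, s.2⟩)
      (key ⟨s, Metric.mem_ball_self hε, s.2⟩ ⟨t, ht, t.2⟩)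
  have h01 := hloc.apply_eq_of_preconnectedSpace ⟨0, by simp⟩ ⟨1, by simp⟩
  have hx : p.line 0 = x := p.extend_zero
  have hy : p.line 1 = y := p.extend_one
  have h0 : (f 0)⁻¹ * e ∈ {m : H | f 0 * m ∈ E (p.line 0)} := by
    rw [Set.mem_ofPred_eq, mul_inv_cancel_left, hx]
    exact he
  have h1 : (f 0)⁻¹ * e ∈ {m : H | f 1 * m ∈ E (p.line 1)} := h01 ▸ h0
  rw [Set.mem_ofPred_eq, hy] at h1
  rw [hp, mul_assoc]
  exact h1

end PathCocycle

/-! ### Van Kampen theorem for balls glued to a set -/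

section Cover

variable {X : Type*} [TopologicalSpace X]

/-- The restriction of a path cocycle to a subset. -/
def PathCocycle.restrict {H : Type*} [Group H] (Φ : PathCocycle X H) (U : Set X) :
    PathCocycle U H :=
  Φ.comap ⟨Subtype.val, continuous_subtype_val⟩

/-- A path in a subset as a path in a larger subset. -/
def Path.toSuperset {U O : Set X} (h : O ⊆ U) {x y : X} {hx : x ∈ O} {hy : y ∈ O}
    (p : Path (⟨x, hx⟩ : O) ⟨y, hy⟩) : Path (⟨x, h hx⟩ : U) ⟨y, h hy⟩ :=
  p.map (ContinuousMap.inclusion h).continuous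

/-- The path cocycles on a set `O` with a base point `b` to which all points are joined: two of them
that agree on the loops at `b` differ by a gauge transformation that is trivial at `b`. -/
theorem PathCocycle.exists_gauge_eq {H : Type*} [Group H] {U O : Set X} (hOU : O ⊆ U)
    (φ : PathCocycle U H) (w : PathCocycle O H) {b : X} (hbO : b ∈ O)
    (hb : ∀ x (hx : x ∈ O), Joined (⟨b, hbO⟩ : O) ⟨x, hx⟩)
    (h : ∀ c : Path (⟨b, hbO⟩ : O) ⟨b, hbO⟩, φ.toFun (c.toSuperset hOU) = w.toFun c) :
    ∃ u : U → H, u ⟨b, hOU hbO⟩ = 1 ∧ ∀ (x y : X) (hx : x ∈ O) (hy : y ∈ O)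
      (p : Path (⟨x, hx⟩ : O) ⟨y, hy⟩), (φ.gauge u).toFun (p.toSuperset hOU) = w.toFun p := by
  classical
  let φ' := φ.comap (ContinuousMap.inclusion hOU)
  refine ⟨fun x => if hx : (x : X) ∈ O then
    w.toFun (hb x hx).somePath * (φ'.toFun (hb x hx).somePath)⁻¹ else 1, ?_, ?_⟩
  · simp only
    rw [dif_pos hbO, mul_inv_eq_one]
    exact (h _).symm
  · intro x y hx hy p
    change dite _ _ _ * φ'.toFun p * (dite _ _ _)⁻¹ = _
    rw [dif_pos hx, dif_pos hy]
    have := h (((hb x hx).somePath.trans p).trans (hb y hy).somePath.symm)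
    change φ'.toFun _ = _ at this
    rw [φ'.map_trans, φ'.map_trans, w.map_trans, w.map_trans, φ'.map_symm, w.map_symm] at this
    calc _ = w.toFun (hb y hy).somePath * ((φ'.toFun (hb y hy).somePath)⁻¹ *
          (φ'.toFun p * φ'.toFun (hb x hx).somePath)) * (w.toFun (hb x hx).somePath)⁻¹ := by group
      _ = _ := by rw [this]; group

/-- The open cover that consists of a set `W` and of sets `U i`. -/
def coverWith {ι : Type*} (W : Set X) (U : ι → Set X) : Option ι → Set X
  | none => W
  | some i => U i

theorem isOpen_coverWith {ι : Type*} {U : ι → Set X} {W : Set X} (hU : ∀ i, IsOpen (U i))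
    (hW : IsOpen W) : ∀ a, IsOpen (coverWith W U a)
  | none => hW
  | some i => hU i

theorem mem_coverWith {X ι : Type*} {U : ι → Set X} {W : Set X}
    (hcov : ∀ x, x ∈ W ∨ ∃ i, x ∈ U i) (x : X) : ∃ a, x ∈ coverWith W U a := by
  rcases hcov x with h | ⟨i, h⟩
  · exact ⟨none, h⟩
  · exact ⟨some i, h⟩

/-- The homomorphism to `π₁(X, o)` from the fundamental group of a subset, along a path from `o` to
the base point of the subset. -/
noncomputable def subsetHom {U : Set X} {b : X} (hb : b ∈ U) {o : X} (δ : Path o b) :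
    FundamentalGroup U ⟨b, hb⟩ →* FundamentalGroup X o :=
  (FundamentalGroup.fundamentalGroupMulEquivOfPath δ.symm).toMonoidHom.comp
    (FundamentalGroup.map ⟨Subtype.val, continuous_subtype_val⟩ (⟨b, hb⟩ : U))

theorem PathCocycle.toHom_subsetHom {H : Type*} [Group H] (Φ : PathCocycle X H) {U : Set X} {b : X}
    (hb : b ∈ U) {o : X} (δ : Path o b) (g : FundamentalGroup U ⟨b, hb⟩) :
    Φ.toHom o (subsetHom hb δ g) =
      (Φ.toFun δ)⁻¹ * (Φ.restrict U).toHom ⟨b, hb⟩ g * Φ.toFun δ := by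
  refine (Φ.toHom_fundamentalGroupMulEquivOfPath δ.symm _).trans ?_
  rw [Φ.map_symm, inv_inv]
  congr 2
  exact Φ.toHom_map ⟨Subtype.val, continuous_subtype_val⟩ (⟨b, hb⟩ : U) g

/-- A path in a subset as a path in the space. -/
def Path.ofSubset {U : Set X} {x y : X} {hx : x ∈ U} {hy : y ∈ U}
    (p : Path (⟨x, hx⟩ : U) ⟨y, hy⟩) : Path x y :=
  p.map continuous_subtype_val

variable {ι : Type*} {U : ι → Set X} {W C : Set X} (hU : ∀ i, IsOpen (U i)) (hW : IsOpen W)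
  (hcov : ∀ x, x ∈ W ∨ ∃ i, x ∈ U i) (hWC : W ⊆ C)
  (hdisj : ∀ i j, i ≠ j → Disjoint (U i) (U j)) {o : X} {b : ι → X}
  (hbU : ∀ i, b i ∈ U i) (hbC : ∀ i, b i ∈ C)
  (hb : ∀ i x (hxU : x ∈ U i) (hxC : x ∈ C),
    Joined (⟨b i, hbU i, hbC i⟩ : ↥(U i ∩ C)) ⟨x, hxU, hxC⟩)

include hU hW hcov hWC hdisj hb in
/-- The existence part of the van Kampen theorem for disjoint open sets `U i` that are glued to
a set `C`: homomorphisms on the fundamental groups of the `U i` extend if they agree, on the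
overlaps, with a path cocycle on `C`. -/
theorem exists_hom_of_cover {H : Type*} [Group H] (hoC : o ∈ C)
    (δ : ∀ i, Path (⟨o, hoC⟩ : C) ⟨b i, hbC i⟩)
    (f : ∀ i, FundamentalGroup (U i) ⟨b i, hbU i⟩ →* H)
    (w : PathCocycle C H) (hδ : ∀ i, w.toFun (δ i) = 1)
    (hw : ∀ i (c : Path (⟨b i, hbU i, hbC i⟩ : ↥(U i ∩ C)) ⟨b i, hbU i, hbC i⟩),
      f i (FundamentalGroup.fromPath (.mk (c.toSuperset Set.inter_subset_left))) =
        w.toFun (c.toSuperset Set.inter_subset_right)) :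
    ∃ F : FundamentalGroup X o →* H,
      ∀ i, F.comp (subsetHom (hbU i) (δ i).ofSubset) = f i := by
  choose u hu1 hu using fun i => PathCocycle.exists_gauge_eq (Set.inter_subset_left (s := U i) (t := C))
    ((PathCocycle.tautological (⟨b i, hbU i⟩ : U i)).mapHom (f i))
    (w.comap (ContinuousMap.inclusion Set.inter_subset_right)) ⟨hbU i, hbC i⟩
    (fun x hx => hb i x hx.1 hx.2) (fun c => by
      refine Eq.trans ?_ (hw i c)
      exact congrArg (f i) (PathCocycle.tautological_loop _))
  -- after a gauge transformation by `u i`, the cocycle of `f i` agrees with `w` on the overlap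
  let φ : ∀ a, PathCocycle (coverWith W U a) H := fun a => match a with
    | none => w.comap (ContinuousMap.inclusion hWC)
    | some i => ((PathCocycle.tautological (⟨b i, hbU i⟩ : U i)).mapHom (f i)).gauge (u i)
  have hφ : CompatibleCocycles φ := by
    have key : ∀ i (x y : ↥(U i ∩ W)) (p : Path x y),
        ((φ (some i)).comap (ContinuousMap.inclusion Set.inter_subset_left)).toFun p =
          ((φ none).comap (ContinuousMap.inclusion Set.inter_subset_right)).toFun p :=
      fun i x y p => hu i _ _ _ _ (p.map (ContinuousMap.inclusion
        (Set.inter_subset_inter_right (U i) hWC)).continuous)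
    rintro (_ | i) (_ | j) x y p
    · rfl
    · exact (key j _ _ (p.map (ContinuousMap.inclusion
        (Set.inter_comm W (U j)).subset).continuous)).symm
    · exact key i x y p
    · by_cases hij : i = j
      · subst hij
        rfl
      · exact ((hdisj i j hij).le_bot x.2).elim
  obtain ⟨Φ, hΦ⟩ := hφ.exists_glue (isOpen_coverWith hU hW) (mem_coverWith hcov)
  have hC : ∀ {x y : C} (p : Path x y), (Φ.restrict C).toFun p = w.toFun p := by
    refine fun p => PathCocycle.ext_of_cover
      (U := fun a => (Subtype.val : C → X) ⁻¹' (coverWith W U a))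
      (fun a => (isOpen_coverWith hU hW a).preimage continuous_subtype_val)
      (fun x => mem_coverWith hcov x) (Φ.restrict C) w ?_ p
    rintro (_ | i) x y q
    · let r : C({x : C // (x : X) ∈ W}, W) := ⟨fun x => ⟨x, x.2⟩, by fun_prop⟩
      exact hΦ none _ _ (q.map r.continuous)
    · let r : C({x : C // (x : X) ∈ U i}, ↥(U i ∩ C)) := ⟨fun x => ⟨x, x.2, x.1.2⟩, by fun_prop⟩
      refine (hΦ (some i) _ _ ((q.map r.continuous).map
        (ContinuousMap.inclusion Set.inter_subset_left).continuous)).trans ?_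
      exact hu i _ _ _ _ (q.map r.continuous)
  refine ⟨Φ.toHom o, fun i => ?_⟩
  ext g
  refine (Φ.toHom_subsetHom _ _ g).trans ?_
  have h1 : Φ.toFun (δ i).ofSubset = 1 := (hC (δ i)).trans (hδ i)
  rw [h1, inv_one, one_mul, mul_one]
  induction g using Path.Homotopic.Quotient.ind with | mk g =>
  refine (hΦ (some i) _ _ g).trans ?_
  change u i _ * f i ((PathCocycle.tautological _).toFun g) * (u i _)⁻¹ = _
  rw [hu1 i, PathCocycle.tautological_loop, inv_one, one_mul, mul_one]

include hU hW hcov hWC hdisj hb in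
/-- The uniqueness part of the van Kampen theorem. -/
theorem hom_ext_of_cover {H : Type*} [Group H] (hoC : o ∈ C)
    (δ : ∀ i, Path (⟨o, hoC⟩ : C) ⟨b i, hbC i⟩)
    (F F' : FundamentalGroup X o →* H)
    (hF : ∀ i (g : FundamentalGroup (U i) ⟨b i, hbU i⟩),
      F (subsetHom (hbU i) (δ i).ofSubset g) = F' (subsetHom (hbU i) (δ i).ofSubset g))
    (hC : ∀ c : Path (⟨o, hoC⟩ : C) ⟨o, hoC⟩, F (FundamentalGroup.fromPath (.mk c.ofSubset)) =
      F' (FundamentalGroup.fromPath (.mk c.ofSubset))) : F = F' := by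
  let Φ := (PathCocycle.tautological o).mapHom (F.prod F')
  have hΦ : ∀ g, Φ.toHom o g = (F g, F' g) := fun g => by
    rw [PathCocycle.toHom_mapHom, PathCocycle.toHom_tautological]
    rfl
  let ΦC := Φ.restrict C
  let ΦU := fun i => Φ.restrict (U i)
  let D : Subgroup (H × H) := MonoidHom.eqLocus (MonoidHom.fst H H) (MonoidHom.snd H H)
  have hDC : ∀ c : Path (⟨o, hoC⟩ : C) ⟨o, hoC⟩, ΦC.toFun c ∈ D := fun c => by
    have := hΦ (FundamentalGroup.fromPath (.mk c.ofSubset))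
    change ΦC.toFun c = _ at this
    rw [this]
    exact hC c
  have hDU : ∀ i (s : Path (⟨b i, hbU i⟩ : U i) ⟨b i, hbU i⟩),
      (ΦC.toFun (δ i))⁻¹ * (ΦU i).toFun s * ΦC.toFun (δ i) ∈ D := fun i s => by
    have := (hΦ _).symm.trans (Φ.toHom_subsetHom (hbU i) (δ i).ofSubset
      (FundamentalGroup.fromPath (.mk s)))
    change _ = (ΦC.toFun (δ i))⁻¹ * (ΦU i).toFun s * ΦC.toFun (δ i) at this
    rw [← this]
    exact hF i _
  let EC : X → Set (H × H) := fun x => {e | ∃ (hx : x ∈ C) (p : Path (⟨o, hoC⟩ : C) ⟨x, hx⟩),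
    (ΦC.toFun p)⁻¹ * e ∈ D}
  let EU : ι → X → Set (H × H) := fun i x => {e | ∃ (hx : x ∈ U i)
    (s : Path (⟨b i, hbU i⟩ : U i) ⟨x, hx⟩),
    (ΦC.toFun (δ i))⁻¹ * ((ΦU i).toFun s)⁻¹ * e ∈ D}
  have hEC : ∀ x ∈ C, ∀ i, x ∈ U i → EC x = EU i x := by
    intro x hxC i hxU
    obtain ⟨sU, sC, hs⟩ : ∃ (sU : Path (⟨b i, hbU i⟩ : U i) ⟨x, hxU⟩)
        (sC : Path (⟨b i, hbC i⟩ : C) ⟨x, hxC⟩), (ΦU i).toFun sU = ΦC.toFun sC := by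
      obtain ⟨s₀⟩ := hb i x hxU hxC
      exact ⟨s₀.toSuperset Set.inter_subset_left, s₀.toSuperset Set.inter_subset_right, rfl⟩
    ext e
    constructor
    · rintro ⟨_, p, hp⟩
      refine ⟨hxU, sU, ?_⟩
      have := D.mul_mem (hDC ((p.trans sC.symm).trans (δ i).symm)) hp
      rw [ΦC.map_trans, ΦC.map_trans, ΦC.map_symm, ΦC.map_symm, ← hs] at this
      convert this using 1
      group
    · rintro ⟨_, s, hp⟩
      refine ⟨hxC, (δ i).trans sC, ?_⟩
      have := D.mul_mem (hDU i (s.trans sU.symm)) hp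
      rw [(ΦU i).map_trans, (ΦU i).map_symm] at this
      rw [ΦC.map_trans, ← hs]
      convert this using 1
      group
  have hstepC : ∀ (x y : W) (p : Path x y), ∀ e ∈ EC x,
      (Φ.restrict W).toFun p * e ∈ EC y := by
    rintro x y p e ⟨hx, q, hq⟩
    obtain ⟨p', hp'⟩ : ∃ p' : Path (⟨x, hx⟩ : C) ⟨y, hWC y.2⟩,
        (Φ.restrict W).toFun p = ΦC.toFun p' :=
      ⟨p.map (ContinuousMap.inclusion hWC).continuous, rfl⟩
    refine ⟨hWC y.2, q.trans p', ?_⟩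
    rw [ΦC.map_trans, hp']
    convert hq using 1
    group
  have hstepU : ∀ i (x y : U i) (p : Path x y), ∀ e ∈ EU i x, (ΦU i).toFun p * e ∈ EU i y := by
    rintro i x y p e ⟨hx, q, hq⟩
    refine ⟨y.2, q.trans p, ?_⟩
    rw [(ΦU i).map_trans]
    convert hq using 1
    group
  let E : X → Set (H × H) := fun x => {e | e ∈ EC x ∨ ∃ i, e ∈ EU i x}
  have hE : ∀ a (x y : coverWith W U a) (p : Path x y), ∀ e ∈ E x,
      Φ.toFun (p.map continuous_subtype_val) * e ∈ E y := by
    rintro (_ | i) x y p e (he | ⟨j, he⟩)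
    · exact Or.inl (hstepC x y p e he)
    · refine Or.inl (hstepC x y p e ?_)
      rwa [hEC x (hWC x.2) j he.1]
    · refine Or.inr ⟨i, hstepU i x y p e ?_⟩
      rwa [← hEC x he.1 i x.2]
    · have hij : j = i := by
        by_contra hij
        exact (hdisj j i hij).le_bot ⟨he.1, x.2⟩
      subst hij
      exact Or.inr ⟨j, hstepU j x y p e he⟩
  have h1 : (1 : H × H) ∈ E o := Or.inl ⟨hoC, Path.refl _, by
    rw [mul_one]
    exact D.inv_mem (hDC (Path.refl _))⟩
  ext g
  induction g using Path.Homotopic.Quotient.ind with | mk g =>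
  have hg := Φ.transport_mem (isOpen_coverWith hU hW) (mem_coverWith hcov) E hE g h1
  have hg' : Φ.toFun g * 1 ∈ EC o := by
    rcases hg with hg | ⟨i, hg⟩
    · exact hg
    · rwa [hEC o hoC i hg.1]
  obtain ⟨_, p, hp⟩ := hg'
  have h2 := D.mul_mem (hDC p) hp
  rw [mul_inv_cancel_left, mul_one, ← Φ.toHom_fromPath, hΦ] at h2
  exact h2

end Cover

/-! ### Periodic maps and winding numbers -/

section Winding

open scoped unitInterval

theorem PathCocycle.toFun_map_eq {X Y H : Type*} [TopologicalSpace X] [TopologicalSpace Y] [Group H]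
    [SimplyConnectedSpace Y] (Φ : PathCocycle X H) (g : C(Y, X)) {x y : Y} (p q : Path x y) :
    Φ.toFun (p.map g.continuous) = Φ.toFun (q.map g.continuous) :=
  (Φ.comap g).map_homotopic (SimplyConnectedSpace.paths_homotopic p q)

/-- A path cocycle is multiplicative along the boundary of a square. -/
theorem PathCocycle.map_square {X H : Type*} [TopologicalSpace X] [Group H] (Φ : PathCocycle X H)
    (g : C(I × I, X)) {x y x' y' : X} (p : Path x y) (p' : Path x' y') (a : Path x x')
    (b : Path y y') (hp : ∀ t, g (0, t) = p t) (hp' : ∀ t, g (1, t) = p' t)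
    (ha : ∀ s, g (s, 0) = a s) (hb : ∀ s, g (s, 1) = b s) :
    Φ.toFun p' * Φ.toFun a = Φ.toFun b * Φ.toFun p := by
  have : ContractibleSpace I := (convex_Icc (0 : ℝ) 1).contractibleSpace ⟨0, by simp⟩
  obtain rfl : g (0, 0) = x := (hp 0).trans p.source
  obtain rfl : g (0, 1) = y := (hp 1).trans p.target
  obtain rfl : g (1, 0) = x' := (hp' 0).trans p'.source
  obtain rfl : g (1, 1) = y' := (hp' 1).trans p'.target
  let u : Path (0 : I) 1 := ⟨⟨id, continuous_id⟩, rfl, rfl⟩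
  have e1 : p = ((Path.refl (0 : I)).prod u).map g.continuous := Path.ext (funext fun t => (hp t).symm)
  have e2 : p' = ((Path.refl (1 : I)).prod u).map g.continuous :=
    Path.ext (funext fun t => (hp' t).symm)
  have e3 : a = (u.prod (Path.refl (0 : I))).map g.continuous := Path.ext (funext fun t => (ha t).symm)
  have e4 : b = (u.prod (Path.refl (1 : I))).map g.continuous := Path.ext (funext fun t => (hb t).symm)
  rw [e1, e2, e3, e4, ← Φ.map_trans, ← Φ.map_trans, ← Path.map_trans, ← Path.map_trans]
  exact Φ.toFun_map_eq g _ _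

/-- Along a periodic map from a simply connected space, a path cocycle takes values which depend
multiplicatively on the period. -/
theorem PathCocycle.exists_periodHom {X H E A : Type*} [TopologicalSpace X] [Group H]
    [AddCommGroup E] [Module ℝ E] [TopologicalSpace E] [IsTopologicalAddGroup E]
    [ContinuousSMul ℝ E] [AddCommGroup A] (Φ : PathCocycle X H) (g : C(E, X)) (l : A →+ E)
    (hg : ∀ a x, g (x + l a) = g x) :
    ∃ Θ : Multiplicative A →* H, ∀ a (p : Path 0 (l a)),
      Φ.toFun (p.map g.continuous) = Θ (Multiplicative.ofAdd a) := by
  let q : ∀ a, Path 0 (l a) := fun a => PathConnectedSpace.somePath _ _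
  refine ⟨MonoidHom.mk' (fun a => Φ.toFun ((q a.toAdd).map g.continuous)) fun a b => ?_,
    fun a p => Φ.toFun_map_eq g _ _⟩
  let r : Path (l b.toAdd) (l (a * b).toAdd) :=
    ((q a.toAdd).map (f := fun x => x + l b.toAdd) (by fun_prop)).cast (zero_add _).symm (by
      rw [toAdd_mul, map_add])
  have h1 : Φ.toFun (r.map g.continuous) = Φ.toFun ((q a.toAdd).map g.continuous) := by
    have h : ∀ (x y x' y' : X) (_ : x = x') (_ : y = y') (s : Path x y) (s' : Path x' y')
        (_ : ∀ t, s t = s' t), Φ.toFun s = Φ.toFun s' := by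
      rintro x y _ _ rfl rfl s s' h
      rw [Path.ext (funext h)]
    refine h _ _ _ _ ?_ ?_ _ _ fun t => hg b.toAdd _
    · rw [← hg b.toAdd 0, zero_add]
    · rw [← hg b.toAdd (l a.toAdd), toAdd_mul, map_add]
  rw [← h1, ← Φ.map_trans, ← Path.map_trans]
  exact Φ.toFun_map_eq g _ _

/-- Paths in the circle lift to the real line. -/
theorem Circle.exists_path_lift {x y : Circle} (p : Path x y) :
    ∃ θ : C(I, ℝ), θ 0 = Complex.arg x ∧ ∀ t, Circle.exp (θ t) = p t := by
  obtain ⟨θ, h1, h2⟩ := Circle.isCoveringMap_exp.exists_path_lifts p (Complex.arg x)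
    (by rw [Circle.exp_arg]; exact p.source)
  exact ⟨θ, h2, fun t => congrFun h1 t⟩

/-- The increments of two lifts of the same path in the circle agree. -/
theorem Circle.lift_sub_eq {x y : Circle} {p q : Path x y} (hpq : p.Homotopic q) {θ θ' : C(I, ℝ)}
    (h : ∀ t, Circle.exp (θ t) = p t) (h' : ∀ t, Circle.exp (θ' t) = q t) :
    θ 1 - θ 0 = θ' 1 - θ' 0 := by
  obtain ⟨k, hk⟩ := Circle.exp_eq_exp.1 (show Circle.exp (θ 0) = Circle.exp (θ' 0) by
    rw [h, h', p.source, q.source])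
  let θ'' : C(I, ℝ) := θ' + ContinuousMap.const _ (k * (2 * Real.pi))
  have hp0 : p.toContinuousMap 0 = Circle.exp (θ 0) := (h 0).symm
  have hq0 : q.toContinuousMap 0 = Circle.exp (θ 0) := by
    rw [h 0, p.source]
    exact q.source
  have e1 : θ = Circle.isCoveringMap_exp.liftPath p.toContinuousMap (θ 0) hp0 :=
    (Circle.isCoveringMap_exp.eq_liftPath_iff' hp0).2 ⟨funext h, rfl⟩
  have e2 : θ'' = Circle.isCoveringMap_exp.liftPath q.toContinuousMap (θ 0) hq0 := by
    refine (Circle.isCoveringMap_exp.eq_liftPath_iff' hq0).2 ⟨funext fun t => ?_, hk.symm⟩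
    refine Eq.trans ?_ (h' t)
    exact Circle.exp_eq_exp.2 ⟨k, rfl⟩
  have e3 := Circle.isCoveringMap_exp.liftPath_apply_one_eq_of_homotopicRel hpq (θ 0) hp0 hq0
  rw [← e1, ← e2] at e3
  change θ 1 = θ' 1 + k * (2 * Real.pi) at e3
  rw [e3, hk]
  ring

theorem Circle.exists_lift_sub {x y : Circle} (p : Path x y) :
    ∃ n : ℤ, ∀ θ : C(I, ℝ), (∀ t, Circle.exp (θ t) = p t) →
      θ 1 - θ 0 = Complex.arg y - Complex.arg x + n * (2 * Real.pi) := by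
  obtain ⟨θ, h0, h⟩ := Circle.exists_path_lift p
  obtain ⟨n, hn⟩ := Circle.exp_eq_exp.1 (show Circle.exp (θ 1) = Circle.exp (Complex.arg y) by
    rw [h, p.target, Circle.exp_arg])
  refine ⟨n, fun θ' h' => ?_⟩
  rw [Circle.lift_sub_eq (Path.Homotopic.refl p) h' h, hn, h0]
  ring

/-- The winding number of paths in the circle, as a path cocycle: the increment of the argument
along the path is `2π` times the winding number, up to the difference of the principal arguments of
the end points. -/
noncomputable def Circle.winding : PathCocycle Circle (Multiplicative ℤ) where
  toFun p := Multiplicative.ofAdd (Circle.exists_lift_sub p).choose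
  map_trans {x y z} p q := by
    obtain ⟨θ, h0, h⟩ := Circle.exists_path_lift p
    obtain ⟨η, k0, k⟩ := Circle.exists_path_lift q
    have e1 := (Circle.exists_lift_sub p).choose_spec θ h
    have e2 := (Circle.exists_lift_sub q).choose_spec η k
    obtain ⟨n, hn⟩ := Circle.exp_eq_exp.1 (show Circle.exp (θ 1) = Circle.exp (η 0) by
      rw [h, k, p.target, q.source])
    let P : Path (θ 0) (θ 1) := ⟨θ, rfl, rfl⟩
    let Q : Path (θ 1) (η 1 + n * (2 * Real.pi)) :=
      ⟨η + ContinuousMap.const _ (n * (2 * Real.pi)), hn.symm, rfl⟩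
    have e3 := (Circle.exists_lift_sub (p.trans q)).choose_spec (P.trans Q).toContinuousMap
      fun t => by
        change Circle.exp ((P.trans Q) t) = _
        rw [Path.trans_apply, Path.trans_apply]
        split_ifs
        · exact h _
        · refine Eq.trans ?_ (k _)
          exact Circle.exp_eq_exp.2 ⟨n, rfl⟩
    change (P.trans Q) 1 - (P.trans Q) 0 = _ at e3
    rw [(P.trans Q).source, (P.trans Q).target] at e3
    rw [← ofAdd_add]
    congr 1
    have h2 : (2 * Real.pi) ≠ 0 := by positivity
    have : ((Circle.exists_lift_sub (p.trans q)).choose : ℝ) * (2 * Real.pi) =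
        ((Circle.exists_lift_sub q).choose + (Circle.exists_lift_sub p).choose) * (2 * Real.pi) := by
      linarith
    exact_mod_cast mul_right_cancel₀ h2 this
  map_homotopic {x y p q} hpq := by
    obtain ⟨θ, h0, h⟩ := Circle.exists_path_lift p
    obtain ⟨η, k0, k⟩ := Circle.exists_path_lift q
    have e1 := (Circle.exists_lift_sub p).choose_spec θ h
    have e2 := (Circle.exists_lift_sub q).choose_spec η k
    have e3 := Circle.lift_sub_eq hpq h k
    have h2 : (2 * Real.pi) ≠ 0 := by positivity
    congr 1
    have : ((Circle.exists_lift_sub p).choose : ℝ) * (2 * Real.pi) =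
        (Circle.exists_lift_sub q).choose * (2 * Real.pi) := by linarith
    exact_mod_cast mul_right_cancel₀ h2 this

theorem Circle.lift_sub_eq_winding {x y : Circle} (p : Path x y) (θ : C(I, ℝ))
    (h : ∀ t, Circle.exp (θ t) = p t) : θ 1 - θ 0 = Complex.arg y - Complex.arg x +
      (Multiplicative.toAdd (Circle.winding.toFun p) : ℤ) * (2 * Real.pi) :=
  (Circle.exists_lift_sub p).choose_spec θ h

/-- The winding number vanishes on paths in the right half plane. -/
theorem Circle.winding_eq_one {x y : Circle} (p : Path x y) (h : ∀ t, 0 < (p t : ℂ).re) :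
    Circle.winding.toFun p = 1 := by
  let θ : C(I, ℝ) := ⟨fun t => Complex.arg (p t), by
    rw [continuous_iff_continuousAt]
    intro t
    exact (Complex.continuousAt_arg (Or.inl (h t))).comp
      (f := fun t => (p t : ℂ)) (by fun_prop : Continuous fun t => (p t : ℂ)).continuousAt⟩
  have h1 := Circle.lift_sub_eq_winding p θ fun t => Circle.exp_arg _
  have h2 : θ 1 - θ 0 = Complex.arg y - Complex.arg x := by
    change Complex.arg (p 1) - Complex.arg (p 0) = _
    rw [p.source, p.target]
  rw [h2] at h1
  have h3 : (2 * Real.pi) ≠ 0 := by positivity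
  have h4 : ((Multiplicative.toAdd (Circle.winding.toFun p) : ℤ) : ℝ) = 0 := by
    have : ((Multiplicative.toAdd (Circle.winding.toFun p) : ℤ) : ℝ) * (2 * Real.pi) = 0 := by
      linarith
    exact (mul_eq_zero.1 this).resolve_right h3
  exact Multiplicative.toAdd.injective (by exact_mod_cast h4)

/-- A loop at `1` in the circle lifts to a path from `0` to `2π` times its winding number. -/
theorem Circle.exists_path_lift_loop (p : Path (1 : Circle) 1) :
    ∃ θ : Path (0 : ℝ) ((Multiplicative.toAdd (Circle.winding.toFun p) : ℤ) * (2 * Real.pi)),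
      ∀ t, Circle.exp (θ t) = p t := by
  obtain ⟨θ, h0, h⟩ := Circle.exists_path_lift p
  have h1 := Circle.lift_sub_eq_winding p θ h
  have h2 : Complex.arg (1 : Circle) = 0 := by simp
  rw [h2] at h0 h1
  exact ⟨⟨θ, h0, by
    rw [h0] at h1
    simpa using h1⟩, h⟩

end Winding

/-! ### Deformation retractions and polar coordinates on the 3-sphere -/

section Retraction

open scoped unitInterval

variable {A Y : Type*} [TopologicalSpace A] [TopologicalSpace Y]

/-- The inclusion of a strong deformation retract induces an isomorphism of fundamental groups. -/
theorem FundamentalGroup.map_bijective_of_retraction (j : C(A, Y)) (r : C(Y, A))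
    (hr : r.comp j = ContinuousMap.id A) (h : C(I × Y, Y)) (h0 : ∀ y, h (0, y) = y)
    (h1 : ∀ y, h (1, y) = j (r y)) (hj : ∀ s a, h (s, j a) = j a) (a : A) :
    Function.Bijective (FundamentalGroup.map j a) := by
  have hra : ∀ a, r (j a) = a := DFunLike.congr_fun hr
  constructor
  · intro p q hpq
    induction p using Path.Homotopic.Quotient.ind with | mk p =>
    induction q using Path.Homotopic.Quotient.ind with | mk q =>
    have hpq' : (p.map j.continuous).Homotopic (q.map j.continuous) :=
      Path.Homotopic.Quotient.exact hpq
    have h2 : ∀ g : C(A, A), g = ContinuousMap.id A →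
        (p.map g.continuous).Homotopic (q.map g.continuous) → p.Homotopic q := by
      rintro _ rfl h
      exact h
    exact Path.Homotopic.Quotient.eq.2 (h2 _ hr (hpq'.map r))
  · intro p
    induction p using Path.Homotopic.Quotient.ind with | mk p =>
    refine ⟨FundamentalGroup.fromPath (.mk ((p.map r.continuous).cast (hra a).symm (hra a).symm)),
      Path.Homotopic.Quotient.eq.2 (Path.Homotopic.symm ⟨?_⟩)⟩
    exact
      { toFun := fun x => h (x.1, p x.2)
        continuous_toFun := by fun_prop
        map_zero_left := fun t => h0 _
        map_one_left := fun t => h1 _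
        prop' := fun s t ht => by
          have hp : p t = j a := by
            rcases ht with rfl | rfl
            · exact p.source
            · exact p.target
          change h (s, p t) = p t
          rw [hp, hj] }

end Retraction

section Polar

open scoped unitInterval

theorem S3.norm_sq_add (p : S3) (i : Fin 2) : ‖p.1 i‖ ^ 2 + ‖p.1 (1 - i)‖ ^ 2 = 1 := by
  have h : ‖p.1‖ = 1 := mem_sphere_zero_iff_norm.1 p.2
  rw [EuclideanSpace.norm_eq, Real.sqrt_eq_one, Fin.sum_univ_two] at h
  fin_cases i
  · exact h
  · rw [add_comm]
    exact h

theorem S3.ext_coord {p q : S3} (i : Fin 2) (h : p.1 i = q.1 i)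
    (h' : p.1 (1 - i) = q.1 (1 - i)) : p = q := by
  refine Subtype.ext (PiLp.ext fun j => ?_)
  by_cases hj : j = i
  · rw [hj, h]
  · obtain rfl : j = 1 - i := by clear h h'; revert i j; decide
    exact h'

@[fun_prop]
theorem S3.continuous_coord (i : Fin 2) : Continuous fun p : S3 => p.1 i :=
  (PiLp.continuous_apply 2 _ i).comp continuous_subtype_val

/-- The point of the 3-sphere whose `i`-th coordinate is `u` and whose other coordinate is a
nonnegative multiple of `d`. -/
noncomputable def S3.polar (i : Fin 2) (u : Metric.closedBall (0 : ℂ) 1) (d : Circle) : S3 :=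
  ⟨WithLp.toLp 2 fun j => if j = i then (u : ℂ) else (√(1 - ‖(u : ℂ)‖ ^ 2) : ℝ) * (d : ℂ), by
    have hu : ‖(u : ℂ)‖ ≤ 1 := mem_closedBall_zero_iff.1 u.2
    have hu' : 0 ≤ 1 - ‖(u : ℂ)‖ ^ 2 := by
      have := norm_nonneg (u : ℂ)
      nlinarith
    have h2 : ‖((√(1 - ‖(u : ℂ)‖ ^ 2) : ℝ) * (d : ℂ) : ℂ)‖ ^ 2 = 1 - ‖(u : ℂ)‖ ^ 2 := by
      rw [norm_mul, Circle.norm_coe, mul_one, Complex.norm_real, Real.norm_eq_abs, sq_abs,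
        Real.sq_sqrt hu']
    rw [mem_sphere_zero_iff_norm, EuclideanSpace.norm_eq, Real.sqrt_eq_one, Fin.sum_univ_two]
    fin_cases i
    · simpa [-norm_mul] using (congrArg (‖(u : ℂ)‖ ^ 2 + ·) h2).trans (by ring)
    · simpa [-norm_mul] using (congrArg (· + ‖(u : ℂ)‖ ^ 2) h2).trans (by ring)⟩

theorem S3.polar_self (i : Fin 2) (u : Metric.closedBall (0 : ℂ) 1) (d : Circle) :
    (S3.polar i u d).1 i = u := by
  simp [S3.polar]

theorem S3.polar_other (i : Fin 2) (u : Metric.closedBall (0 : ℂ) 1) (d : Circle) :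
    (S3.polar i u d).1 (1 - i) = (√(1 - ‖(u : ℂ)‖ ^ 2) : ℝ) * (d : ℂ) := by
  fin_cases i <;> simp [S3.polar]

theorem S3.continuous_polar {Y : Type*} [TopologicalSpace Y] (i : Fin 2)
    {u : Y → Metric.closedBall (0 : ℂ) 1} {d : Y → Circle} (hu : Continuous u)
    (hd : Continuous d) : Continuous fun y => S3.polar i (u y) (d y) := by
  refine Continuous.subtype_mk ((PiLp.continuous_toLp 2 _).comp ?_) _
  refine continuous_pi fun j => ?_
  split_ifs <;> fun_prop

/-- The direction of a complex number, with the direction of `0` being `1`. -/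
noncomputable def Complex.direction (z : ℂ) : Circle := Circle.exp (Complex.arg z)

theorem Complex.norm_mul_direction (z : ℂ) : (‖z‖ : ℂ) * Complex.direction z = z :=
  Complex.norm_mul_exp_arg_mul_I z

theorem Complex.direction_eq {z : ℂ} {r : ℝ} (hr : 0 < r) {d : Circle} (h : z = r * (d : ℂ)) :
    Complex.direction z = d := by
  rw [direction, h, Complex.arg_real_mul _ hr, Circle.exp_arg]

theorem Complex.continuousOn_direction : ContinuousOn Complex.direction {z | z ≠ 0} := by
  rw [continuousOn_iff_continuous_domRestrict]
  refine continuous_induced_rng.2 ?_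
  have : ∀ z : {z : ℂ | z ≠ 0}, (Complex.direction z : ℂ) = (z : ℂ) / ‖(z : ℂ)‖ := by
    intro z
    have hz : (‖(z : ℂ)‖ : ℂ) ≠ 0 := by
      rw [Complex.ofReal_ne_zero, norm_ne_zero_iff]
      exact z.2
    refine (eq_div_iff hz).2 ?_
    rw [mul_comm]
    exact Complex.norm_mul_direction z
  refine (continuous_congr this).2 ?_
  refine Continuous.div (by fun_prop) (by fun_prop) fun z => ?_
  rw [Complex.ofReal_ne_zero, norm_ne_zero_iff]
  exact z.2

/-- The `i`-th coordinate of a point of the 3-sphere, as a point of the unit disc. -/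
noncomputable def S3.disc (p : S3) (i : Fin 2) : Metric.closedBall (0 : ℂ) 1 :=
  ⟨p.1 i, by
    rw [mem_closedBall_zero_iff]
    have h1 := S3.norm_sq_add p i
    have h2 := sq_nonneg ‖p.1 (1 - i)‖
    nlinarith [norm_nonneg (p.1 i)]⟩

theorem S3.polar_eq_iff {i : Fin 2} {u : Metric.closedBall (0 : ℂ) 1} {d : Circle} {p : S3} :
    S3.polar i u d = p ↔ (u : ℂ) = p.1 i ∧ p.1 (1 - i) = ‖p.1 (1 - i)‖ * (d : ℂ) := by
  constructor
  · rintro rfl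
    refine ⟨(S3.polar_self i u d).symm, ?_⟩
    rw [S3.polar_other, norm_mul, Circle.norm_coe, mul_one, Complex.norm_real, Real.norm_eq_abs,
      abs_of_nonneg (Real.sqrt_nonneg _)]
  · rintro ⟨h1, h2⟩
    refine S3.ext_coord i ((S3.polar_self i u d).trans h1) ?_
    have h3 : ‖p.1 (1 - i)‖ = √(1 - ‖(u : ℂ)‖ ^ 2) := by
      have := S3.norm_sq_add p i
      rw [h1, show 1 - ‖p.1 i‖ ^ 2 = ‖p.1 (1 - i)‖ ^ 2 by linarith, Real.sqrt_sq (norm_nonneg _)]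
    rw [S3.polar_other, ← h3]
    exact h2.symm

theorem S3.polar_disc_direction (i : Fin 2) (p : S3) :
    S3.polar i (p.disc i) (Complex.direction (p.1 (1 - i))) = p :=
  S3.polar_eq_iff.2 ⟨rfl, (Complex.norm_mul_direction _).symm⟩

end Polar

/-! ### Points of the exteriors in the standard balls -/

section Exterior

open scoped unitInterval

theorem S3.norm_other_lt {p : S3} {i : Fin 2} (h : 3 / 4 ≤ (p.1 i).re) :
    ‖p.1 (1 - i)‖ < 4 / 5 := by
  have h1 := S3.norm_sq_add p i
  have h2 := (Complex.re_le_norm (p.1 i)).trans' h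
  nlinarith [norm_nonneg (p.1 (1 - i))]

theorem S3.norm_other_sq_le {p : S3} {i : Fin 2} (h : 1 / 2 ≤ ‖p.1 (1 - i)‖) :
    ‖p.1 i‖ ^ 2 ≤ 3 / 4 := by
  have h1 := S3.norm_sq_add p i
  nlinarith

theorem S3.half_le_norm_other {p : S3} {i : Fin 2} (h : ‖p.1 i‖ ^ 2 ≤ 3 / 4) :
    1 / 2 ≤ ‖p.1 (1 - i)‖ := by
  have h1 := S3.norm_sq_add p i
  nlinarith [norm_nonneg (p.1 (1 - i))]

namespace HopfLikeLink

variable (L : HopfLikeLink)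

theorem apply_mem_knot_exterior_iff {i : Fin 2} {p : S3} (h : (p.1 i).re ≤ 4 / 5) :
    L.h p ∈ (L.K i).exterior ↔ 1 / 2 ≤ ‖p.1 (1 - i)‖ := by
  rw [ThickenedKnot.exterior, Set.mem_compl_iff, L.nbhd_iff i p h, not_lt]

theorem apply_mem_other_exterior {i : Fin 2} {p : S3} (h : 3 / 4 ≤ (p.1 i).re) :
    L.h p ∈ (L.K (1 - i)).exterior := by
  rw [L.apply_mem_knot_exterior_iff ((Complex.re_le_norm _).trans (S3.norm_other_lt h).le),
    sub_sub_cancel]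
  have := (Complex.re_le_norm (p.1 i)).trans' h
  linarith

theorem mem_exterior_iff (i : Fin 2) {x : S3} :
    x ∈ L.exterior ↔ x ∈ (L.K i).exterior ∧ x ∈ (L.K (1 - i)).exterior := by
  rw [exterior, Set.mem_iInter]
  refine ⟨fun h => ⟨h i, h _⟩, fun h j => ?_⟩
  by_cases hj : j = i
  · rw [hj]
    exact h.1
  · obtain rfl : j = 1 - i := by clear h; revert i j; decide
    exact h.2

theorem apply_mem_exterior_iff_of_le {i : Fin 2} {p : S3} (h : 3 / 4 ≤ (p.1 i).re) :
    L.h p ∈ L.exterior ↔ L.h p ∈ (L.K i).exterior := by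
  rw [L.mem_exterior_iff i]
  exact and_iff_left (L.apply_mem_other_exterior h)

end HopfLikeLink

end Exterior

/-! ### The retraction of the exterior of a component onto the piece -/

section Retract

open scoped unitInterval

/-- The horizontal projection of the complex plane to the line `Re z = 4/5`, followed by the
retraction of the line to its segment in the disc of radius `√3/2`. The segment has half-length
`√11/10`, since `3/4 - (4/5)² = 11/100`. -/
noncomputable def wall (z : ℂ) : ℂ := ⟨4 / 5, max (-(√11 / 10)) (min (√11 / 10) z.im)⟩

theorem continuous_wall : Continuous wall := by
  have : wall = fun z => ((4 / 5 : ℝ) : ℂ) +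
      ((max (-(√11 / 10)) (min (√11 / 10) z.im) : ℝ) : ℂ) * Complex.I := by
    funext z
    exact Complex.mk_eq_add_mul_I _ _
  rw [this]
  fun_prop

theorem norm_wall_sq_le (z : ℂ) : ‖wall z‖ ^ 2 ≤ 3 / 4 := by
  have h0 : (0 : ℝ) ≤ √11 / 10 := by positivity
  have h1 : (√11 / 10) ^ 2 = 11 / 100 := by
    rw [div_pow, Real.sq_sqrt (by norm_num)]
    norm_num
  have h2 : (max (-(√11 / 10)) (min (√11 / 10) z.im)) ^ 2 ≤ (√11 / 10) ^ 2 :=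
    sq_le_sq' (le_max_left _ _) (max_le (by linarith) (min_le_left _ _))
  rw [← Complex.normSq_eq_norm_sq, Complex.normSq_apply]
  change 4 / 5 * (4 / 5) + max (-(√11 / 10)) (min (√11 / 10) z.im) *
    max (-(√11 / 10)) (min (√11 / 10) z.im) ≤ _
  nlinarith

theorem wall_eq_self {z : ℂ} (hz : z.re = 4 / 5) (h : ‖z‖ ^ 2 ≤ 3 / 4) : wall z = z := by
  have h1 : (√11 / 10) ^ 2 = 11 / 100 := by
    rw [div_pow, Real.sq_sqrt (by norm_num)]
    norm_num
  rw [← Complex.normSq_eq_norm_sq, Complex.normSq_apply, hz] at h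
  have h2 : z.im ^ 2 ≤ (√11 / 10) ^ 2 := by nlinarith
  have h3 := abs_le_of_sq_le_sq' h2 (by positivity)
  refine Complex.ext hz.symm ?_
  change max (-(√11 / 10)) (min (√11 / 10) z.im) = z.im
  rw [min_eq_right h3.2, max_eq_right h3.1]

/-- A point of the segment from `z` to `w`. -/
noncomputable def segmentPoint (s : I) (z w : ℂ) : ℂ := (1 - s : ℝ) • z + (s : ℝ) • w

theorem segmentPoint_mem {K : Set ℂ} (hK : Convex ℝ K) {z w : ℂ} (hz : z ∈ K) (hw : w ∈ K)
    (s : I) : segmentPoint s z w ∈ K :=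
  hK hz hw (by linarith [s.2.2]) s.2.1 (by ring)

@[simp] theorem segmentPoint_zero (z w : ℂ) : segmentPoint 0 z w = z := by simp [segmentPoint]

@[simp] theorem segmentPoint_one (z w : ℂ) : segmentPoint 1 z w = w := by simp [segmentPoint]

@[simp] theorem segmentPoint_self (s : I) (z : ℂ) : segmentPoint s z z = z := by
  rw [segmentPoint, ← add_smul, sub_add_cancel, one_smul]

theorem norm_segmentPoint_sq_le {z w : ℂ} {r : ℝ} (hr : 0 ≤ r) (hz : ‖z‖ ^ 2 ≤ r)
    (hw : ‖w‖ ^ 2 ≤ r) (s : I) : ‖segmentPoint s z w‖ ^ 2 ≤ r := by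
  have h : ∀ {v : ℂ}, v ∈ Metric.closedBall (0 : ℂ) √r ↔ ‖v‖ ^ 2 ≤ r := fun {v} => by
    rw [mem_closedBall_zero_iff, Real.le_sqrt (norm_nonneg _) hr]
  exact h.1 (segmentPoint_mem (convex_closedBall _ _) (h.2 hz) (h.2 hw) s)

/-- A point of the segment between two points of the unit disc. -/
noncomputable def discSegment (s : I) (z w : Metric.closedBall (0 : ℂ) 1) :
    Metric.closedBall (0 : ℂ) 1 :=
  ⟨segmentPoint s z w, segmentPoint_mem (convex_closedBall _ _) z.2 w.2 s⟩

theorem continuous_discSegment {Y : Type*} [TopologicalSpace Y] {s : Y → I}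
    {z w : Y → Metric.closedBall (0 : ℂ) 1} (hs : Continuous s) (hz : Continuous z)
    (hw : Continuous w) : Continuous fun y => discSegment (s y) (z y) (w y) :=
  Continuous.subtype_mk (by unfold segmentPoint; fun_prop) _

/-- `wall`, as a self-map of the unit disc. -/
noncomputable def discWall (z : Metric.closedBall (0 : ℂ) 1) : Metric.closedBall (0 : ℂ) 1 :=
  ⟨wall z, by
    rw [mem_closedBall_zero_iff]
    nlinarith [norm_wall_sq_le z, norm_nonneg (wall z)]⟩

theorem continuous_discWall : Continuous discWall :=
  Continuous.subtype_mk (continuous_wall.comp continuous_subtype_val) _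

/-- The points of the sphere which are not in the tube `‖z₁₋ᵢ‖ < 1/2` outside the ball
`Re zᵢ ≥ 4/5`. -/
def outsideTube (i : Fin 2) : Set S3 := {p | (p.1 i).re ≤ 4 / 5 → 1 / 2 ≤ ‖p.1 (1 - i)‖}

open Classical in
/-- The deformation of the complement of the tube `‖z₁₋ᵢ‖ < 1/2`, `Re zᵢ < 4/5` to the ball
`Re zᵢ ≥ 4/5`: outside of the ball, the coordinate `zᵢ` moves straight to its projection to the
line `Re z = 4/5`, and the direction of `z₁₋ᵢ` is fixed. -/
noncomputable def pushToBall (i : Fin 2) (s : I) (p : S3) : S3 :=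
  if 4 / 5 ≤ (p.1 i).re then p else
    S3.polar i (discSegment s (p.disc i) (discWall (p.disc i))) (Complex.direction (p.1 (1 - i)))

theorem S3.continuous_disc (i : Fin 2) : Continuous fun p : S3 => p.disc i :=
  Continuous.subtype_mk (S3.continuous_coord i) _

theorem pushToBall_of_le {i : Fin 2} {p : S3} (h : 4 / 5 ≤ (p.1 i).re) (s : I) :
    pushToBall i s p = p := if_pos h

theorem pushToBall_zero (i : Fin 2) (p : S3) : pushToBall i 0 p = p := by
  unfold pushToBall
  split_ifs
  · rfl
  · refine Eq.trans ?_ (S3.polar_disc_direction i p)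
    congr 1
    exact Subtype.ext (segmentPoint_zero _ _)

theorem pushToBall_coord {i : Fin 2} {p : S3} (h : (p.1 i).re < 4 / 5) (s : I) :
    (pushToBall i s p).1 i = segmentPoint s (p.1 i) (wall (p.1 i)) := by
  rw [pushToBall, if_neg h.not_ge, S3.polar_self]
  rfl

theorem le_re_pushToBall_one (i : Fin 2) (p : S3) : 4 / 5 ≤ ((pushToBall i 1 p).1 i).re := by
  by_cases h : 4 / 5 ≤ (p.1 i).re
  · rwa [pushToBall_of_le h]
  · rw [pushToBall_coord (not_le.1 h), segmentPoint_one]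
    exact le_refl (4 / 5 : ℝ)

theorem lt_re_pushToBall {i : Fin 2} {p : S3} (h : 3 / 4 < (p.1 i).re) (s : I) :
    3 / 4 < ((pushToBall i s p).1 i).re := by
  by_cases h' : 4 / 5 ≤ (p.1 i).re
  · rwa [pushToBall_of_le h']
  · rw [pushToBall_coord (not_le.1 h')]
    refine segmentPoint_mem (convex_halfSpace_re_gt (3 / 4)) h ?_ s
    change (3 / 4 : ℝ) < 4 / 5
    norm_num

theorem pushToBall_mem {i : Fin 2} {p : S3} (hp : p ∈ outsideTube i) (s : I)
    (h' : (p.1 i).re < 4 / 5) :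
    ((pushToBall i s p).1 i).re ≤ 4 / 5 ∧ 1 / 2 ≤ ‖(pushToBall i s p).1 (1 - i)‖ := by
  constructor
  · rw [pushToBall_coord h']
    refine segmentPoint_mem (convex_halfSpace_re_le (4 / 5)) h'.le ?_ s
    exact le_refl (4 / 5 : ℝ)
  · refine S3.half_le_norm_other ?_
    rw [pushToBall_coord h']
    exact norm_segmentPoint_sq_le (by norm_num) (S3.norm_other_sq_le (hp h'.le))
      (norm_wall_sq_le _) s

/-- The two definitions agree on the sphere `Re zᵢ = 4/5`, where `wall` fixes the points with
`‖z₁₋ᵢ‖ ≥ 1/2`. -/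
theorem continuous_pushToBall (i : Fin 2) :
    Continuous fun x : I × outsideTube i => pushToBall i x.1 x.2 := by
  unfold pushToBall
  refine continuous_if_le (by fun_prop)
    ((Complex.continuous_re.comp (S3.continuous_coord i)).comp
      (continuous_subtype_val.comp continuous_snd)) (by fun_prop) ?_ ?_
  · rw [continuousOn_iff_continuous_domRestrict]
    refine S3.continuous_polar i (continuous_discSegment (by fun_prop) ?_ ?_) ?_
    · exact (S3.continuous_disc i).comp (by fun_prop)
    · exact continuous_discWall.comp ((S3.continuous_disc i).comp (by fun_prop))
    · refine Complex.continuousOn_direction.comp_continuous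
        ((S3.continuous_coord (1 - i)).comp (by fun_prop)) fun x => ?_
      have h := x.1.2.2 x.2
      rw [Set.mem_ofPred_eq, ← norm_pos_iff]
      linarith
  · rintro x hx
    have h1 := x.2.2 hx.ge
    have h2 : wall ((x.2 : S3).1 i) = (x.2 : S3).1 i :=
      wall_eq_self hx.symm (S3.norm_other_sq_le h1)
    refine (S3.polar_disc_direction i x.2).symm.trans ?_
    congr 1
    refine Subtype.ext ?_
    change _ = segmentPoint x.1 _ (wall _)
    rw [show ((S3.disc x.2 i : Metric.closedBall (0 : ℂ) 1) : ℂ) = (x.2 : S3).1 i from rfl, h2,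
      segmentPoint_self]

namespace HopfLikeLink

variable (L : HopfLikeLink)

theorem symm_mem_outsideTube {i : Fin 2} {x : S3} (hx : x ∈ (L.K i).exterior) :
    L.h.symm x ∈ outsideTube i := fun h => by
  rw [← L.apply_mem_knot_exterior_iff h, L.h.apply_symm_apply]
  exact hx

theorem pushToBall_mem_knot_exterior {i : Fin 2} {x : S3} (hx : x ∈ (L.K i).exterior) (s : I) :
    L.h (pushToBall i s (L.h.symm x)) ∈ (L.K i).exterior := by
  by_cases h : 4 / 5 ≤ ((L.h.symm x).1 i).re
  · rwa [pushToBall_of_le h, L.h.apply_symm_apply]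
  · obtain ⟨h1, h2⟩ := pushToBall_mem (L.symm_mem_outsideTube hx) s (not_le.1 h)
    exact (L.apply_mem_knot_exterior_iff h1).2 h2

theorem mem_knot_exterior_of_mem {x : S3} (hx : x ∈ L.exterior) (i : Fin 2) :
    x ∈ (L.K i).exterior := Set.mem_iInter.1 hx i

theorem pushToBall_mem_piece {i : Fin 2} {x : S3} (hx : x ∈ (L.K i).exterior) :
    L.h (pushToBall i 1 (L.h.symm x)) ∈ L.piece i := by
  refine ⟨?_, _, le_re_pushToBall_one i _, rfl⟩
  rw [L.apply_mem_exterior_iff_of_le ((le_re_pushToBall_one i _).trans' (by norm_num))]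
  exact L.pushToBall_mem_knot_exterior hx 1

theorem re_symm_of_mem_piece {i : Fin 2} {x : S3} (hx : x ∈ L.piece i) :
    4 / 5 ≤ ((L.h.symm x).1 i).re := by
  obtain ⟨-, p, hp, rfl⟩ := hx
  rw [L.h.symm_apply_apply]
  exact hp

/-- The part of the link exterior in the open ball `Re zᵢ > 3/4`. -/
def cap (i : Fin 2) : Set L.exterior := {x | 3 / 4 < ((L.h.symm x).1 i).re}

theorem isOpen_cap (i : Fin 2) : IsOpen (L.cap i) :=
  isOpen_lt continuous_const (Complex.continuous_re.comp ((S3.continuous_coord i).comp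
    (L.h.symm.continuous.comp continuous_subtype_val)))

/-- The inclusion of `Pᵢ` into the part of the link exterior in a larger open ball. -/
def pieceToCap (i : Fin 2) : C(L.piece i, L.cap i) :=
  ⟨fun x => ⟨⟨x, x.2.1⟩, (L.re_symm_of_mem_piece x.2).trans_lt' (by norm_num)⟩, by fun_prop⟩

theorem continuous_pushToBall_symm {Y : Type*} [TopologicalSpace Y] (i : Fin 2) {s : Y → I}
    {x : Y → S3} (hs : Continuous s) (hx : Continuous x) (hx' : ∀ y, x y ∈ (L.K i).exterior) :
    Continuous fun y => L.h (pushToBall i (s y) (L.h.symm (x y))) :=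
  L.h.continuous.comp ((continuous_pushToBall i).comp (hs.prodMk
    (Continuous.subtype_mk (L.h.symm.continuous.comp hx) fun y => L.symm_mem_outsideTube (hx' y))))

/-- The inclusion of `Pᵢ` into the exterior of `Kᵢ` is the inclusion of a strong deformation
retract: the exterior of the unknotted part of `Kᵢ` outside the ball is pushed into the ball. -/
theorem toKnotGroup_bijective (i : Fin 2) : Function.Bijective (L.toKnotGroup i) := by
  refine FundamentalGroup.map_bijective_of_retraction (L.pieceToKnot i)
    ⟨fun x => ⟨_, L.pushToBall_mem_piece x.2⟩, Continuous.subtype_mk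
      (L.continuous_pushToBall_symm i continuous_const continuous_subtype_val fun x => x.2) _⟩ ?_
    ⟨fun y => ⟨_, L.pushToBall_mem_knot_exterior y.2.2 y.1⟩, Continuous.subtype_mk
      (L.continuous_pushToBall_symm i continuous_fst (continuous_subtype_val.comp continuous_snd)
        fun y => y.2.2) _⟩ ?_ ?_ ?_ _
  · refine ContinuousMap.ext fun x => Subtype.ext ?_
    change (L.h (pushToBall i 1 (L.h.symm x)) : S3) = x
    rw [pushToBall_of_le (L.re_symm_of_mem_piece x.2), L.h.apply_symm_apply]
  · intro y
    refine Subtype.ext ?_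
    change L.h (pushToBall i 0 (L.h.symm y)) = y
    rw [pushToBall_zero, L.h.apply_symm_apply]
  · intro y
    rfl
  · intro s x
    refine Subtype.ext ?_
    change L.h (pushToBall i s (L.h.symm x)) = x
    rw [pushToBall_of_le (L.re_symm_of_mem_piece x.2), L.h.apply_symm_apply]

/-- The deformation of the exterior of `Kᵢ` onto `Pᵢ` preserves the open ball `Re zᵢ > 3/4`, on
which the exteriors of `Kᵢ` and of the link coincide. -/
theorem map_pieceToCap_bijective (i : Fin 2) (a : L.piece i) :
    Function.Bijective (FundamentalGroup.map (L.pieceToCap i) a) := by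
  have hK : ∀ y : L.cap i, ((y : L.exterior) : S3) ∈ (L.K i).exterior := fun y =>
    L.mem_knot_exterior_of_mem y.1.2 i
  have hre : ∀ (s : I) (y : L.cap i), 3 / 4 < ((pushToBall i s (L.h.symm y)).1 i).re :=
    fun s y => lt_re_pushToBall y.2 s
  have hmem : ∀ (s : I) (y : L.cap i), L.h (pushToBall i s (L.h.symm y)) ∈ L.exterior :=
    fun s y => (L.apply_mem_exterior_iff_of_le (hre s y).le).2
      (L.pushToBall_mem_knot_exterior (hK y) s)
  have hcap : ∀ (s : I) (y : L.cap i), (⟨_, hmem s y⟩ : L.exterior) ∈ L.cap i := fun s y => by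
    change 3 / 4 < ((L.h.symm (L.h _)).1 i).re
    rw [L.h.symm_apply_apply]
    exact hre s y
  refine FundamentalGroup.map_bijective_of_retraction (L.pieceToCap i)
    ⟨fun x => ⟨_, L.pushToBall_mem_piece (hK x)⟩, Continuous.subtype_mk
      (L.continuous_pushToBall_symm i continuous_const (by fun_prop) hK) _⟩ ?_
    ⟨fun y => ⟨⟨_, hmem y.1 y.2⟩, hcap y.1 y.2⟩, Continuous.subtype_mk (Continuous.subtype_mk
      (L.continuous_pushToBall_symm i continuous_fst (by fun_prop)
        fun y => hK y.2) _) _⟩ ?_ ?_ ?_ a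
  · refine ContinuousMap.ext fun x => Subtype.ext ?_
    change (L.h (pushToBall i 1 (L.h.symm x)) : S3) = x
    rw [pushToBall_of_le (L.re_symm_of_mem_piece x.2), L.h.apply_symm_apply]
  · intro y
    refine Subtype.ext (Subtype.ext ?_)
    change L.h (pushToBall i 0 (L.h.symm y)) = y
    rw [pushToBall_zero, L.h.apply_symm_apply]
  · intro y
    rfl
  · intro s x
    refine Subtype.ext (Subtype.ext ?_)
    change L.h (pushToBall i s (L.h.symm x)) = x
    rw [pushToBall_of_le (L.re_symm_of_mem_piece x.2), L.h.apply_symm_apply]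

end HopfLikeLink

end Retract

/-! ### The torus between the balls -/

section Middle

open scoped unitInterval

theorem PathCocycle.toFun_eq_one_of_const {X H : Type*} [TopologicalSpace X] [Group H]
    (Φ : PathCocycle X H) {x y : X} (p : Path x y) (h : ∀ t, p t = x) : Φ.toFun p = 1 := by
  obtain rfl : x = y := (h 1).symm.trans p.target
  rw [show p = Path.refl x from Path.ext (funext h), Φ.map_refl]

/-- Path cocycles are invariant under homotopies with fixed end points, the end points of the two
paths being propositionally equal only. -/
theorem PathCocycle.toFun_eq_of_homotopy {X H : Type*} [TopologicalSpace X] [Group H]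
    (Φ : PathCocycle X H) (g : C(I × I, X)) {x y x' y' : X} (p : Path x y) (p' : Path x' y')
    (hp : ∀ t, g (0, t) = p t) (hp' : ∀ t, g (1, t) = p' t)
    (h0 : ∀ s, g (s, 0) = x) (h1 : ∀ s, g (s, 1) = y) : Φ.toFun p = Φ.toFun p' := by
  have e0 : x = x' := (h0 1).symm.trans ((hp' 0).trans p'.source)
  have e1 : y = y' := (h1 1).symm.trans ((hp' 1).trans p'.target)
  have := Φ.map_square g p p' ((Path.refl x).cast rfl e0.symm) ((Path.refl y).cast rfl e1.symm)
    hp hp' h0 h1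
  rw [Φ.toFun_eq_one_of_const ((Path.refl x).cast rfl e0.symm) fun _ => rfl,
    Φ.toFun_eq_one_of_const ((Path.refl y).cast rfl e1.symm) fun _ => rfl, mul_one, one_mul] at this
  exact this.symm

theorem segmentPoint_ofReal_mul (s : I) (a b : ℝ) (z : ℂ) :
    segmentPoint s (a * z) (b * z) = (((1 - s) * a + s * b : ℝ) : ℂ) * z := by
  simp only [segmentPoint, Complex.real_smul]
  push_cast
  ring

/-- The point `r d` of the unit disc, for `r ∈ [0, 1]` and a unit complex number `d`. -/
noncomputable def discPoint (r : I) (d : Circle) : Metric.closedBall (0 : ℂ) 1 :=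
  ⟨(r : ℝ) * (d : ℂ), by
    rw [mem_closedBall_zero_iff, norm_mul, Circle.norm_coe, mul_one, Complex.norm_real,
      Real.norm_eq_abs, abs_of_nonneg r.2.1]
    exact r.2.2⟩

theorem continuous_discPoint (r : I) : Continuous (discPoint r) :=
  Continuous.subtype_mk (by fun_prop) _

theorem norm_discPoint (r : I) (d : Circle) : ‖(discPoint r d : ℂ)‖ = r := by
  rw [discPoint, norm_mul, Circle.norm_coe, mul_one, Complex.norm_real,
      Real.norm_eq_abs, abs_of_nonneg r.2.1]

/-- The radius `1/√2` of the two circles whose product is the torus `‖z₀‖ = ‖z₁‖`. -/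
noncomputable def torusRadius : I :=
  ⟨√(1 / 2), Real.sqrt_nonneg _, Real.sqrt_le_one.2 (by norm_num)⟩

theorem torusRadius_sq : (torusRadius : ℝ) ^ 2 = 1 / 2 := Real.sq_sqrt (by norm_num)

theorem half_lt_torusRadius : 1 / 2 < (torusRadius : ℝ) := by
  nlinarith [torusRadius_sq, torusRadius.2.1]

theorem torusRadius_lt : (torusRadius : ℝ) < 3 / 4 := by
  nlinarith [torusRadius_sq, torusRadius.2.1]

/-- The radius `4/5`. -/
noncomputable def fourFifths : I := ⟨4 / 5, by norm_num, by norm_num⟩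

/-- The point with the coordinates `d₀/√2` and `d₁/√2`. -/
noncomputable def torusPoint (d : Fin 2 → Circle) : S3 :=
  S3.polar 0 (discPoint torusRadius (d 0)) (d 1)

theorem torusPoint_coord (d : Fin 2 → Circle) (j : Fin 2) :
    (torusPoint d).1 j = (torusRadius : ℝ) * (d j : ℂ) := by
  fin_cases j
  · exact S3.polar_self 0 _ _
  · refine (S3.polar_other 0 _ _).trans ?_
    rw [norm_discPoint, torusRadius_sq, show (1 - 1 / 2 : ℝ) = 1 / 2 by norm_num]
    rfl

theorem polar_torusRadius (i : Fin 2) (d : Fin 2 → Circle) :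
    S3.polar i (discPoint torusRadius (d i)) (d (1 - i)) = torusPoint d := by
  refine S3.polar_eq_iff.2 ⟨(torusPoint_coord d i).symm, ?_⟩
  rw [torusPoint_coord, norm_mul, Circle.norm_coe, mul_one, Complex.norm_real, Real.norm_eq_abs,
    abs_of_nonneg torusRadius.2.1]

theorem continuous_torusPoint : Continuous torusPoint :=
  S3.continuous_polar 0 ((continuous_discPoint _).comp (continuous_apply 0)) (continuous_apply 1)

theorem circlePoint_eq_polar (i : Fin 2) (t : ℝ) : HopfLikeLink.circlePoint i t =
    S3.polar i (discPoint fourFifths 1) (Circle.exp (2 * Real.pi * t)) := by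
  refine (S3.polar_eq_iff.2 ⟨?_, ?_⟩).symm
  · rw [HopfLikeLink.circlePoint_self]
    simp [discPoint, fourFifths]
  · rw [HopfLikeLink.circlePoint_other, norm_mul, Complex.norm_exp_ofReal_mul_I, Circle.coe_exp]
    norm_num

/-- The part of the sphere between the balls `Re zᵢ > 4/5`, without the neighbourhoods of the
components of the Hopf link. -/
def middleRegion : Set S3 := {p | ∀ i, (p.1 i).re ≤ 4 / 5 ∧ 1 / 2 ≤ ‖p.1 i‖}

theorem mem_middleRegion_iff (i : Fin 2) {p : S3} : p ∈ middleRegion ↔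
    ((p.1 i).re ≤ 4 / 5 ∧ 1 / 2 ≤ ‖p.1 i‖) ∧
      ((p.1 (1 - i)).re ≤ 4 / 5 ∧ 1 / 2 ≤ ‖p.1 (1 - i)‖) := by
  refine ⟨fun h => ⟨h i, h _⟩, fun h j => ?_⟩
  by_cases hj : j = i
  · rw [hj]
    exact h.1
  · obtain rfl : j = 1 - i := by clear h; revert i j; decide
    exact h.2

theorem mem_middleRegion_of_re {i : Fin 2} {p : S3} (h1 : 3 / 4 ≤ (p.1 i).re)
    (h2 : (p.1 i).re ≤ 4 / 5) (h3 : ‖p.1 i‖ ^ 2 ≤ 3 / 4) : p ∈ middleRegion := by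
  refine (mem_middleRegion_iff i).2 ⟨⟨h2, ?_⟩, ?_, S3.half_le_norm_other h3⟩
  · have := (Complex.re_le_norm (p.1 i)).trans' h1
    linarith
  · exact (Complex.re_le_norm _).trans (S3.norm_other_lt h1).le

theorem Complex.direction_ofReal_mul {r : ℝ} (hr : 0 < r) (d : Circle) :
    Complex.direction (r * (d : ℂ)) = d := Complex.direction_eq hr rfl

theorem Complex.re_eq_norm_mul_direction (z : ℂ) :
    z.re = ‖z‖ * (Complex.direction z : ℂ).re := by
  conv_lhs => rw [← Complex.norm_mul_direction z]
  rw [Complex.re_ofReal_mul]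

theorem Complex.direction_re_pos {z : ℂ} (hz : 0 < z.re) : 0 < (Complex.direction z : ℂ).re := by
  rw [Complex.re_eq_norm_mul_direction] at hz
  exact pos_of_mul_pos_right hz (norm_nonneg z)

theorem S3.direction_polar (i : Fin 2) {u : Metric.closedBall (0 : ℂ) 1} (hu : ‖(u : ℂ)‖ < 1)
    (d : Circle) : Complex.direction ((S3.polar i u d).1 (1 - i)) = d := by
  rw [S3.polar_other]
  refine Complex.direction_ofReal_mul (Real.sqrt_pos.2 ?_) d
  nlinarith [norm_nonneg (u : ℂ)]

theorem Circle.re_le_one (d : Circle) : (d : ℂ).re ≤ 1 :=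
  (Complex.re_le_norm _).trans (Circle.norm_coe d).le

/-- The deformation of the middle region to the torus `‖z₀‖ = ‖z₁‖`, with fixed directions. -/
noncomputable def pushToTorus (s : I) (p : S3) : S3 :=
  S3.polar 0 (discSegment s (p.disc 0) (discPoint torusRadius (Complex.direction (p.1 0))))
    (Complex.direction (p.1 1))

theorem pushToTorus_zero (p : S3) : pushToTorus 0 p = p := by
  refine Eq.trans ?_ (S3.polar_disc_direction 0 p)
  rw [pushToTorus]
  congr 1
  exact Subtype.ext (segmentPoint_zero _ _)

theorem pushToTorus_one (p : S3) :
    pushToTorus 1 p = torusPoint fun j => Complex.direction (p.1 j) := by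
  rw [pushToTorus, torusPoint]
  congr 1
  exact Subtype.ext (segmentPoint_one _ _)

theorem pushToTorus_torusPoint (s : I) (d : Fin 2 → Circle) :
    pushToTorus s (torusPoint d) = torusPoint d := by
  have h : ∀ j, Complex.direction ((torusPoint d).1 j) = d j := fun j => by
    rw [torusPoint_coord]
    exact Complex.direction_ofReal_mul (half_lt_torusRadius.trans' (by norm_num)) _
  rw [pushToTorus, h, h]
  conv_rhs => rw [torusPoint]
  congr 1
  refine Subtype.ext ?_
  change segmentPoint s ((torusPoint d).1 0) _ = _
  rw [torusPoint_coord]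
  exact segmentPoint_self s _

theorem continuous_direction_coord {Y : Type*} [TopologicalSpace Y] {p : Y → S3}
    (hp : Continuous p) (hp' : ∀ y, p y ∈ middleRegion) (j : Fin 2) :
    Continuous fun y => Complex.direction ((p y).1 j) :=
  Complex.continuousOn_direction.comp_continuous ((S3.continuous_coord j).comp hp) fun y => by
    have h := (hp' y j).2
    rw [Set.mem_ofPred_eq, ← norm_pos_iff]
    linarith

theorem continuous_pushToTorus {Y : Type*} [TopologicalSpace Y] {s : Y → I} {p : Y → S3}
    (hs : Continuous s) (hp : Continuous p) (hp' : ∀ y, p y ∈ middleRegion) :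
    Continuous fun y => pushToTorus (s y) (p y) :=
  S3.continuous_polar 0 (continuous_discSegment hs ((S3.continuous_disc 0).comp hp)
    ((continuous_discPoint _).comp (continuous_direction_coord hp hp' 0)))
    (continuous_direction_coord hp hp' 1)

theorem pushToTorus_mem {p : S3} (hp : p ∈ middleRegion) (s : I) :
    pushToTorus s p ∈ middleRegion := by
  have h0 := hp 0
  have h1 := hp 1
  have hn := S3.norm_sq_add p 0
  change ‖p.1 0‖ ^ 2 + ‖p.1 1‖ ^ 2 = 1 at hn
  set r : ℝ := (1 - s) * ‖p.1 0‖ + s * (torusRadius : ℝ) with hr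
  have hs := s.2
  have ht := half_lt_torusRadius
  have ht' := torusRadius_lt
  have ht2 := torusRadius_sq
  have hz : (pushToTorus s p).1 0 = r * (Complex.direction (p.1 0) : ℂ) := by
    refine (S3.polar_self 0 _ _).trans ?_
    rw [hr, ← segmentPoint_ofReal_mul, Complex.norm_mul_direction]
    rfl
  have hr1 : 1 / 2 ≤ r := by nlinarith [hs.1, hs.2]
  have hnz : ‖(pushToTorus s p).1 0‖ = r := by
    rw [hz, norm_mul, Circle.norm_coe, mul_one, Complex.norm_real, Real.norm_eq_abs,
      abs_of_nonneg (by linarith)]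
  have hr2 : ‖(pushToTorus s p).1 0‖ ^ 2 ≤ 3 / 4 := by
    refine (congrArg (‖·‖ ^ 2) (S3.polar_self 0 _ _)).trans_le
      (norm_segmentPoint_sq_le (by norm_num) (S3.norm_other_sq_le (i := 0) h1.2) ?_ s)
    rw [norm_discPoint, ht2]
    norm_num
  have hn1 := S3.norm_sq_add (pushToTorus s p) 0
  change _ + ‖(pushToTorus s p).1 1‖ ^ 2 = 1 at hn1
  have hd : (pushToTorus s p).1 1 =
      ‖(pushToTorus s p).1 1‖ * (Complex.direction (p.1 1) : ℂ) :=
    (S3.polar_eq_iff (i := 0).1 rfl).2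
  have key : ∀ {a b c : ℝ}, 0 ≤ a → 0 ≤ c → c ≤ 1 → (a ≤ b ∨ a ≤ 4 / 5) → b * c ≤ 4 / 5 →
      a * c ≤ 4 / 5 := by
    rintro a b c ha hc hc' (h | h) hb
    · nlinarith
    · nlinarith
  refine (mem_middleRegion_iff 0).2 ⟨⟨?_, ?_⟩, ?_, S3.half_le_norm_other hr2⟩
  · refine (congrArg Complex.re (S3.polar_self 0 _ _)).trans_le
      (segmentPoint_mem (convex_halfSpace_re_le (4 / 5)) h0.1 ?_ s)
    refine (Complex.re_le_norm _).trans ?_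
    rw [norm_discPoint]
    linarith
  · rw [hnz]
    exact hr1
  · change ((pushToTorus s p).1 1).re ≤ _
    rw [hd, Complex.re_ofReal_mul]
    rcases le_total (Complex.direction (p.1 1) : ℂ).re 0 with hc | hc
    · nlinarith [norm_nonneg ((pushToTorus s p).1 1)]
    · refine key (b := ‖p.1 1‖) (norm_nonneg _) hc (Circle.re_le_one _) ?_ ?_
      · rcases le_total ‖p.1 0‖ (torusRadius : ℝ) with h | h
        · left
          have : ‖p.1 0‖ ≤ r := by nlinarith [hs.1, hs.2]
          refine (sq_le_sq₀ (norm_nonneg _) (norm_nonneg _)).1 ?_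
          rw [hnz] at hn1
          nlinarith [norm_nonneg (p.1 0)]
        · right
          have : (torusRadius : ℝ) ≤ r := by nlinarith [hs.1, hs.2]
          nlinarith [norm_nonneg ((pushToTorus s p).1 1)]
      · rw [← Complex.re_eq_norm_mul_direction]
        exact h1.1

end Middle

/-! ### Collars of the torus and the parts of the link exterior -/

section Pieces

open scoped unitInterval

theorem PathCocycle.toFun_cast {X H : Type*} [TopologicalSpace X] [Group H] (Φ : PathCocycle X H)
    {x y x' y' : X} (p : Path x y) (hx : x' = x) (hy : y' = y) :
    Φ.toFun (p.cast hx hy) = Φ.toFun p := by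
  subst hx hy
  rfl

/-- The straight path from the origin to `v`. -/
noncomputable def Path.toVector {E : Type*} [AddCommGroup E] [Module ℝ E] [TopologicalSpace E]
    [ContinuousSMul ℝ E] (v : E) : Path 0 v where
  toFun t := (t : ℝ) • v
  continuous_toFun := by fun_prop
  source' := by simp
  target' := by simp

/-- The points with positive coordinate `zᵢ` in `[1/√2, 4/5]` and `z₁₋ᵢ` of direction `d`. -/
noncomputable def collarPoint (i : Fin 2) (s : I) (d : Circle) : S3 :=
  S3.polar i (discSegment s (discPoint torusRadius 1) (discPoint fourFifths 1)) d

theorem continuous_collarPoint {Y : Type*} [TopologicalSpace Y] (i : Fin 2) {s : Y → I}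
    {d : Y → Circle} (hs : Continuous s) (hd : Continuous d) :
    Continuous fun y => collarPoint i (s y) (d y) :=
  S3.continuous_polar i (continuous_discSegment hs continuous_const continuous_const) hd

theorem collarPoint_coord (i : Fin 2) (s : I) (d : Circle) :
    (collarPoint i s d).1 i = (((1 - s) * torusRadius + s * (4 / 5) : ℝ) : ℂ) := by
  refine (S3.polar_self i _ _).trans ?_
  refine (segmentPoint_ofReal_mul s torusRadius (4 / 5) 1).trans ?_
  rw [mul_one]

theorem collarPoint_coord_bounds (s : I) : 1 / 2 < (1 - s) * torusRadius + s * (4 / 5 : ℝ) ∧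
    (1 - s) * torusRadius + s * (4 / 5 : ℝ) ≤ 4 / 5 ∧
    1 / 2 ≤ ((1 - s) * torusRadius + s * (4 / 5 : ℝ)) ^ 2 := by
  have hs := s.2
  have ht := half_lt_torusRadius
  have ht' := torusRadius_lt
  have ht2 := torusRadius_sq
  have h : (torusRadius : ℝ) ≤ (1 - s) * torusRadius + s * (4 / 5 : ℝ) := by
    nlinarith [hs.1, hs.2]
  refine ⟨by linarith, by nlinarith [hs.1, hs.2], ?_⟩
  rw [← ht2]
  exact pow_le_pow_left₀ (by linarith) h 2

theorem norm_collarPoint_coord (i : Fin 2) (s : I) (d : Circle) :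
    ‖(collarPoint i s d).1 i‖ = (1 - s) * torusRadius + s * (4 / 5 : ℝ) := by
  rw [collarPoint_coord, Complex.norm_real, Real.norm_eq_abs,
    abs_of_pos ((collarPoint_coord_bounds s).1.trans' (by norm_num))]

theorem collarPoint_mem (i : Fin 2) (s : I) (d : Circle) :
    collarPoint i s d ∈ middleRegion := by
  obtain ⟨h1, h2, h3⟩ := collarPoint_coord_bounds s
  have hn := norm_collarPoint_coord i s d
  have hn2 := S3.norm_sq_add (collarPoint i s d) i
  rw [hn] at hn2
  refine (mem_middleRegion_iff i).2 ⟨⟨?_, ?_⟩, ?_, S3.half_le_norm_other ?_⟩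
  · rw [collarPoint_coord, Complex.ofReal_re]
    exact h2
  · rw [hn]
    exact h1.le
  · refine (Complex.re_le_norm _).trans ?_
    nlinarith [norm_nonneg ((collarPoint i s d).1 (1 - i))]
  · rw [hn]
    nlinarith

theorem collarPoint_zero (i : Fin 2) (d : Fin 2 → Circle) (hd : d i = 1) :
    collarPoint i 0 (d (1 - i)) = torusPoint d := by
  rw [← polar_torusRadius i, collarPoint, hd]
  congr 1
  exact Subtype.ext (segmentPoint_zero _ _)

theorem collarPoint_one (i : Fin 2) (t : ℝ) :
    collarPoint i 1 (Circle.exp (2 * Real.pi * t)) = HopfLikeLink.circlePoint i t := by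
  rw [circlePoint_eq_polar, collarPoint]
  congr 1
  exact Subtype.ext (segmentPoint_one _ _)

theorem direction_collarPoint (i j : Fin 2) (s : I) :
    Complex.direction ((collarPoint i s 1).1 j) = 1 := by
  obtain ⟨h1, h2, h3⟩ := collarPoint_coord_bounds s
  by_cases hj : j = i
  · rw [hj, collarPoint_coord]
    refine Complex.direction_eq (r := (1 - s) * torusRadius + s * (4 / 5 : ℝ)) (by linarith) ?_
    rw [Circle.coe_one, mul_one]
  · obtain rfl : j = 1 - i := by clear h1 h2 h3; revert i j; decide
    refine S3.direction_polar i ?_ 1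
    rw [← S3.polar_self i _ 1]
    exact (norm_collarPoint_coord i s 1).trans_lt (by linarith)

theorem torusPoint_mem (d : Fin 2 → Circle) : torusPoint d ∈ middleRegion := by
  intro j
  have ht := half_lt_torusRadius
  have ht' := torusRadius_lt
  have : ‖(torusPoint d).1 j‖ = torusRadius := by
    rw [torusPoint_coord, norm_mul, Circle.norm_coe, mul_one, Complex.norm_real, Real.norm_eq_abs,
      abs_of_nonneg torusRadius.2.1]
  refine ⟨(Complex.re_le_norm _).trans ?_, ?_⟩ <;> rw [this] <;> linarith

/-- The deformation of the part `3/4 ≤ Re zᵢ ≤ 4/5` of the middle region to the circle `zᵢ = 4/5`,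
with fixed direction of `z₁₋ᵢ`. -/
noncomputable def pushToCircle (i : Fin 2) (s : I) (p : S3) : S3 :=
  S3.polar i (discSegment s (p.disc i) (discPoint fourFifths 1)) (Complex.direction (p.1 (1 - i)))

theorem pushToCircle_zero (i : Fin 2) (p : S3) : pushToCircle i 0 p = p := by
  refine Eq.trans ?_ (S3.polar_disc_direction i p)
  rw [pushToCircle]
  congr 1
  exact Subtype.ext (segmentPoint_zero _ _)

theorem pushToCircle_one (i : Fin 2) (p : S3) : pushToCircle i 1 p =
    S3.polar i (discPoint fourFifths 1) (Complex.direction (p.1 (1 - i))) := by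
  rw [pushToCircle]
  congr 1
  exact Subtype.ext (segmentPoint_one _ _)

theorem norm_fourFifths_lt : ‖(discPoint fourFifths 1 : ℂ)‖ < 1 := by
  rw [norm_discPoint]
  change (4 / 5 : ℝ) < 1
  norm_num

theorem pushToCircle_polar (i : Fin 2) (s : I) (d : Circle) :
    pushToCircle i s (S3.polar i (discPoint fourFifths 1) d) =
      S3.polar i (discPoint fourFifths 1) d := by
  rw [pushToCircle, S3.direction_polar i norm_fourFifths_lt]
  congr 1
  refine Subtype.ext ?_
  change segmentPoint s ((S3.polar i _ d).1 i) _ = _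
  rw [S3.polar_self, segmentPoint_self]

theorem continuous_pushToCircle (i : Fin 2) {Y : Type*} [TopologicalSpace Y] {s : Y → I}
    {p : Y → S3} (hs : Continuous s) (hp : Continuous p) (hp' : ∀ y, p y ∈ middleRegion) :
    Continuous fun y => pushToCircle i (s y) (p y) :=
  S3.continuous_polar i (continuous_discSegment hs ((S3.continuous_disc i).comp hp)
    continuous_const) (continuous_direction_coord hp hp' (1 - i))

theorem pushToCircle_mem {i : Fin 2} {p : S3} (hp : p ∈ middleRegion) (h : 3 / 4 < (p.1 i).re)
    (s : I) : 3 / 4 < ((pushToCircle i s p).1 i).re ∧ pushToCircle i s p ∈ middleRegion := by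
  have h4 : (discPoint fourFifths 1 : ℂ) = ((4 / 5 : ℝ) : ℂ) := mul_one _
  have hc : (pushToCircle i s p).1 i = segmentPoint s (p.1 i) ((4 / 5 : ℝ) : ℂ) := by
    rw [← h4]
    exact S3.polar_self i _ _
  have h1 : 3 / 4 < ((pushToCircle i s p).1 i).re := by
    rw [hc]
    refine segmentPoint_mem (convex_halfSpace_re_gt (3 / 4)) h ?_ s
    change (3 / 4 : ℝ) < ((4 / 5 : ℝ) : ℂ).re
    rw [Complex.ofReal_re]
    norm_num
  refine ⟨h1, mem_middleRegion_of_re h1.le ?_ ?_⟩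
  · rw [hc]
    exact segmentPoint_mem (convex_halfSpace_re_le (4 / 5)) (hp i).1
      (Complex.ofReal_re (4 / 5)).le s
  · rw [hc]
    refine norm_segmentPoint_sq_le (by norm_num) (S3.norm_other_sq_le (hp _).2) ?_ s
    rw [Complex.norm_real]
    norm_num

theorem polar_fourFifths_mem (i : Fin 2) (d : Circle) :
    3 / 4 < ((S3.polar i (discPoint fourFifths 1) d).1 i).re ∧
      S3.polar i (discPoint fourFifths 1) d ∈ middleRegion := by
  have h4 : (S3.polar i (discPoint fourFifths 1) d).1 i = ((4 / 5 : ℝ) : ℂ) :=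
    (S3.polar_self i _ _).trans (mul_one _)
  have h1 : 3 / 4 < ((S3.polar i (discPoint fourFifths 1) d).1 i).re := by
    rw [h4, Complex.ofReal_re]
    norm_num
  refine ⟨h1, mem_middleRegion_of_re h1.le ?_ ?_⟩
  · rw [h4, Complex.ofReal_re]
  · rw [h4, Complex.norm_real]
    norm_num

namespace HopfLikeLink

variable (L : HopfLikeLink)

theorem apply_mem_exterior {p : S3} (hp : p ∈ middleRegion) : L.h p ∈ L.exterior :=
  (L.mem_exterior_iff 0).2 ⟨(L.apply_mem_knot_exterior_iff (hp 0).1).2 (hp 1).2,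
    (L.apply_mem_knot_exterior_iff (hp 1).1).2 (hp 0).2⟩

/-- The point of the link exterior that corresponds to a point of the middle region. -/
noncomputable def point {p : S3} (hp : p ∈ middleRegion) : L.exterior := ⟨L.h p, L.apply_mem_exterior hp⟩

theorem continuous_point {Y : Type*} [TopologicalSpace Y] {p : Y → S3} (hp : Continuous p)
    (hp' : ∀ y, p y ∈ middleRegion) : Continuous fun y => L.point (hp' y) :=
  Continuous.subtype_mk (L.h.continuous.comp hp) _

theorem point_congr {p q : S3} (h : p = q) (hp : p ∈ middleRegion) (hq : q ∈ middleRegion) :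
    L.point hp = L.point hq := by
  subst h
  rfl

/-- The part of the link exterior outside of the open balls `Re zᵢ > 4/5`. -/
def middle : Set L.exterior := {x | L.h.symm x ∈ middleRegion}

/-- The part of the link exterior outside of the closed balls `Re zᵢ ≥ 4/5`. -/
def waist : Set L.exterior := {x | ∀ i, ((L.h.symm x).1 i).re < 4 / 5}

theorem continuous_symm_coord (i : Fin 2) : Continuous fun x : L.exterior => (L.h.symm x).1 i :=
  (S3.continuous_coord i).comp (L.h.symm.continuous.comp continuous_subtype_val)

theorem isOpen_waist : IsOpen L.waist := by
  have : L.waist = ⋂ i, {x : L.exterior | ((L.h.symm x).1 i).re < 4 / 5} := by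
    ext x
    refine ⟨fun h => Set.mem_iInter.2 h, fun h i => ?_⟩
    have h' := Set.mem_iInter.1 h i
    exact h'
  rw [this]
  exact isOpen_iInter_of_finite fun i =>
    isOpen_lt (Complex.continuous_re.comp (L.continuous_symm_coord i)) continuous_const

theorem waist_subset_middle : L.waist ⊆ L.middle := fun x hx i => by
  refine ⟨(hx i).le, ?_⟩
  have h := L.mem_knot_exterior_of_mem x.2 (1 - i)
  rw [← L.h.apply_symm_apply x, L.apply_mem_knot_exterior_iff (hx _).le, sub_sub_cancel] at h
  exact h

theorem mem_waist_or_cap (x : L.exterior) : x ∈ L.waist ∨ ∃ i, x ∈ L.cap i := by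
  by_cases h : x ∈ L.waist
  · exact Or.inl h
  · obtain ⟨i, hi⟩ := not_forall.1 h
    exact Or.inr ⟨i, (not_lt.1 hi).trans_lt' (by norm_num)⟩

theorem disjoint_cap (i j : Fin 2) (hij : i ≠ j) : Disjoint (L.cap i) (L.cap j) := by
  rw [Set.disjoint_left]
  intro x hi hj
  obtain rfl : j = 1 - i := by clear hi hj; revert i j; decide
  have h1 := S3.norm_other_lt (le_of_lt hi)
  have h2 := (Complex.re_le_norm _).trans' (le_of_lt hj)
  have h3 := S3.norm_sq_add (L.h.symm x) i
  have h4 := (Complex.re_le_norm _).trans' (le_of_lt hi)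
  nlinarith

theorem point_mem_middle {p : S3} (hp : p ∈ middleRegion) : L.point hp ∈ L.middle := by
  change L.h.symm (L.h p) ∈ middleRegion
  rwa [L.h.symm_apply_apply]

theorem point_mem_cap {i : Fin 2} {p : S3} (hp : p ∈ middleRegion) (h : 3 / 4 < (p.1 i).re) :
    L.point hp ∈ L.cap i := by
  change 3 / 4 < ((L.h.symm (L.h p)).1 i).re
  rwa [L.h.symm_apply_apply]

/-- The parametrization of the torus `‖z₀‖ = ‖z₁‖` in the link exterior by the arguments. -/
noncomputable def torusMap : C(Fin 2 → ℝ, L.exterior) :=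
  ⟨fun x => L.point (torusPoint_mem fun j => Circle.exp (x j)),
    L.continuous_point (continuous_torusPoint.comp (by fun_prop)) _⟩

/-- A base point on the torus `‖z₀‖ = ‖z₁‖`. -/
noncomputable def torusBase : L.exterior := L.point (torusPoint_mem fun _ => 1)

theorem torusMap_zero : L.torusMap 0 = L.torusBase :=
  L.point_congr (congrArg torusPoint (funext fun _ => Circle.exp_zero)) (torusPoint_mem _) (torusPoint_mem _)

theorem torusBase_mem_middle : L.torusBase ∈ L.middle :=
  L.point_mem_middle (torusPoint_mem _)

/-- The base point of `Pᵢ`, as a point of the link exterior. -/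
noncomputable def capBase (i : Fin 2) : L.exterior := L.pieceToLink i (L.pieceBase i)

theorem circlePoint_mem (i : Fin 2) (t : ℝ) : circlePoint i t ∈ middleRegion := by
  rw [circlePoint_eq_polar]
  exact (polar_fourFifths_mem i _).2

theorem lt_re_circlePoint (i : Fin 2) (t : ℝ) : 3 / 4 < ((circlePoint i t).1 i).re := by
  rw [circlePoint_eq_polar]
  exact (polar_fourFifths_mem i _).1

theorem capBase_mem_middle (i : Fin 2) : L.capBase i ∈ L.middle :=
  L.point_mem_middle (circlePoint_mem i 0)

theorem capBase_mem_cap (i : Fin 2) : L.capBase i ∈ L.cap i :=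
  L.point_mem_cap (circlePoint_mem i 0) (lt_re_circlePoint i 0)

/-- The path from the torus `‖z₀‖ = ‖z₁‖` to the base point of `Pᵢ`, along which `z₀` and `z₁` are
positive real numbers. -/
noncomputable def arc (i : Fin 2) : Path (⟨L.torusBase, L.torusBase_mem_middle⟩ : L.middle)
    ⟨L.capBase i, L.capBase_mem_middle i⟩ where
  toFun s := ⟨L.point (collarPoint_mem i s 1), L.point_mem_middle _⟩
  continuous_toFun := Continuous.subtype_mk
    (L.continuous_point (continuous_collarPoint i continuous_id continuous_const)
      fun s => collarPoint_mem i s 1) _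
  source' := by
    have h : collarPoint i 0 1 = torusPoint fun _ => 1 :=
      collarPoint_zero i (fun _ => 1) rfl
    exact Subtype.ext (L.point_congr h (collarPoint_mem i 0 1) (torusPoint_mem _))
  target' := by
    have h : collarPoint i 1 1 = circlePoint i 0 := by
      rw [← collarPoint_one]
      simp
    exact Subtype.ext (L.point_congr h (collarPoint_mem i 1 1) (circlePoint_mem i 0))

/-- The direction of a coordinate on the middle part of the link exterior. -/
noncomputable def dir (j : Fin 2) : C(L.middle, Circle) :=
  ⟨fun x => Complex.direction ((L.h.symm x).1 j), continuous_direction_coord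
    (L.h.symm.continuous.comp (continuous_subtype_val.comp continuous_subtype_val))
    (fun x => x.2) j⟩

theorem dir_point {p : S3} (hp : p ∈ middleRegion) (j : Fin 2) :
    L.dir j ⟨L.point hp, L.point_mem_middle hp⟩ = Complex.direction (p.1 j) := by
  change Complex.direction ((L.h.symm (L.h p)).1 j) = _
  rw [L.h.symm_apply_apply]

theorem dir_torusBase (j : Fin 2) : L.dir j ⟨L.torusBase, L.torusBase_mem_middle⟩ = 1 := by
  refine (L.dir_point (torusPoint_mem _) j).trans ?_
  rw [← collarPoint_zero j _ rfl]
  exact direction_collarPoint j j 0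

theorem dir_arc (i j : Fin 2) (s : I) : L.dir j (L.arc i s) = 1 :=
  (L.dir_point (collarPoint_mem i s 1) j).trans (direction_collarPoint i j s)

/-- The meridian as a loop in the link exterior. -/
noncomputable def linkMeridian (i : Fin 2) : Path (L.capBase i) (L.capBase i) :=
  (L.meridianLoop i).map (L.pieceToLink i).continuous

/-- The meridian as a loop in the open ball `Re zᵢ > 3/4`. -/
noncomputable def capMeridian (i : Fin 2) :
    Path (⟨L.capBase i, L.capBase_mem_cap i⟩ : L.cap i) ⟨L.capBase i, L.capBase_mem_cap i⟩ :=
  (L.meridianLoop i).map (L.pieceToCap i).continuous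

end HopfLikeLink

end Pieces

/-! ### Path cocycles on the torus and the collars -/

section Gluing

open scoped unitInterval

theorem Multiplicative.hom_int_apply {H : Type*} [Group H] (Θ : Multiplicative ℤ →* H)
    (a : Multiplicative ℤ) : Θ a = Θ (Multiplicative.ofAdd 1) ^ a.toAdd := by
  rw [← map_zpow, ← ofAdd_zsmul]
  simp

/-- The path cocycle `h ^ N(c)` that comes from a winding number `N` and an element `h`. -/
noncomputable def PathCocycle.zpow {X H : Type*} [TopologicalSpace X] [Group H]
    (N : PathCocycle X (Multiplicative ℤ)) (h : H) : PathCocycle X H :=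
  N.mapHom (zpowersHom H h)

/-- The product of two path cocycles whose values commute. -/
def PathCocycle.mulOfCommute {X H : Type*} [TopologicalSpace X] [Group H] (φ φ' : PathCocycle X H)
    (h : ∀ {x y x' y' : X} (p : Path x y) (p' : Path x' y'), Commute (φ.toFun p) (φ'.toFun p')) :
    PathCocycle X H where
  toFun p := φ.toFun p * φ'.toFun p
  map_trans p q := by
    rw [φ.map_trans, φ'.map_trans, mul_assoc, mul_assoc, ← mul_assoc _ (φ'.toFun q),
      (h p q).eq, mul_assoc]
  map_homotopic hpq := by rw [φ.map_homotopic hpq, φ'.map_homotopic hpq]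

namespace HopfLikeLink

variable (L : HopfLikeLink)

/-- The period lattice of the torus. -/
noncomputable def periodLattice : (Fin 2 → ℤ) →+ (Fin 2 → ℝ) where
  toFun a := fun j => a j * (2 * Real.pi)
  map_zero' := by
    ext
    simp
  map_add' a b := by
    ext
    simp [add_mul]

theorem exp_add_period (x : ℝ) (n : ℤ) :
    Circle.exp (x + n * (2 * Real.pi)) = Circle.exp x := Circle.exp_eq_exp.2 ⟨n, rfl⟩

theorem torusMap_add_period (a : Fin 2 → ℤ) (x : Fin 2 → ℝ) :
    L.torusMap (x + periodLattice a) = L.torusMap x :=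
  L.point_congr (congrArg torusPoint (funext fun j => exp_add_period (x j) (a j)))
    (torusPoint_mem _) (torusPoint_mem _)

/-- The winding number of the `j`-th coordinate along the paths in the middle part. -/
noncomputable def windingCocycle (j : Fin 2) : PathCocycle L.middle (Multiplicative ℤ) :=
  Circle.winding.comap (L.dir j)

theorem windingCocycle_arc (i j : Fin 2) : (L.windingCocycle j).toFun (L.arc i) = 1 :=
  Circle.winding_eq_one _ fun t => by
    change 0 < (L.dir j (L.arc i t) : ℂ).re
    rw [dir_arc]
    simp

/-- The values of a path cocycle on the loops in the middle part of the link exterior: they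
are given by a homomorphism on the fundamental group `ℤ²` of the torus. -/
theorem exists_torusHom {H : Type*} [Group H] (Φ : PathCocycle L.exterior H) :
    ∃ Θ : Multiplicative (Fin 2 → ℤ) →* H,
      (∀ c : Path (⟨L.torusBase, L.torusBase_mem_middle⟩ : L.middle)
          ⟨L.torusBase, L.torusBase_mem_middle⟩, (Φ.restrict L.middle).toFun c =
        Θ (Multiplicative.ofAdd fun j => ((L.windingCocycle j).toFun c).toAdd)) ∧
      ∀ i, Θ (Multiplicative.ofAdd (Pi.single (1 - i) 1)) =
        ((Φ.restrict L.middle).toFun (L.arc i))⁻¹ * Φ.toFun (L.linkMeridian i) *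
          (Φ.restrict L.middle).toFun (L.arc i) := by
  obtain ⟨Θ, hΘ⟩ := Φ.exists_periodHom L.torusMap periodLattice L.torusMap_add_period
  refine ⟨Θ, fun c => ?_, fun i => ?_⟩
  · have hlift : ∀ j, ∃ θ : Path (0 : ℝ)
        ((((L.windingCocycle j).toFun c).toAdd : ℤ) * (2 * Real.pi)),
        ∀ t, Circle.exp (θ t) = L.dir j (c t) := fun j => by
      have h := Circle.exists_path_lift_loop ((c.map (L.dir j).continuous).cast
        (L.dir_torusBase j).symm (L.dir_torusBase j).symm)
      rwa [Circle.winding.toFun_cast] at h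
    choose θ hθ using hlift
    have hc : ∀ t, L.h.symm (c t).1 ∈ middleRegion := fun t => (c t).2
    let G : C(I × I, L.exterior) := ⟨fun x => L.point (pushToTorus_mem (hc x.2) x.1),
      L.continuous_point (continuous_pushToTorus continuous_fst
        (L.h.symm.continuous.comp (continuous_subtype_val.comp (continuous_subtype_val.comp
          (c.continuous.comp continuous_snd)))) fun x => hc x.2) _⟩
    have hG : ∀ s t, L.h.symm (c t).1 = torusPoint (fun _ => 1) → G (s, t) = L.torusBase := by
      intro s t h
      refine L.point_congr ?_ (pushToTorus_mem (hc t) s) (torusPoint_mem _)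
      rw [h, pushToTorus_torusPoint]
    have hbase : L.h.symm L.torusBase = torusPoint (fun _ => 1) := L.h.symm_apply_apply _
    rw [← hΘ _ (Path.pi θ)]
    refine Φ.toFun_eq_of_homotopy G c.ofSubset _ (fun t => ?_) (fun t => ?_) (fun s => ?_)
      fun s => ?_
    · refine Subtype.ext ?_
      change L.h (pushToTorus 0 (L.h.symm (c t).1)) = (c t).1
      rw [pushToTorus_zero, L.h.apply_symm_apply]
    · refine L.point_congr ?_ (pushToTorus_mem (hc t) 1) (torusPoint_mem _)
      rw [pushToTorus_one]
      exact congrArg torusPoint (funext fun j => (hθ j t).symm)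
    · refine hG s 0 ?_
      rw [c.source]
      exact hbase
    · refine hG s 1 ?_
      rw [c.target]
      exact hbase
  · rw [← hΘ _ (Path.toVector _)]
    have hm : L.torusMap (periodLattice (Pi.single (1 - i) 1)) = L.torusBase := by
      rw [← zero_add (periodLattice _), L.torusMap_add_period, L.torusMap_zero]
    let p : Path L.torusBase L.torusBase := ((Path.toVector
      (periodLattice (Pi.single (1 - i) 1))).map L.torusMap.continuous).cast
        L.torusMap_zero.symm hm.symm
    let G : C(I × I, L.exterior) :=
      ⟨fun x => L.point (collarPoint_mem i x.1 (Circle.exp (2 * Real.pi * x.2))),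
        L.continuous_point (continuous_collarPoint i continuous_fst (by fun_prop)) _⟩
    have hG := Φ.map_square G p (L.linkMeridian i) (L.arc i).ofSubset (L.arc i).ofSubset
      (fun t => ?_) (fun t => ?_) (fun s => ?_) (fun s => ?_)
    · change _ = (Φ.toFun (L.arc i).ofSubset)⁻¹ * _ * Φ.toFun (L.arc i).ofSubset
      rw [mul_assoc, hG, inv_mul_cancel_left, Φ.toFun_cast]
    · refine L.point_congr ?_ (collarPoint_mem i 0 _) (torusPoint_mem _)
      refine Eq.trans ?_ (collarPoint_zero i (fun j => Circle.exp
        (((t : ℝ) • periodLattice (Pi.single (1 - i) 1)) j)) ?_)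
      · refine congrArg (collarPoint i 0) (congrArg Circle.exp ?_)
        simp [periodLattice, mul_comm]
      · have hi : i ≠ 1 - i := by
          fin_cases i <;> decide
        simp [periodLattice, Pi.single_eq_of_ne hi]
    · refine L.point_congr (collarPoint_one i t) (collarPoint_mem i 1 _) (circlePoint_mem i t)
    · refine L.point_congr ?_ (collarPoint_mem i s _) (collarPoint_mem i s 1)
      simp
    · refine L.point_congr ?_ (collarPoint_mem i s _) (collarPoint_mem i s 1)
      simp

/-- The values of a path cocycle on the loops in the overlap of the ball `Re zᵢ > 3/4` with the
middle part of the link exterior: they depend on the winding number of `z₁₋ᵢ` only. -/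
theorem exists_collarHom {H : Type*} [Group H] (i : Fin 2) (Φ : PathCocycle (L.cap i) H) :
    ∃ Θ : Multiplicative ℤ →* H,
      (∀ c : Path (⟨L.capBase i, L.capBase_mem_cap i, L.capBase_mem_middle i⟩ :
          ↥(L.cap i ∩ L.middle)) ⟨L.capBase i, L.capBase_mem_cap i, L.capBase_mem_middle i⟩,
        Φ.toFun (c.toSuperset Set.inter_subset_left) =
          Θ ((L.windingCocycle (1 - i)).toFun (c.toSuperset Set.inter_subset_right))) ∧
      Θ (Multiplicative.ofAdd 1) = Φ.toFun (L.capMeridian i) := by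
  let ψ : C(ℝ, L.cap i) := ⟨fun t => ⟨L.point (polar_fourFifths_mem i (Circle.exp t)).2,
    L.point_mem_cap (polar_fourFifths_mem i _).2 (polar_fourFifths_mem i _).1⟩,
    Continuous.subtype_mk (L.continuous_point (S3.continuous_polar i continuous_const
      Circle.exp.continuous) _) _⟩
  let l : ℤ →+ ℝ :=
    { toFun := fun n => n * (2 * Real.pi)
      map_zero' := by simp
      map_add' := fun a b => by simp [add_mul] }
  obtain ⟨Θ, hΘ⟩ := Φ.exists_periodHom ψ l fun n x => Subtype.ext
    (L.point_congr (congrArg (S3.polar i (discPoint fourFifths 1)) (exp_add_period x n))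
      (polar_fourFifths_mem i _).2 (polar_fourFifths_mem i _).2)
  have h4 : circlePoint i 0 = S3.polar i (discPoint fourFifths 1) 1 := by
    rw [circlePoint_eq_polar, mul_zero, Circle.exp_zero]
  have hψ : ∀ t, Circle.exp t = 1 → ψ t = ⟨L.capBase i, L.capBase_mem_cap i⟩ := fun t ht =>
    Subtype.ext (L.point_congr (by rw [ht, h4]) (polar_fourFifths_mem i _).2
      (circlePoint_mem i 0))
  refine ⟨Θ, fun c => ?_, ?_⟩
  · have hdir : L.dir (1 - i) ⟨L.capBase i, L.capBase_mem_middle i⟩ = 1 := by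
      refine (L.dir_point (circlePoint_mem i 0) (1 - i)).trans ?_
      rw [h4]
      exact S3.direction_polar i norm_fourFifths_lt 1
    have hlift := Circle.exists_path_lift_loop
      (((c.toSuperset Set.inter_subset_right).map (L.dir (1 - i)).continuous).cast
        hdir.symm hdir.symm)
    rw [Circle.winding.toFun_cast] at hlift
    obtain ⟨θ, hθ⟩ := hlift
    have hc : ∀ t, L.h.symm (c t).1 ∈ middleRegion := fun t => (c t).2.2
    have hc' : ∀ t, 3 / 4 < ((L.h.symm (c t).1).1 i).re := fun t => (c t).2.1
    let G : C(I × I, L.cap i) := ⟨fun x => ⟨L.point (pushToCircle_mem (hc x.2) (hc' x.2) x.1).2,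
      L.point_mem_cap (pushToCircle_mem (hc x.2) (hc' x.2) x.1).2
        (pushToCircle_mem (hc x.2) (hc' x.2) x.1).1⟩,
      Continuous.subtype_mk (L.continuous_point (continuous_pushToCircle i continuous_fst
        (L.h.symm.continuous.comp (continuous_subtype_val.comp (continuous_subtype_val.comp
          (c.continuous.comp continuous_snd)))) fun x => hc x.2) _) _⟩
    have hG : ∀ s t, L.h.symm (c t).1 = circlePoint i 0 →
        G (s, t) = ⟨L.capBase i, L.capBase_mem_cap i⟩ := by
      intro s t h
      refine Subtype.ext (L.point_congr ?_ (pushToCircle_mem (hc t) (hc' t) s).2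
        (circlePoint_mem i 0))
      rw [h, h4, pushToCircle_polar]
    have hbase : L.h.symm (L.capBase i) = circlePoint i 0 := L.h.symm_apply_apply _
    refine Eq.trans ?_ (hΘ _ θ)
    refine (Φ.toFun_eq_of_homotopy G _ ((θ.map ψ.continuous).cast (hψ 0 ?_).symm
      (hψ _ ?_).symm) (fun t => ?_) (fun t => ?_) (fun s => ?_) fun s => ?_).trans
        (Φ.toFun_cast _ _ _)
    · rw [Circle.exp_zero]
    · rw [← zero_add (_ * _), exp_add_period, Circle.exp_zero]
    · refine Subtype.ext (Subtype.ext ?_)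
      change L.h (pushToCircle i 0 (L.h.symm (c t).1)) = (c t).1
      rw [pushToCircle_zero, L.h.apply_symm_apply]
    · refine Subtype.ext (L.point_congr ?_ (pushToCircle_mem (hc t) (hc' t) 1).2
        (polar_fourFifths_mem i _).2)
      rw [pushToCircle_one]
      exact congrArg (S3.polar i (discPoint fourFifths 1)) (hθ t).symm
    · refine hG s 0 ?_
      rw [c.source]
      exact hbase
    · refine hG s 1 ?_
      rw [c.target]
      exact hbase
  · rw [← hΘ 1 (Path.toVector _), ← Φ.toFun_cast (L.capMeridian i) (hψ 0 Circle.exp_zero)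
      (hψ (l 1) (by simp [l]))]
    refine congrArg Φ.toFun (Path.ext (funext fun t => Subtype.ext ?_))
    refine L.point_congr ?_ (polar_fourFifths_mem i _).2 (circlePoint_mem i t)
    rw [circlePoint_eq_polar]
    refine congrArg (S3.polar i (discPoint fourFifths 1)) (congrArg Circle.exp ?_)
    change (t : ℝ) * (((1 : ℤ) : ℝ) * (2 * Real.pi)) = 2 * Real.pi * t
    push_cast
    ring

end HopfLikeLink

end Gluing

/-! ### The link group as a pushout -/

section VanKampen

open scoped unitInterval

/-- The transport of a pushout with commuting elements along isomorphisms. -/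
theorem IsCommutingPushout.congr {G G' G₀ G₁ P₀ P₁ : Type*} [Group G] [Group G'] [Group G₀]
    [Group G₁] [Group P₀] [Group P₁] {j₀ : G₀ →* G} {j₁ : G₁ →* G} {m₀ : P₀} {m₁ : P₁}
    (e₀ : P₀ ≃* G₀) (e₁ : P₁ ≃* G₁) (e : G ≃* G')
    (h : IsCommutingPushout.{u} j₀ j₁ (e₀ m₀) (e₁ m₁)) :
    IsCommutingPushout.{u} ((e.toMonoidHom.comp j₀).comp e₀.toMonoidHom)
      ((e.toMonoidHom.comp j₁).comp e₁.toMonoidHom) m₀ m₁ where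
  commute := h.commute.map e
  exists_hom H _ f₀ f₁ hf := by
    obtain ⟨f, h₀, h₁⟩ := h.exists_hom H (f₀.comp e₀.symm.toMonoidHom)
      (f₁.comp e₁.symm.toMonoidHom) (by simpa using hf)
    refine ⟨f.comp e.symm.toMonoidHom, MonoidHom.ext fun x => ?_, MonoidHom.ext fun x => ?_⟩
    · simpa using DFunLike.congr_fun h₀ (e₀ x)
    · simpa using DFunLike.congr_fun h₁ (e₁ x)
  hom_ext H _ f f' h₀ h₁ := by
    have := h.hom_ext H (f.comp e.toMonoidHom) (f'.comp e.toMonoidHom)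
      (MonoidHom.ext fun x => by simpa using DFunLike.congr_fun h₀ (e₀.symm x))
      (MonoidHom.ext fun x => by simpa using DFunLike.congr_fun h₁ (e₁.symm x))
    ext x
    simpa using DFunLike.congr_fun this (e.symm x)

theorem ContinuousMap.joined {X : Type*} [TopologicalSpace X] (f : C(I, X)) :
    Joined (f 0) (f 1) := ⟨⟨f, rfl, rfl⟩⟩

namespace HopfLikeLink

variable (L : HopfLikeLink)

/-- The annulus `3/4 < Re zᵢ ≤ 4/5` of the middle part is path connected. -/
theorem joined_cap_inter_middle (i : Fin 2) (x : L.exterior) (hx : x ∈ L.cap i)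
    (hx' : x ∈ L.middle) :
    Joined (⟨L.capBase i, L.capBase_mem_cap i, L.capBase_mem_middle i⟩ : ↥(L.cap i ∩ L.middle))
      ⟨x, hx, hx'⟩ := by
  set d := Complex.direction ((L.h.symm x).1 (1 - i)) with hd
  let A : C(I, ↥(L.cap i ∩ L.middle)) :=
    ⟨fun t => ⟨L.point (polar_fourFifths_mem i (Circle.exp (t * Complex.arg d))).2,
      L.point_mem_cap (polar_fourFifths_mem i _).2 (polar_fourFifths_mem i _).1,
      L.point_mem_middle (polar_fourFifths_mem i _).2⟩,
      Continuous.subtype_mk (L.continuous_point (S3.continuous_polar i continuous_const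
        (by fun_prop)) _) _⟩
  let B : C(I, ↥(L.cap i ∩ L.middle)) :=
    ⟨fun s => ⟨L.point (pushToCircle_mem hx' hx s).2,
      L.point_mem_cap (pushToCircle_mem hx' hx s).2 (pushToCircle_mem hx' hx s).1,
      L.point_mem_middle (pushToCircle_mem hx' hx s).2⟩,
      Continuous.subtype_mk (L.continuous_point (continuous_pushToCircle i continuous_id
        continuous_const fun _ => hx') _) _⟩
  have hA0 : A 0 = ⟨L.capBase i, L.capBase_mem_cap i, L.capBase_mem_middle i⟩ := by
    refine Subtype.ext (L.point_congr ?_ (polar_fourFifths_mem i _).2 (circlePoint_mem i 0))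
    rw [circlePoint_eq_polar]
    simp
  have hB0 : B 0 = ⟨x, hx, hx'⟩ := by
    refine Subtype.ext (Subtype.ext ?_)
    change L.h (pushToCircle i 0 (L.h.symm x)) = x
    rw [pushToCircle_zero, L.h.apply_symm_apply]
  have h1 : A 1 = B 1 := by
    refine Subtype.ext (L.point_congr ?_ (polar_fourFifths_mem i _).2
      (pushToCircle_mem hx' hx 1).2)
    rw [pushToCircle_one, ← hd]
    refine congrArg (S3.polar i (discPoint fourFifths 1)) ?_
    simp
  rw [← hA0, ← hB0]
  exact A.joined.trans (h1 ▸ B.joined.symm)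

/-- The homomorphism from `π₁` of the open ball `Re zᵢ > 3/4` in the link exterior. -/
noncomputable def capHom (i : Fin 2) :
    FundamentalGroup (L.cap i) ⟨L.capBase i, L.capBase_mem_cap i⟩ →*
      FundamentalGroup L.exterior L.torusBase :=
  subsetHom (L.capBase_mem_cap i) (L.arc i).ofSubset

/-- The loops in the middle part of the link exterior come from the fundamental group `ℤ²` of
a torus, which is generated by the two meridians. -/
theorem exists_hom_middle : ∃ Θ : Multiplicative (Fin 2 → ℤ) →*
      FundamentalGroup L.exterior L.torusBase,
    (∀ c : Path (⟨L.torusBase, L.torusBase_mem_middle⟩ : L.middle)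
        ⟨L.torusBase, L.torusBase_mem_middle⟩,
      FundamentalGroup.fromPath (.mk c.ofSubset) ∈ Θ.range) ∧
    ∀ i, Θ (Multiplicative.ofAdd (Pi.single (1 - i) 1)) =
      L.capHom i (FundamentalGroup.fromPath (.mk (L.capMeridian i))) := by
  obtain ⟨Θ, h, h'⟩ := L.exists_torusHom (PathCocycle.tautological L.torusBase)
  refine ⟨Θ, fun c => ⟨_, (h c).symm.trans (PathCocycle.tautological_loop _)⟩, fun i => ?_⟩
  rw [h', ← MonoidHom.id_apply _ (L.capHom i _), ← PathCocycle.toHom_tautological, capHom,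
    PathCocycle.toHom_subsetHom]
  rfl

/-- On the ball `Re zᵢ > 3/4`, the coordinate `zᵢ` has positive real part and does not wind. -/
theorem windingCocycle_cap (i : Fin 2)
    (c : Path (⟨L.capBase i, L.capBase_mem_cap i, L.capBase_mem_middle i⟩ :
      ↥(L.cap i ∩ L.middle)) ⟨L.capBase i, L.capBase_mem_cap i, L.capBase_mem_middle i⟩) :
    (L.windingCocycle i).toFun (c.toSuperset Set.inter_subset_right) = 1 :=
  Circle.winding_eq_one _ fun t => Complex.direction_re_pos ((c t).2.1.trans' (by norm_num))

/-- Homomorphisms `f i` on the groups of the two balls, under which the meridians commute, extend to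
the link group. On the middle part, they are extended by `h₀ ^ N₁ * h₁ ^ N₀`, where `hᵢ` is the
image of the meridian of `Kᵢ`, and where `Nⱼ` is the winding number of `zⱼ`: the meridian of `Kᵢ`
winds once in the coordinate `z₁₋ᵢ`, which vanishes on `Hᵢ`. -/
theorem exists_hom_of_capHom {H : Type*} [Group H]
    (f : ∀ i, FundamentalGroup (L.cap i) ⟨L.capBase i, L.capBase_mem_cap i⟩ →* H)
    (hf : Commute (f 0 (FundamentalGroup.fromPath (.mk (L.capMeridian 0))))
      (f 1 (FundamentalGroup.fromPath (.mk (L.capMeridian 1))))) :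
    ∃ F : FundamentalGroup L.exterior L.torusBase →* H, ∀ i, F.comp (L.capHom i) = f i := by
  set h := fun i => f i (FundamentalGroup.fromPath (.mk (L.capMeridian i))) with hh
  refine exists_hom_of_cover L.isOpen_cap L.isOpen_waist L.mem_waist_or_cap L.waist_subset_middle
    L.disjoint_cap L.capBase_mem_cap L.capBase_mem_middle L.joined_cap_inter_middle
    L.torusBase_mem_middle L.arc f
    (((L.windingCocycle 1).zpow (h 0)).mulOfCommute ((L.windingCocycle 0).zpow (h 1))
      fun p p' => hf.zpow_zpow _ _) (fun i => ?_) fun i c => ?_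
  · change h 0 ^ ((L.windingCocycle 1).toFun (L.arc i)).toAdd *
      h 1 ^ ((L.windingCocycle 0).toFun (L.arc i)).toAdd = 1
    simp [windingCocycle_arc]
  · obtain ⟨Θ, h1, h2⟩ := L.exists_collarHom i ((PathCocycle.tautological
      (⟨L.capBase i, L.capBase_mem_cap i⟩ : L.cap i)).mapHom (f i))
    have key : f i (FundamentalGroup.fromPath (.mk (c.toSuperset Set.inter_subset_left))) =
        h i ^ ((L.windingCocycle (1 - i)).toFun (c.toSuperset Set.inter_subset_right)).toAdd := by
      rw [← PathCocycle.tautological_loop]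
      refine (h1 c).trans ?_
      rw [Multiplicative.hom_int_apply, h2]
      refine congrArg (· ^ _) ?_
      exact congrArg (f i) (PathCocycle.tautological_loop _)
    rw [key]
    change _ = h 0 ^ ((L.windingCocycle 1).toFun _).toAdd *
      h 1 ^ ((L.windingCocycle 0).toFun _).toAdd
    have hi := L.windingCocycle_cap i c
    fin_cases i
    · refine (mul_one _).symm.trans (congrArg _ ?_)
      exact ((congrArg (fun a : Multiplicative ℤ => h 1 ^ a.toAdd) hi).trans (zpow_zero _)).symm
    · refine (one_mul _).symm.trans (congrArg (· * _) ?_)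
      exact ((congrArg (fun a : Multiplicative ℤ => h 0 ^ a.toAdd) hi).trans (zpow_zero _)).symm

/-- The link group, based on the torus, is the pushout of the groups of the two pieces, subject to
the relation that the meridians commute. -/
theorem isCommutingPushout_capHom : IsCommutingPushout.{u} (L.capHom 0) (L.capHom 1)
    (FundamentalGroup.fromPath (.mk (L.capMeridian 0)))
    (FundamentalGroup.fromPath (.mk (L.capMeridian 1))) := by
  obtain ⟨Θ, hC, hm⟩ := L.exists_hom_middle
  refine ⟨?_, fun H _ f₀ f₁ hf => ?_, fun H _ F F' h₀ h₁ => ?_⟩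
  · rw [← hm, ← hm]
    exact (Commute.all _ _).map Θ
  · obtain ⟨F, hF⟩ := L.exists_hom_of_capHom (fun | 0 => f₀ | 1 => f₁) hf
    exact ⟨F, hF 0, hF 1⟩
  · have hF : ∀ i g, F (L.capHom i g) = F' (L.capHom i g) := fun i g => by
      fin_cases i
      · exact DFunLike.congr_fun h₀ g
      · exact DFunLike.congr_fun h₁ g
    refine hom_ext_of_cover L.isOpen_cap L.isOpen_waist L.mem_waist_or_cap L.waist_subset_middle
      L.disjoint_cap L.capBase_mem_cap L.capBase_mem_middle L.joined_cap_inter_middle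
      L.torusBase_mem_middle L.arc F F' hF fun c => ?_
    obtain ⟨a, ha⟩ := hC c
    rw [← ha]
    have hs : ∀ i, F (Θ (Multiplicative.ofAdd (Pi.single i 1))) =
        F' (Θ (Multiplicative.ofAdd (Pi.single i 1))) := fun i => by
      have := hm (1 - i)
      rw [sub_sub_cancel] at this
      rw [this, hF]
    have hab : a = Multiplicative.ofAdd (Pi.single 0 1) ^ (a.toAdd 0) *
        Multiplicative.ofAdd (Pi.single 1 1) ^ (a.toAdd 1) := by
      rw [← ofAdd_zsmul, ← ofAdd_zsmul, ← ofAdd_add]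
      refine congrArg Multiplicative.ofAdd (funext fun i => ?_)
      fin_cases i <;> simp <;> rfl
    rw [hab]
    simp only [map_mul, map_zpow, hs]

/-- The link group is, up to conjugation, the pushout of the groups of the two pieces, subject to
the relation that the meridians commute. -/
theorem exists_isCommutingPushout {x₀ : L.exterior}
    (γ : ∀ i, Path (L.pieceToLink i (L.pieceBase i)) x₀) :
    ∃ (j : ∀ i, FundamentalGroup (L.piece i) (L.pieceBase i) →* FundamentalGroup L.exterior x₀)
      (c : Fin 2 → FundamentalGroup L.exterior x₀),
      IsCommutingPushout.{u} (j 0) (j 1) (L.meridian 0) (L.meridian 1) ∧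
      ∀ i g, j i g = c i * L.toLinkGroup i (γ i) g * (c i)⁻¹ := by
  let e : ∀ i, FundamentalGroup (L.piece i) (L.pieceBase i) ≃*
      FundamentalGroup (L.cap i) ⟨L.capBase i, L.capBase_mem_cap i⟩ := fun i =>
    MulEquiv.ofBijective (FundamentalGroup.map (L.pieceToCap i) (L.pieceBase i))
      (L.map_pieceToCap_bijective i _)
  let q : Path L.torusBase x₀ := (L.arc 0).ofSubset.trans (γ 0)
  let T := FundamentalGroup.fundamentalGroupMulEquivOfPath q
  refine ⟨fun i => (T.toMonoidHom.comp (L.capHom i)).comp (e i).toMonoidHom,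
    fun i => FundamentalGroup.fromPath (.mk ((γ i).symm.trans ((L.arc i).ofSubset.symm.trans q))),
    IsCommutingPushout.congr (e 0) (e 1) T L.isCommutingPushout_capHom, fun i g => ?_⟩
  have h : L.capHom i (e i g) =
      FundamentalGroup.fundamentalGroupMulEquivOfPath (L.arc i).ofSubset.symm
        (FundamentalGroup.map (L.pieceToLink i) (L.pieceBase i) g) := by
    induction g using Quotient.ind
    rfl
  refine (congrArg T h).trans ?_
  exact (FundamentalGroup.fundamentalGroupMulEquivOfPath_trans (L.arc i).ofSubset.symm q _).symm.trans
    (FundamentalGroup.fundamentalGroupMulEquivOfPath_conj _ (γ i) _)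

end HopfLikeLink

end VanKampen

/-! ### The twisted Alexander polynomial of a Hopf-like link -/

/-- A homomorphism to a torsion-free abelian group factors through the free abelian quotient. -/
theorem IsNaturalSurjection.eq_one_of_eq_one {G A B : Type*} [Group G] [AddCommGroup A]
    [AddCommGroup B] [IsMulTorsionFree (Multiplicative B)] {ψ : G →* Multiplicative A}
    (h : IsNaturalSurjection ψ) (χ : G →* Multiplicative B) {g : G} (hg : ψ g = 1) : χ g = 1 := by
  have := (Abelianization.lift χ).isOfFinOrder ((h.2 g).1 hg)
  rw [Abelianization.lift_apply_of] at this
  exact (isOfFinOrder_iff_eq_one _).1 this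

/-- A homomorphism `χ` from a group with free abelian quotient `ℤ` to a torsion-free abelian group
is determined by the image of an element `m` that generates the quotient. -/
theorem IsNaturalSurjection.apply_eq_zpow {G B : Type*} [Group G] [AddCommGroup B]
    [IsMulTorsionFree (Multiplicative B)] {ψ : G →* Multiplicative ℤ} (h : IsNaturalSurjection ψ)
    {m : G} (hm : ψ m = Multiplicative.ofAdd 1) (χ : G →* Multiplicative B) (g : G) :
    χ g = χ m ^ (ψ g).toAdd := by
  have hg : ψ (g * (m ^ (ψ g).toAdd)⁻¹) = 1 := by
    rw [map_mul, map_inv, map_zpow, hm, ← ofAdd_zsmul, mul_inv_eq_one]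
    simp
  have := h.eq_one_of_eq_one χ hg
  rwa [map_mul, map_inv, map_zpow, mul_inv_eq_one] at this

theorem proposition5p1 {F : Type*} [Field F] {k : ℕ} (L : HopfLikeLink)
    -- base point of `X(L)`, and paths joining it to the pieces `Pᵢ`
    (x₀ : L.exterior) (γ : ∀ i, Path (L.pieceToLink i (L.pieceBase i)) x₀)
    -- `FH₁(X(L))` is identified with `ℤ²` and `FH₁(X(Kᵢ))` with `ℤ`, by means of the meridians
    (ψ : FundamentalGroup L.exterior x₀ →* Multiplicative (Fin 2 → ℤ))
    (hψ : IsNaturalSurjection ψ)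
    (hψμ : ∀ i, ψ (L.toLinkGroup i (γ i) (L.meridian i)) = Multiplicative.ofAdd (Pi.single i 1))
    (ψK : ∀ i, FundamentalGroup (L.K i).exterior (L.knotBase i) →* Multiplicative ℤ)
    (hψK : ∀ i, IsNaturalSurjection (ψK i))
    (hψKμ : ∀ i, ψK i (L.toKnotGroup i (L.meridian i)) = Multiplicative.ofAdd 1)
    -- the representation of `π₁(X(L))`, and those it induces on `π₁(X(Kᵢ)) ≅ π₁(Pᵢ)`
    (α : FundamentalGroup L.exterior x₀ →* GL (Fin k) F)
    (αK : ∀ i, FundamentalGroup (L.K i).exterior (L.knotBase i) →* GL (Fin k) F)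
    (hαK : ∀ i, (αK i).comp (L.toKnotGroup i) = α.comp (L.toLinkGroup i (γ i)))
    -- the polynomials `Δ_{Kᵢ}^α` and `Δ_{Kᵢ}^{α,0}`
    (ΔK ΔK0 : Fin 2 → LaurentPolynomial F)
    (hΔK : ∀ i, IsTwistedAlexander (αK i) (ψK i) 1 (ΔK i))
    (hΔK0 : ∀ i, IsTwistedAlexander (αK i) (ψK i) 0 (ΔK0 i))
    (hne : ∀ i, ΔK i ≠ 0) :
    (∀ i, ΔK0 i ≠ 0) ∧
    ∃ Δ : Fin 2 → LaurentPolynomial F,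
      (∀ i, Δ i * ΔK0 i =
        ΔK i * detPolynomial (α (L.toLinkGroup i (γ i) (L.meridian i)))) ∧
      (∀ ΔL : AddMonoidAlgebra F (Fin 2 → ℤ),
        IsTwistedAlexander α ψ 1 ΔL ↔
          Associated ΔL (inVariable F 0 (Δ 0) * inVariable F 1 (Δ 1))) ∧
      ∀ i, (laurentWidth (Δ i) : ℤ) =
        (laurentWidth (ΔK i) : ℤ) + (k : ℤ) - (laurentWidth (ΔK0 i) : ℤ) := by
  let κ := fun i => MulEquiv.ofBijective (L.toKnotGroup i) (L.toKnotGroup_bijective i)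
  have hα : ∀ i g, αK i (κ i g) = α (L.toLinkGroup i (γ i) g) := fun i g =>
    DFunLike.congr_fun (hαK i) g
  have hψι : ∀ i g, ψ (L.toLinkGroup i (γ i) g) = Multiplicative.ofAdd
      (Pi.single i (Multiplicative.toAdd (ψK i (κ i g)))) := fun i g => by
    have := (hψK i).apply_eq_zpow (hψKμ i) ((ψ.comp (L.toLinkGroup i (γ i))).comp
      (κ i).symm.toMonoidHom) (κ i g)
    have hm : (κ i).symm (L.toKnotGroup i (L.meridian i)) = L.meridian i :=
      (κ i).symm_apply_apply (L.meridian i)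
    simp only [MonoidHom.comp_apply, MulEquiv.coe_toMonoidHom, MulEquiv.symm_apply_apply, hm,
      hψμ] at this
    rw [this, ← ofAdd_zsmul, ← Pi.single_smul, smul_eq_mul, mul_one]
  have h1 : ∀ i, IsOrder (FoxModule.H1 (twistedRep (αK i) (ψK i))) (ΔK i) := fun i =>
    (nonempty_twistedHomology_one_equiv (αK i) (ψK i)).elim fun e => (hΔK i).of_equiv e
  have h0 : ∀ i, IsOrder (FoxModule.H0 (twistedRep (αK i) (ψK i))) (ΔK0 i) := fun i =>
    (nonempty_twistedHomology_zero_equiv (αK i) (ψK i)).elim fun e => (hΔK0 i).of_equiv e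
  have hdvd := fun i => IsOrder.H0_ne_zero_and_dvd (hψKμ i) (h0 i)
  refine ⟨fun i => (hdvd i).1, ?_⟩
  choose e he using fun i => (hdvd i).2
  have hαm : ∀ i, αK i (L.toKnotGroup i (L.meridian i)) =
    α (L.toLinkGroup i (γ i) (L.meridian i)) := fun i =>
    hα i (L.meridian i)
  have hΔ : ∀ i, ΔK i * e i * ΔK0 i =
      ΔK i * detPolynomial (αK i (L.toKnotGroup i (L.meridian i))) := fun i => by
    rw [he]
    ring
  -- `e i` is the quotient of `det (α (μᵢ) x - 1)` by the order of `H₀`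
  refine ⟨fun i => ΔK i * e i, fun i => ?_, fun d => ?_, fun i => ?_⟩
  · rw [← hαm]
    exact hΔ i
  · obtain ⟨j, c, hpush, hj⟩ := L.exists_isCommutingPushout γ
    obtain ⟨E⟩ := nonempty_twistedHomology_one_equiv α ψ
    refine Iff.trans ⟨fun h => IsOrder.of_equiv h E, fun h => IsOrder.of_equiv h E.symm⟩ ?_
    exact hpush.isOrder_H1_iff hj hα hψι hψKμ h1 h0 hne hΔ d
  · have hdet := detPolynomial_ne_zero (αK i (L.toKnotGroup i (L.meridian i)))
    have hk := laurentWidth_detPolynomial (αK i (L.toKnotGroup i (L.meridian i)))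
    rw [he] at hdet hk
    rw [laurentWidth_mul (hdvd i).1 (right_ne_zero_of_mul hdet)] at hk
    rw [laurentWidth_mul (hne i) (right_ne_zero_of_mul hdet), ← hk]
    push_cast
    ring
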